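/- Let $\mathcal B$ (the body) and $\mathcal S$ (the ambient space) be smooth Hausdorff $n$-manifolds without boundary, $n\ge 1$; $\mathcal S$ carries a fixed Riemannian metric $\mathbf g$ and $\mathcal B$ a time-dependent Riemannian metric $\mathbf G(X,t)$, with volume element $dV$. Let $\varphi_t:\mathcal B\to\mathcal S$ be a motion, each $\varphi_t$ being injective with invertible tangent map $\mathbf F=T\varphi_t$; let $\mathbf V$ and $\mathbf A$ be its velocity and (Levi-Civita) acceleration. Let $\rho_0>0$ be the mass density, $S_m$ the mass source, $\mathbf B$ the body force, $\mathbf P=(P^{aA})$ the first Piola–Kirchhoff stress, $\mathbf Q$ the heat flux vector, $R$ the heat supply, $\Theta>0$ the temperature and $\mathsf N$ the specific entropy. All fields are smooth in $(X,t)$. The internal energy $E=E(X,\mathsf N,\mathbf G,\mathbf F,\mathbf g\circ\varphi)$ and the free energy $\Psi=\Psi(X,\Theta,\mathbf G,\mathbf F,\mathbf g\circ\varphi)$ are smooth response functions that are tensorial, i.e. unchanged when $\mathbf F$ and $\mathbf g$ are pushed forward by a diffeomorphism of $\mathcal S$, and $E=\Psi+\Theta\mathsf N$ along the process. With traction $\mathbf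 T=\mathbf P\hat{\mathbf N}$ and $H=-\langle\!\langle\mathbf Q,\hat{\mathbf N}\rangle\!\rangle$ on a surface with outward unit normal $\hat{\mathbf N}$, the energy balance at time $t_0$ is $$\frac{d}{dt}\int_{\mathcal U}\rho_0\Big(E+\tfrac12\langle\!\langle\mathbf V,\mathbf V\rangle\!\rangle\Big)dV=\int_{\mathcal U}\Big\{\rho_0\big(\langle\!\langle\mathbf B,\mathbf V\rangle\!\rangle+R\big)+\rho_0\frac{\partial E}{\partial\mathbf G}:\frac{\partial\mathbf G}{\partial t}+S_m\Big(E+\tfrac12\langle\!\langle\mathbf V,\mathbf V\rangle\!\rangle\Big)\Big\}dV+\int_{\partial\mathcal U}\big(\langle\!\langle\mathbf T,\mathbf V\rangle\!\rangle+H\big)dA$$ for every subbody $\mathcal U$ (it is enough to take the closed coordinate boxes of charts of $\mathcal B$). Suppose that the energy balance holds at $t_0$, and that it is covariant at $t_0$: for every smooth family of diffeomorphisms $\xi_t:\mathcal S\to\mathcal S$ with $\xi_{t_0}=\mathrm{id}$ and every smooth $\zeta_t>0$ with $\zeta_{t_0}=1$ (the increasing temperature rescalings $\theta\mapsto\zeta_t\theta$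 of $\mathbb R^+$), there are fields $\mathsf N'$ (smooth) and $R'$ with $$\mathsf N'|_{t_0}=\mathsf N|_{t_0},\qquad \frac{\partial\mathsf N'}{\partial t}\Theta'-R'=\zeta\Big(\frac{\partial\mathsf N}{\partial t}\Theta-R\Big),\qquad E'=\Psi'+\Theta'\mathsf N',$$ such that the same energy balance holds at $t_0$ for the process with $\varphi'=\xi_t\circ\varphi$, $\Theta'=\zeta\Theta$, $\mathbf G'=\mathbf G$, $\rho_0'=\rho_0$, $S_m'=S_m$, $\mathbf B'-\mathbf A'=\xi_{t*}(\mathbf B-\mathbf A)$, $\mathbf P'=\xi_{t*}\mathbf P$, $\mathbf Q'=\zeta\mathbf Q$, entropy $\mathsf N'$ and heat supply $R'$, where $E'$, $\Psi'$ are the same response functions $E$, $\Psi$ evaluated on the primed fields. Then at time $t_0$, at every $X\in\mathcal B$, $$\frac{\partial\rho_0}{\partial t}+\tfrac12\rho_0\operatorname{tr}\Big(\frac{\partial\mathbf G}{\partial t}\Big)=S_m,\qquad \operatorname{Div}\mathbf P+\rho_0\mathbf B=\rho_0\mathbf A,\qquad \boldsymbol\tau^{\mathsf T}=\boldsymbol\tau\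 \ (\tau^{ab}=P^{aA}F^b{}_A),$$ $$\rho_0\frac{\partial\Psi}{\partial\mathbf F}=\mathbf P,\qquad \frac{\partial\Psi}{\partial\Theta}=-\mathsf N .$$ (No entropy inequality is assumed.) -/

import Mathlib

open scoped Manifold ContDiff Topology

noncomputable section

namespace GrowthMechanics

/-- The coordinate space `ℝⁿ` with `n = d + 1 ≥ 1`. -/
abbrev Vec (d : ℕ) : Type := Fin (d + 1) → ℝ

/-- The model of smooth `n`-manifolds without boundary, `n = d + 1`. -/
abbrev mdl (d : ℕ) : ModelWithCorners ℝ (Vec d) (Vec d) := 𝓘(ℝ, Vec d)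

/-- The tangent space `T_x M` of an `n`-manifold. -/
abbrev Tan (d : ℕ) {M : Type*} [TopologicalSpace M] [ChartedSpace (Vec d) M] (x : M) : Type :=
  TangentSpace (mdl d) x

/-- Covariant tensors of rank two at a point. -/
abbrev Bil (d : ℕ) {M : Type*} [TopologicalSpace M] [ChartedSpace (Vec d) M] (x : M) : Type :=
  Tan d x →L[ℝ] Tan d x →L[ℝ] ℝ

/-- Covectors at a point. -/
abbrev Cotan (d : ℕ) {M : Type*} [TopologicalSpace M] [ChartedSpace (Vec d) M] (x : M) : Type :=
  Tan d x →L[ℝ] ℝ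

/-- Smooth Riemannian metrics on `M`. -/
abbrev Metric (d : ℕ) (M : Type*) [TopologicalSpace M] [ChartedSpace (Vec d) M]
    [IsManifold (mdl d) ∞ M] : Type _ :=
  Bundle.ContMDiffRiemannianMetric (mdl d) ∞ (Vec d) (fun x : M => TangentSpace (mdl d) x)

/-- The `A`-th standard basis vector of `ℝⁿ`. -/
abbrev stdVec {d : ℕ} (A : Fin (d + 1)) : Vec d := Pi.single A 1

/-- The pull-back `(v, w) ↦ b(Lv, Lw)` of a bilinear form by a linear map. -/
def pullBack {E F : Type*} [AddCommGroup E] [Module ℝ E] [TopologicalSpace E]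
    [AddCommGroup F] [Module ℝ F] [TopologicalSpace F]
    (b : F →L[ℝ] F →L[ℝ] ℝ) (L : E →L[ℝ] F) : E →L[ℝ] E →L[ℝ] ℝ :=
  (ContinuousLinearMap.precomp ℝ L).comp (b.comp L)

section Coordinates

variable {d : ℕ} {M : Type*} [TopologicalSpace M] [ChartedSpace (Vec d) M]

/-- The coordinate vector `∂/∂X^A` of the chart `e` at the point with coordinates `y`. -/
def coordVec (e : OpenPartialHomeomorph M (Vec d)) (y : Vec d) (A : Fin (d + 1)) :
    Tan d (e.symm y) :=
  mfderiv (mdl d) (mdl d) e.symm y (stdVec A)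

/-- The coordinate covector `dX^A` of the chart `e` at the point with coordinates `y`. -/
def coordCovec (e : OpenPartialHomeomorph M (Vec d)) (y : Vec d) (A : Fin (d + 1)) :
    Cotan d (e.symm y) :=
  (ContinuousLinearMap.proj (R := ℝ) (φ := fun _ : Fin (d + 1) => ℝ) A).comp
    (mfderiv (mdl d) (mdl d) e (e.symm y))

/-- The components `h_AB` of a field of bilinear forms in the chart `e`, as functions of the
coordinates. -/
def components (h : (x : M) → Bil d x) (e : OpenPartialHomeomorph M (Vec d)) (y : Vec d) :
    Matrix (Fin (d + 1)) (Fin (d + 1)) ℝ :=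
  Matrix.of fun A B => h (e.symm y) (coordVec e y A) (coordVec e y B)

/-- The Christoffel symbols `Γ^a_{bc}` of the Levi-Civita connection of a metric with components
`h` in a chart. -/
def christoffel (h : Vec d → Matrix (Fin (d + 1)) (Fin (d + 1)) ℝ) (y : Vec d)
    (a b c : Fin (d + 1)) : ℝ :=
  (1 / 2) * ∑ k, (h y)⁻¹ a k *
    (fderiv ℝ (fun z => h z k c) y (stdVec b) + fderiv ℝ (fun z => h z k b) y (stdVec c)
      - fderiv ℝ (fun z => h z b c) y (stdVec k))

/-- Density of the Riemannian volume element `dV` in a chart. -/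
def volDensity (h : Matrix (Fin (d + 1)) (Fin (d + 1)) ℝ) : ℝ := Real.sqrt h.det

/-- Density of the Riemannian area element `dA` on a hypersurface `X^A = const` of a chart: the
root of the determinant of the metric induced on the hypersurface. -/
def areaDensity (h : Matrix (Fin (d + 1)) (Fin (d + 1)) ℝ) (A : Fin (d + 1)) : ℝ :=
  Real.sqrt (h.submatrix A.succAbove A.succAbove).det

/-- The unit conormal `dX^A / |dX^A|` of a hypersurface `X^A = const`, pointing towards
increasing `X^A`. -/
def unitConormal (h : (x : M) → Bil d x) (e : OpenPartialHomeomorph M (Vec d)) (y : Vec d)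
    (A : Fin (d + 1)) : Cotan d (e.symm y) :=
  (Real.sqrt ((components h e y)⁻¹ A A))⁻¹ • coordCovec e y A

/-- The trace `h^{AB} b_AB` of a bilinear form `b` with respect to an inner product `h` on a
tangent space. -/
def traceForm {x : M} (h b : Bil d x) : ℝ :=
  ∑ A, ∑ B, (Matrix.of fun I J : Fin (d + 1) =>
      h (stdVec I : Vec d) (stdVec J : Vec d))⁻¹ A B *
    b (stdVec A : Vec d) (stdVec B : Vec d)

/-- The acceleration `∇_{ċ} ċ` of a curve `c` in a Riemannian manifold, in components
`c̈^a + γ^a_{bc} ċ^b ċ^c`. The chart is the preferred chart at `c t`, in which the components of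
a tangent vector at `c t` are the vector itself. -/
def acceleration [IsManifold (mdl d) ∞ M] (g : Metric d M) (c : ℝ → M) (t : ℝ) : Tan d (c t) :=
  let f := chartAt (Vec d) (c t)
  let u : ℝ → Vec d := fun s => f (c s)
  let γ := christoffel (components g.inner f) (u t)
  ((fun a => deriv (deriv u) t a + ∑ b, ∑ k, γ a b k * deriv u t b * deriv u t k : Vec d))

/-- `b` is symmetric and positive definite. -/
def IsInner {x : M} (b : Bil d x) : Prop :=
  (∀ v w, b v w = b w v) ∧ ∀ v, v ≠ 0 → 0 < b v v

end Coordinates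

section Bodies

variable {d : ℕ} {B S : Type*} [TopologicalSpace B] [ChartedSpace (Vec d) B]
  [IsManifold (mdl d) ∞ B] [TopologicalSpace S] [ChartedSpace (Vec d) S] [IsManifold (mdl d) ∞ S]

variable (d B S) in
/-- The fields of a growing body `B` moving in the ambient space `S`. -/
structure GrowthProcess where
  /-- the motion `φ_t : B → S` -/
  φ : ℝ → B → S
  /-- the evolving material metric -/
  G : ℝ → Metric d B
  /-- material mass density -/
  ρ : ℝ → B → ℝ
  /-- mass source -/
  Sm : ℝ → B → ℝ
  /-- body force per unit undeformed mass -/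
  force : (t : ℝ) → (X : B) → Tan d (φ t X)
  /-- first Piola–Kirchhoff stress, the two-point tensor `P^{aA}` -/
  P : (t : ℝ) → (X : B) → Cotan d X →L[ℝ] Tan d (φ t X)
  /-- heat flux vector -/
  Q : (t : ℝ) → (X : B) → Tan d X
  /-- heat supply per unit undeformed mass -/
  R : ℝ → B → ℝ
  /-- absolute temperature -/
  Θ : ℝ → B → ℝ
  /-- specific entropy -/
  N : ℝ → B → ℝ

variable (d B S) in
/-- A scalar response function of the material point, a thermal variable (entropy or temperature),
the material metric, the place, the deformation gradient, and the spatial metric at that place. -/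
abbrev Response : Type _ :=
  (X : B) → ℝ → Bil d X → (x : S) → (Tan d X →L[ℝ] Tan d x) → Bil d x → ℝ

/-- The response function in terms of coordinates of the material point and of the place, and of
the components of its tensorial arguments. -/
def Response.inCharts (W : Response d B S) (e : OpenPartialHomeomorph B (Vec d))
    (f : OpenPartialHomeomorph S (Vec d)) :
    Vec d × ℝ × (Vec d →L[ℝ] Vec d →L[ℝ] ℝ) × Vec d × (Vec d →L[ℝ] Vec d) ×
      (Vec d →L[ℝ] Vec d →L[ℝ] ℝ) → ℝ :=
  fun q =>
    let De : Tan d (e.symm q.1) →L[ℝ] Vec d := mfderiv (mdl d) (mdl d) e (e.symm q.1)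
    let Df : Tan d (f.symm q.2.2.2.1) →L[ℝ] Vec d :=
      mfderiv (mdl d) (mdl d) f (f.symm q.2.2.2.1)
    let Dfi : Vec d →L[ℝ] Tan d (f.symm q.2.2.2.1) :=
      mfderiv (mdl d) (mdl d) f.symm q.2.2.2.1
    W (e.symm q.1) q.2.1 (pullBack q.2.2.1 De) (f.symm q.2.2.2.1)
      (Dfi.comp (q.2.2.2.2.1.comp De)) (pullBack q.2.2.2.2.2 Df)

/-- The response function is smooth at all states with a thermal variable in `T`, positive
definite metrics and invertible deformation gradient. -/
def Response.IsSmooth (W : Response d B S) (T : Set ℝ) : Prop :=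
  ∀ e ∈ atlas (Vec d) B, ∀ f ∈ atlas (Vec d) S,
    ContDiffOn ℝ ∞ (W.inCharts e f)
      {q | q.1 ∈ e.target ∧ q.2.1 ∈ T ∧
        ((∀ v w, q.2.2.1 v w = q.2.2.1 w v) ∧ ∀ v, v ≠ 0 → 0 < q.2.2.1 v v) ∧
        q.2.2.2.1 ∈ f.target ∧ Function.Bijective q.2.2.2.2.1 ∧
        ((∀ v w, q.2.2.2.2.2 v w = q.2.2.2.2.2 w v) ∧ ∀ v, v ≠ 0 → 0 < q.2.2.2.2.2 v v)}

/-- The response function transforms tensorially under spatial diffeomorphisms: its value does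
not change when the deformation gradient and the spatial metric are pushed forward. (Here `h` is
the pushed-forward metric at `ξ x`, so that the metric at `x` is the pull-back of `h`.) -/
def Response.IsTensorial (W : Response d B S) (T : Set ℝ) : Prop :=
  ∀ (ξ : Diffeomorph (mdl d) (mdl d) S S ∞) (X : B) (θ : ℝ) (G : Bil d X) (x : S)
    (F : Tan d X →L[ℝ] Tan d x) (h : Bil d (ξ x)),
    θ ∈ T → IsInner G → Function.Bijective F → IsInner h →
      W X θ G (ξ x) ((mfderiv (mdl d) (mdl d) ξ x).comp F) h =
        W X θ G x F (pullBack h (mfderiv (mdl d) (mdl d) ξ x))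

namespace GrowthProcess

variable (p : GrowthProcess d B S)

/-- The deformation gradient `F = Tφ_t`. -/
def F (t : ℝ) (X : B) : Tan d X →L[ℝ] Tan d (p.φ t X) :=
  mfderiv (mdl d) (mdl d) (p.φ t) X

/-- The material velocity `V = ∂φ/∂t`. -/
def V (t : ℝ) (X : B) : Tan d (p.φ t X) :=
  mfderiv 𝓘(ℝ, ℝ) (mdl d) (fun s => p.φ s X) t (1 : ℝ)

/-- The material acceleration. -/
def A (g : Metric d S) (t : ℝ) (X : B) : Tan d (p.φ t X) :=
  acceleration g (fun s => p.φ s X) t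

/-- The rate `∂G/∂t` of the material metric. -/
def Gdot (t : ℝ) (X : B) : Bil d X :=
  deriv (fun s => (p.G s).inner X) t

/-- The value of a response function along the process, for a given field `θ` of the thermal
variable. -/
def value (g : Metric d S) (W : Response d B S) (θ : ℝ → B → ℝ) (t : ℝ) (X : B) : ℝ :=
  W X (θ t X) ((p.G t).inner X) (p.φ t X) (p.F t X) (g.inner (p.φ t X))

/-- The power density `∂E/∂G : ∂G/∂t` of the evolution of the material metric, per unit mass. -/
def metricPower (g : Metric d S) (E : Response d B S) (t : ℝ) (X : B) : ℝ :=
  deriv (fun s : ℝ => E X (p.N t X) ((p.G t).inner X + s • p.Gdot t X) (p.φ t X) (p.F t X)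
    (g.inner (p.φ t X))) 0

/-- `E + ½⟨⟨V, V⟩⟩`. -/
def specificEnergy (g : Metric d S) (E : Response d B S) (t : ℝ) (X : B) : ℝ :=
  p.value g E p.N t X + (1 / 2) * g.inner (p.φ t X) (p.V t X) (p.V t X)

/-- The supply terms `ρ₀(⟨⟨B, V⟩⟩ + R) + ρ₀ ∂E/∂G : ∂G/∂t + S_m (E + ½⟨⟨V, V⟩⟩)`. -/
def supply (g : Metric d S) (E : Response d B S) (t : ℝ) (X : B) : ℝ :=
  p.ρ t X * (g.inner (p.φ t X) (p.force t X) (p.V t X) + p.R t X)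
    + p.ρ t X * p.metricPower g E t X + p.Sm t X * p.specificEnergy g E t X

/-- The surface power `⟨⟨T, V⟩⟩ + H` on a surface element with outward unit conormal `ν`, where
`T = P ν` is the traction and `H = -⟨Q, ν⟩` the heat flux. -/
def surfacePower (g : Metric d S) (t : ℝ) (X : B) (ν : Cotan d X) : ℝ :=
  g.inner (p.φ t X) (p.P t X ν) (p.V t X) - ν (p.Q t X)

/-- Energy balance for the growing body at time `t₀`, for every subbody that is a coordinate box
`∏ [a_A, b_A]` of a chart `e`. The boundary integral is the sum of the integrals over the faces
`X^A = b_A` (outward conormal `dX^A / |dX^A|`) and `X^A = a_A` (outward conormal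
`-dX^A / |dX^A|`). -/
def EnergyBalance (g : Metric d S) (E : Response d B S) (t₀ : ℝ) : Prop :=
  ∀ e ∈ atlas (Vec d) B, ∀ a b : Vec d, (∀ i, a i < b i) → Set.Icc a b ⊆ e.target →
    HasDerivAt
      (fun t => ∫ y in Set.Icc a b,
        p.ρ t (e.symm y) * p.specificEnergy g E t (e.symm y) *
          volDensity (components (p.G t).inner e y))
      ((∫ y in Set.Icc a b,
          p.supply g E t₀ (e.symm y) * volDensity (components (p.G t₀).inner e y)) +
        ∑ i : Fin (d + 1),
          ((∫ x in Set.Icc (a ∘ i.succAbove) (b ∘ i.succAbove),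
              (fun y : Vec d =>
                p.surfacePower g t₀ (e.symm y) (unitConormal (p.G t₀).inner e y i) *
                  areaDensity (components (p.G t₀).inner e y) i)
                (i.insertNth (α := fun _ => ℝ) (b i) x)) +
            ∫ x in Set.Icc (a ∘ i.succAbove) (b ∘ i.succAbove),
              (fun y : Vec d =>
                p.surfacePower g t₀ (e.symm y) (-unitConormal (p.G t₀).inner e y i) *
                  areaDensity (components (p.G t₀).inner e y) i)
                (i.insertNth (α := fun _ => ℝ) (a i) x)))
      t₀

/-- `E = Ψ + ΘN` along the process. -/
def Helmholtz (g : Metric d S) (E Ψ : Response d B S) : Prop :=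
  ∀ t X, p.value g E p.N t X = p.value g Ψ p.Θ t X + p.Θ t X * p.N t X

/-- The components `P^{aA}` in charts `f` and `e`. -/
def Pcomp (e : OpenPartialHomeomorph B (Vec d)) (f : OpenPartialHomeomorph S (Vec d)) (t : ℝ)
    (y : Vec d) (a A : Fin (d + 1)) : ℝ :=
  (mfderiv (mdl d) (mdl d) f (p.φ t (e.symm y)) (p.P t (e.symm y) (coordCovec e y A)) : Vec d) a

/-- The divergence
`(Div P)^a = ∂P^{aA}/∂X^A + Γ^A_{AB} P^{aB} + γ^a_{bc} F^b_A P^{cA}`, in the preferred charts at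
`X` and `φ_t(X)`, where `Γ` and `γ` belong to `G(·,t)` and `g`. -/
def DivP (g : Metric d S) (t : ℝ) (X : B) : Tan d (p.φ t X) :=
  let e := chartAt (Vec d) X
  let f := chartAt (Vec d) (p.φ t X)
  let y := e X
  let Γ := christoffel (components (p.G t).inner e) y
  let γ := christoffel (components g.inner f) (f (p.φ t X))
  let Fc : Fin (d + 1) → Fin (d + 1) → ℝ := fun b I =>
    fderiv ℝ (fun z => f (p.φ t (e.symm z))) y (stdVec I) b
  ((fun a => ∑ I, fderiv ℝ (fun z => p.Pcomp e f t z a I) y (stdVec I)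
      + ∑ I, ∑ J, Γ I I J * p.Pcomp e f t y a J
      + ∑ I, ∑ b, ∑ c, γ a b c * Fc b I * p.Pcomp e f t y c I : Vec d))

/-- The Kirchhoff stress `τ^{ab} = P^{aA} F^b_A`, as a map from covectors to vectors. -/
def kirchhoff (t : ℝ) (X : B) (α : Cotan d (p.φ t X)) : Tan d (p.φ t X) :=
  p.P t X (α.comp (p.F t X))

/-- The pairing `P : H = g_ab P^{aA} H^b_A` with a two-point tensor `H^b_A`. -/
def stressPairing (g : Metric d S) (t : ℝ) (X : B) (H : Tan d X →L[ℝ] Tan d (p.φ t X)) : ℝ :=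
  ∑ I : Fin (d + 1), g.inner (p.φ t X)
    (p.P t X (ContinuousLinearMap.proj (R := ℝ) (φ := fun _ : Fin (d + 1) => ℝ) I))
    (H (stdVec I : Vec d))

/-- The standing assumptions: all fields are smooth, `φ_t` is invertible and regular, mass density
and temperature are positive. -/
structure IsRegular : Prop where
  φ_smooth : ContMDiff (𝓘(ℝ, ℝ).prod (mdl d)) (mdl d) ∞ (fun q : ℝ × B => p.φ q.1 q.2)
  φ_injective : ∀ t, Function.Injective (p.φ t)
  F_bijective : ∀ t X, Function.Bijective (p.F t X)
  G_smooth : ∀ e ∈ atlas (Vec d) B, ∀ I J, ContDiffOn ℝ ∞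
    (fun q : ℝ × Vec d => components (p.G q.1).inner e q.2 I J) (Set.univ ×ˢ e.target)
  ρ_smooth : ContMDiff (𝓘(ℝ, ℝ).prod (mdl d)) 𝓘(ℝ, ℝ) ∞ (fun q : ℝ × B => p.ρ q.1 q.2)
  Sm_smooth : ContMDiff (𝓘(ℝ, ℝ).prod (mdl d)) 𝓘(ℝ, ℝ) ∞ (fun q : ℝ × B => p.Sm q.1 q.2)
  force_smooth : ContMDiff (𝓘(ℝ, ℝ).prod (mdl d)) (mdl d).tangent ∞
    (fun q : ℝ × B => (⟨p.φ q.1 q.2, p.force q.1 q.2⟩ : TangentBundle (mdl d) S))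
  P_smooth : ∀ e ∈ atlas (Vec d) B, ∀ f ∈ atlas (Vec d) S, ∀ a I, ContDiffOn ℝ ∞
    (fun q : ℝ × Vec d => p.Pcomp e f q.1 q.2 a I)
    {q | q.2 ∈ e.target ∧ p.φ q.1 (e.symm q.2) ∈ f.source}
  Q_smooth : ContMDiff (𝓘(ℝ, ℝ).prod (mdl d)) (mdl d).tangent ∞
    (fun q : ℝ × B => (⟨q.2, p.Q q.1 q.2⟩ : TangentBundle (mdl d) B))
  R_smooth : ContMDiff (𝓘(ℝ, ℝ).prod (mdl d)) 𝓘(ℝ, ℝ) ∞ (fun q : ℝ × B => p.R q.1 q.2)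
  Θ_smooth : ContMDiff (𝓘(ℝ, ℝ).prod (mdl d)) 𝓘(ℝ, ℝ) ∞ (fun q : ℝ × B => p.Θ q.1 q.2)
  N_smooth : ContMDiff (𝓘(ℝ, ℝ).prod (mdl d)) 𝓘(ℝ, ℝ) ∞ (fun q : ℝ × B => p.N q.1 q.2)
  ρ_pos : ∀ t X, 0 < p.ρ t X
  Θ_pos : ∀ t X, 0 < p.Θ t X

end GrowthProcess

variable (d S) in
/-- A change of frame that is the identity at time `t₀`: a smooth family of spatial
diffeomorphisms `ξ_t` and a smooth family of increasing temperature rescalings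
`θ ↦ ζ_t θ` of the positive half-line. -/
structure FrameChange (t₀ : ℝ) where
  ξ : ℝ → Diffeomorph (mdl d) (mdl d) S S ∞
  ξ_smooth : ContMDiff (𝓘(ℝ, ℝ).prod (mdl d)) (mdl d) ∞ (fun q : ℝ × S => ξ q.1 q.2)
  ξ_t₀ : ∀ x, ξ t₀ x = x
  ζ : ℝ → ℝ
  ζ_smooth : ContDiff ℝ ∞ ζ
  ζ_pos : ∀ t, 0 < ζ t
  ζ_t₀ : ζ t₀ = 1

/-- The process seen in the new frame, where `N'` and `R'` are the entropy and the heat supply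
in that frame: `φ' = ξ_t ∘ φ`, `G' = G`, `ρ₀' = ρ₀`, `S_m' = S_m`, `B' - A' = ξ_*(B - A)`,
`P' = ξ_* P` (so `T' = ξ_* T`), `Q' = ζ Q` (a material vector, on which `ξ_*` does not act),
`Θ' = ζ Θ`. -/
def GrowthProcess.transform (p : GrowthProcess d B S) (g : Metric d S) {t₀ : ℝ} (c : FrameChange d S t₀)
    (N' R' : ℝ → B → ℝ) : GrowthProcess d B S where
  φ t X := c.ξ t (p.φ t X)
  G := p.G
  ρ := p.ρ
  Sm := p.Sm
  force t X := acceleration g (fun s => c.ξ s (p.φ s X)) t +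
    mfderiv (mdl d) (mdl d) (c.ξ t) (p.φ t X) (p.force t X - p.A g t X)
  P t X := (mfderiv (mdl d) (mdl d) (c.ξ t) (p.φ t X)).comp (p.P t X)
  Q t X := c.ζ t • p.Q t X
  R := R'
  Θ t X := c.ζ t * p.Θ t X
  N := N'

/-- Covariance of the energy balance at time `t₀`: it holds in every frame. The fields `N'`, `R'`
in the new frame are only required to be such that `N' = N` at `t₀`, that `E' = Ψ' + Θ'N'`, and
that `(∂N'/∂t) Θ' - R' = ζ ((∂N/∂t) Θ - R)`. -/
def GrowthProcess.EnergyBalanceCovariant (p : GrowthProcess d B S) (g : Metric d S) (E Ψ : Response d B S)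
    (t₀ : ℝ) : Prop :=
  ∀ c : FrameChange d S t₀, ∃ N' R' : ℝ → B → ℝ,
    ContMDiff (𝓘(ℝ, ℝ).prod (mdl d)) 𝓘(ℝ, ℝ) ∞ (fun q : ℝ × B => N' q.1 q.2) ∧
    (∀ X, N' t₀ X = p.N t₀ X) ∧
    (∀ t X, deriv (fun s => N' s X) t * (c.ζ t * p.Θ t X) - R' t X =
      c.ζ t * (deriv (fun s => p.N s X) t * p.Θ t X - p.R t X)) ∧
    (p.transform g c N' R').Helmholtz g E Ψ ∧
    (p.transform g c N' R').EnergyBalance g E t₀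

end Bodies

end GrowthMechanics

end

/-!
The energy balance holds in every frame, so its difference in a moving frame and in the frame at
rest is an identity in the rates of the frame: the velocity `v` and the velocity gradient `L` of
the diffeomorphisms at a point, and the rate `r` of the temperature rescaling. All balance laws
and constitutive relations are obtained by choosing these rates.

*Arbitrary rates.* Given a point of the ambient space, `exists_frameChange` produces a frame
change with any prescribed `v`, `L` and `r`. In a chart its diffeomorphisms are `z ↦ z + η_t w(z)`
with `w` compactly supported and `η` small, and they extend by the identity since the space is
Hausdorff.

*Localization.* Shrinking coordinate boxes and the divergence theorem turn the integral balance
into a pointwise identity (`deriv_eq_add_divergence_of_balance`, applied in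
`transform_local_balance`). The internal energy in the new frame is written as `Ψ' + Θ'N'`. Then
the unknown rate `∂N'/∂t` enters the rate of the energy as `ρ₀ Θ ∂N'/∂t` and, through `R'`, the
supply in the same way, so it cancels; the only response derivative of the internal energy left is
`∂E/∂G`, which does not depend on the frame.

*Acceleration.* The covariant acceleration is used in its Lagrangian form `lowerAcc`, which does
not depend on the chart (`lowerAcc_comp`, `inner_acceleration`). Its power is the rate of the
kinetic energy (`hasDerivAt_kinetic`), so the acceleration of the moving frame drops out, because
`B' - A'` is the push-forward of `B - A`. What remains is linear in the test velocity.

*Virtual power.* Subtracting the identity for `v = 0`, `L = 0`, `r = 0` gives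
`EnergyBalanceCovariant.virtual_power`, valid for all `v`, `L` and `r`:
* `r` alone gives `∂Ψ/∂Θ = -N`;
* `L` alone gives `ρ₀ ∂Ψ/∂F = P`, because `F` is invertible;
* the part quadratic in `v` gives the balance of mass, as `ρ₀` times the volume density has to
  grow at the rate `S_m` times the volume density;
* tensoriality of `Ψ` makes its rate depend on `v` and `L` only through the Lie derivative of the
  metric (`responseDeriv_frame`), hence it vanishes for infinitesimal isometries
  (`EnergyBalanceCovariant.isometry_power`). Skew-symmetric `L` with `v = 0` give the symmetry of
  the Kirchhoff stress; `v` arbitrary with `L = -Γ(·, v)`, that is, `v` parallel at the point,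
  gives the balance of momentum.
-/

noncomputable section

namespace GrowthMechanics

set_option maxSynthPendingDepth 3

/-! ### Derivatives of charts and components of a metric -/

section ChartDerivatives

variable {d : ℕ} {M : Type*} [TopologicalSpace M] [ChartedSpace (Vec d) M]

/-- The derivative of a chart at a point, as an endomorphism of `ℝⁿ`. -/
def chartD (e : OpenPartialHomeomorph M (Vec d)) (x : M) : Vec d →L[ℝ] Vec d :=
  mfderiv (mdl d) (mdl d) e x

/-- The derivative of the inverse of a chart, as an endomorphism of `ℝⁿ`. -/
def chartDi (e : OpenPartialHomeomorph M (Vec d)) (y : Vec d) : Vec d →L[ℝ] Vec d :=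
  mfderiv (mdl d) (mdl d) e.symm y

variable [IsManifold (mdl d) ∞ M]

theorem contMDiffOn_chart {e : OpenPartialHomeomorph M (Vec d)} (he : e ∈ atlas (Vec d) M) :
    ContMDiffOn (mdl d) (mdl d) ∞ e e.source :=
  contMDiffOn_of_mem_maximalAtlas (IsManifold.subset_maximalAtlas he)

theorem contMDiffOn_chart_symm {e : OpenPartialHomeomorph M (Vec d)} (he : e ∈ atlas (Vec d) M) :
    ContMDiffOn (mdl d) (mdl d) ∞ e.symm e.target :=
  contMDiffOn_symm_of_mem_maximalAtlas (IsManifold.subset_maximalAtlas he)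

theorem contMDiffAt_chart {e : OpenPartialHomeomorph M (Vec d)} (he : e ∈ atlas (Vec d) M) {x : M}
    (hx : x ∈ e.source) : ContMDiffAt (mdl d) (mdl d) ∞ e x :=
  (contMDiffOn_chart he).contMDiffAt (e.open_source.mem_nhds hx)

theorem contMDiffAt_chart_symm {e : OpenPartialHomeomorph M (Vec d)} (he : e ∈ atlas (Vec d) M)
    {y : Vec d} (hy : y ∈ e.target) : ContMDiffAt (mdl d) (mdl d) ∞ e.symm y :=
  (contMDiffOn_chart_symm he).contMDiffAt (e.open_target.mem_nhds hy)

theorem chartDi_chartD {e : OpenPartialHomeomorph M (Vec d)} (he : e ∈ atlas (Vec d) M) {x : M}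
    (hx : x ∈ e.source) (v : Vec d) : chartDi e (e x) (chartD e x v) = v :=
  DFunLike.congr_fun ((mdifferentiable_of_mem_atlas (I := mdl d) he).symm_comp_deriv hx) v

theorem chartD_chartDi {e : OpenPartialHomeomorph M (Vec d)} (he : e ∈ atlas (Vec d) M)
    {y : Vec d} (hy : y ∈ e.target) (v : Vec d) : chartD e (e.symm y) (chartDi e y v) = v :=
  DFunLike.congr_fun ((mdifferentiable_of_mem_atlas (I := mdl d) he).comp_symm_deriv hy) v

/-- In the preferred chart at a point, the components of a tangent vector are the vector itself. -/
theorem chartD_chartAt (x : M) : chartD (chartAt (Vec d) x) x = ContinuousLinearMap.id ℝ _ := by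
  have h := mfderiv_chartAt_eq_tangentCoordChange (I := mdl d) (x := x) (y := x)
    (mem_chart_source (Vec d) x)
  ext1 v
  exact (DFunLike.congr_fun h v).trans
    (tangentCoordChange_self (I := mdl d) (mem_extChartAt_source (I := mdl d) x))

theorem chartDi_chartAt (x : M) :
    chartDi (chartAt (Vec d) x) (chartAt (Vec d) x x) = ContinuousLinearMap.id ℝ _ := by
  ext1 v
  have h := chartDi_chartD (chart_mem_atlas (Vec d) x) (mem_chart_source (Vec d) x) v
  rw [chartD_chartAt] at h
  exact h

theorem chartD_bijective {e : OpenPartialHomeomorph M (Vec d)} (he : e ∈ atlas (Vec d) M) {x : M}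
    (hx : x ∈ e.source) : Function.Bijective (chartD e x) := by
  refine Function.bijective_iff_has_inverse.2 ⟨chartDi e (e x), chartDi_chartD he hx, fun v => ?_⟩
  have := chartD_chartDi he (e.map_source hx) v
  rwa [e.left_inv hx] at this

theorem chartDi_bijective {e : OpenPartialHomeomorph M (Vec d)} (he : e ∈ atlas (Vec d) M)
    {y : Vec d} (hy : y ∈ e.target) : Function.Bijective (chartDi e y) := by
  refine Function.bijective_iff_has_inverse.2 ⟨chartD e (e.symm y), chartD_chartDi he hy,
    fun v => ?_⟩
  have := chartDi_chartD he (e.map_target hy) v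
  rwa [e.right_inv hy] at this

/-- A smooth field of tangent vectors along a map has smooth components in a chart. -/
theorem contMDiffAt_chartD_section {N : Type*} {EN : Type*} [NormedAddCommGroup EN]
    [NormedSpace ℝ EN] {HN : Type*} [TopologicalSpace HN] {J : ModelWithCorners ℝ EN HN}
    [TopologicalSpace N] [ChartedSpace HN N]
    {e : OpenPartialHomeomorph M (Vec d)} (he : e ∈ atlas (Vec d) M)
    {b : N → M} {V : N → Vec d} {q : N}
    (hV : ContMDiffAt J (mdl d).tangent ∞
      (fun q => (⟨b q, V q⟩ : TangentBundle (mdl d) M)) q) (hq : b q ∈ e.source) :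
    ContMDiffAt J 𝓘(ℝ, Vec d) ∞ (fun q => chartD e (b q) (V q)) q := by
  have h1 := (contMDiffOn_chart he).contMDiffOn_tangentMapWithin (m := ∞) (by simp)
    e.open_source.uniqueMDiffOn
  have h2 : ContMDiffAt (mdl d).tangent (mdl d).tangent ∞
      (tangentMapWithin (mdl d) (mdl d) e e.source) (⟨b q, V q⟩ : TangentBundle (mdl d) M) := by
    refine h1.contMDiffAt ?_
    exact (e.open_source.preimage (FiberBundle.continuous_proj _ _)).mem_nhds hq
  have h3 := ContMDiffAt.comp (f := fun q => (⟨b q, V q⟩ : TangentBundle (mdl d) M)) q h2 hV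
  have h4 := (contMDiff_snd_tangentBundle_modelSpace (n := ∞) (Vec d) (mdl d)).contMDiffAt.comp q h3
  refine h4.congr_of_eventuallyEq ?_
  have hb : ContinuousAt b q :=
    ((FiberBundle.continuous_proj (Vec d) (TangentSpace (mdl d) : M → Type _)).continuousAt).comp
      hV.continuousAt
  filter_upwards [hb.preimage_mem_nhds (e.open_source.mem_nhds hq)] with q' hq'
  have : mfderivWithin (mdl d) (mdl d) e e.source (b q') = mfderiv (mdl d) (mdl d) e (b q') :=
    mfderivWithin_of_isOpen e.open_source hq'
  simp only [Function.comp, tangentMapWithin, this, chartD]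
  rfl

/-- The coordinate vector fields of a chart are smooth. -/
theorem contMDiffAt_chartDi_section {e : OpenPartialHomeomorph M (Vec d)}
    (he : e ∈ atlas (Vec d) M) {y : Vec d} (hy : y ∈ e.target) (v : Vec d) :
    ContMDiffAt (mdl d) (mdl d).tangent ∞
      (fun y => (⟨e.symm y, chartDi e y v⟩ : TangentBundle (mdl d) M)) y := by
  have h1 := (contMDiffOn_chart_symm he).contMDiffOn_tangentMapWithin (m := ∞) (by simp)
    e.open_target.uniqueMDiffOn
  have h0 : ContMDiffAt (mdl d) (mdl d).tangent ∞
      (fun y => (⟨y, v⟩ : TangentBundle (mdl d) (Vec d))) y := by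
    rw [Bundle.contMDiffAt_totalSpace]
    refine ⟨contMDiffAt_id, ?_⟩
    simpa using! contMDiffAt_const
  have h2 : ContMDiffAt (mdl d).tangent (mdl d).tangent ∞
      (tangentMapWithin (mdl d) (mdl d) e.symm e.target)
      (⟨y, v⟩ : TangentBundle (mdl d) (Vec d)) := by
    refine h1.contMDiffAt ?_
    exact (e.open_target.preimage (FiberBundle.continuous_proj _ _)).mem_nhds hy
  refine (ContMDiffAt.comp (f := fun y => (⟨y, v⟩ : TangentBundle (mdl d) (Vec d))) y h2
    h0).congr_of_eventuallyEq ?_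
  filter_upwards [e.open_target.mem_nhds hy] with y' hy'
  have : mfderivWithin (mdl d) (mdl d) e.symm e.target y' = mfderiv (mdl d) (mdl d) e.symm y' :=
    mfderivWithin_of_isOpen e.open_target hy'
  simp only [Function.comp, tangentMapWithin, this, chartDi]
  rfl

/-- The components of a metric in a chart, as a bilinear form on `ℝⁿ`. -/
def metricIn (g : Metric d M) (e : OpenPartialHomeomorph M (Vec d)) (y : Vec d) :
    Vec d →L[ℝ] Vec d →L[ℝ] ℝ :=
  pullBack (E := Vec d) (F := Vec d) (g.inner (e.symm y)) (chartDi e y)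

theorem metricIn_apply (g : Metric d M) (e : OpenPartialHomeomorph M (Vec d)) (y v w : Vec d) :
    metricIn g e y v w = g.inner (e.symm y) (chartDi e y v) (chartDi e y w) := rfl

theorem inner_eq_metricIn (g : Metric d M) {e : OpenPartialHomeomorph M (Vec d)}
    (he : e ∈ atlas (Vec d) M) {x : M} (hx : x ∈ e.source) (v w : Vec d) :
    g.inner x v w = metricIn g e (e x) (chartD e x v) (chartD e x w) := by
  rw [metricIn_apply, chartDi_chartD he hx, chartDi_chartD he hx, e.left_inv hx]

theorem metricIn_symm (g : Metric d M) (e : OpenPartialHomeomorph M (Vec d)) (y v w : Vec d) :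
    metricIn g e y v w = metricIn g e y w v := g.symm _ _ _

theorem metricIn_pos (g : Metric d M) {e : OpenPartialHomeomorph M (Vec d)}
    (he : e ∈ atlas (Vec d) M) {y : Vec d} (hy : y ∈ e.target) (v : Vec d) (hv : v ≠ 0) :
    0 < metricIn g e y v v := by
  refine g.pos _ _ fun h => hv ?_
  exact (chartDi_bijective he hy).1 ((show chartDi e y v = 0 from h).trans (map_zero _).symm)

end ChartDerivatives

/-- A family of bilinear forms on `ℝⁿ` is smooth if its components are. -/
theorem contDiffAt_bilin {d : ℕ} {E : Type*} [NormedAddCommGroup E] [NormedSpace ℝ E]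
    {n : WithTop ℕ∞} {b : E → Vec d →L[ℝ] Vec d →L[ℝ] ℝ} {x : E}
    (h : ∀ I J, ContDiffAt ℝ n (fun q => b q (stdVec I) (stdVec J)) x) : ContDiffAt ℝ n b x := by
  have key : b = fun q => ∑ I : Fin (d + 1), ∑ J : Fin (d + 1), b q (stdVec I) (stdVec J) •
      (ContinuousLinearMap.proj (R := ℝ) (φ := fun _ : Fin (d + 1) => ℝ) I).smulRight
        (ContinuousLinearMap.proj (R := ℝ) (φ := fun _ : Fin (d + 1) => ℝ) J) := by
    funext q
    ext v w
    have hv : v = ∑ I, v I • (stdVec I : Vec d) := by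
      simpa using (pi_eq_sum_univ' v)
    have hw : w = ∑ I, w I • (stdVec I : Vec d) := by
      simpa using (pi_eq_sum_univ' w)
    conv_lhs => rw [hv, hw]
    simp only [map_sum, map_smul, sum_apply, smul_apply,
      ContinuousLinearMap.smulRight_apply, ContinuousLinearMap.proj_apply, smul_eq_mul]
    rw [Finset.sum_comm]
    refine Finset.sum_congr rfl fun I _ => ?_
    rw [Finset.mul_sum]
    exact Finset.sum_congr rfl fun J _ => by ring
  rw [key]
  exact ContDiffAt.sum fun I _ => ContDiffAt.sum fun J _ =>
    (ContinuousLinearMap.toSpanSingleton ℝ _).contDiff.contDiffAt.comp x (h I J)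

theorem contDiffAt_metricIn {d : ℕ} {M : Type*} [TopologicalSpace M] [ChartedSpace (Vec d) M]
    [IsManifold (mdl d) ∞ M] (g : Metric d M) {e : OpenPartialHomeomorph M (Vec d)}
    (he : e ∈ atlas (Vec d) M) {y : Vec d} (hy : y ∈ e.target) :
    ContDiffAt ℝ ∞ (metricIn g e) y := by
  refine contDiffAt_bilin fun I J => ?_
  have h := ContMDiffAt.clm_bundle_apply₂ (F₁ := Vec d) (F₂ := Vec d) (F₃ := ℝ)
    (E₁ := fun x : M => TangentSpace (mdl d) x) (E₂ := fun x : M => TangentSpace (mdl d) x)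
    (E₃ := Bundle.Trivial M ℝ) (IM := mdl d) (IB := mdl d) (n := ∞)
    (b := e.symm) (ψ := fun y => g.inner (e.symm y))
    (v := fun y => chartDi e y (stdVec I)) (w := fun y => chartDi e y (stdVec J)) (x := y)
    (g.contMDiff.contMDiffAt.comp y (contMDiffAt_chart_symm he hy))
    (contMDiffAt_chartDi_section he hy _) (contMDiffAt_chartDi_section he hy _)
  rw [Bundle.contMDiffAt_totalSpace] at h
  exact contMDiffAt_iff_contDiffAt.1 h.2

/-! ### Localization of balance laws, determinants and area elements -/

section Localization

open MeasureTheory Set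

/-- A function whose integrals over all small cubes around a point vanish is zero at that point. -/
theorem eq_zero_of_integral_cubes {n : ℕ} {k : (Fin n → ℝ) → ℝ} {y₀ : Fin n → ℝ}
    (hk : ContinuousAt k y₀)
    (hi : ∀ᶠ r in 𝓝[>] (0 : ℝ), IntegrableOn k (Metric.closedBall y₀ r))
    (h : ∀ᶠ r in 𝓝[>] (0 : ℝ), ∫ y in Metric.closedBall y₀ r, k y = 0) : k y₀ = 0 := by
  by_contra hne
  have hpos : 0 < |k y₀| / 2 := by positivity
  obtain ⟨δ, hδ, hball⟩ := Metric.nhds_basis_closedBall.mem_iff.1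
    (hk.preimage_mem_nhds (Metric.closedBall_mem_nhds (k y₀) hpos))
  have hsmall : ∀ᶠ r in 𝓝[>] (0 : ℝ), r ∈ Ioo 0 δ := Ioo_mem_nhdsGT hδ
  obtain ⟨r, ⟨hr0, hrδ⟩, hir, hr⟩ := (hsmall.and (hi.and h)).exists
  have hfin : volume (Metric.closedBall y₀ r) < ⊤ := measure_closedBall_lt_top
  have hvol : 0 < volume.real (Metric.closedBall y₀ r) :=
    ENNReal.toReal_pos (Metric.measure_closedBall_pos volume y₀ hr0).ne' hfin.ne
  have h1 : ‖∫ y in Metric.closedBall y₀ r, (k y - k y₀)‖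
      ≤ |k y₀| / 2 * volume.real (Metric.closedBall y₀ r) := by
    refine norm_setIntegral_le_of_norm_le_const hfin fun y hy => ?_
    have := hball (Metric.closedBall_subset_closedBall hrδ.le hy)
    rwa [mem_preimage, Metric.mem_closedBall, dist_eq_norm] at this
  rw [integral_sub hir (integrableOn_const hfin.ne), hr, setIntegral_const, zero_sub, norm_neg,
    smul_eq_mul, norm_mul, Real.norm_eq_abs, Real.norm_eq_abs, abs_of_pos hvol] at h1
  nlinarith [abs_pos.2 hne]

/-- A balance law for all small coordinate boxes around a point holds pointwise: the rate of the
density is the source plus the divergence of the flux. -/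
theorem deriv_eq_add_divergence_of_balance {d : ℕ} {ε : ℝ → Vec d → ℝ} {s : Vec d → ℝ}
    {J : Fin (d + 1) → Vec d → ℝ} {t₀ : ℝ} {y₀ : Vec d} {U : Set (Vec d)} (hU : U ∈ 𝓝 y₀)
    (hε : ContDiffAt ℝ 1 (fun q : ℝ × Vec d => ε q.1 q.2) (t₀, y₀))
    (hs : ContDiffAt ℝ 1 s y₀) (hJ : ∀ i, ContDiffAt ℝ 1 (J i) y₀)
    (h : ∀ a b : Vec d, (∀ i, a i < b i) → Icc a b ⊆ U →
      HasDerivAt (fun t => ∫ y in Icc a b, ε t y)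
        ((∫ y in Icc a b, s y) + ∑ i : Fin (d + 1),
          ((∫ x in Icc (a ∘ i.succAbove) (b ∘ i.succAbove),
              J i (i.insertNth (α := fun _ => ℝ) (b i) x)) -
            ∫ x in Icc (a ∘ i.succAbove) (b ∘ i.succAbove),
              J i (i.insertNth (α := fun _ => ℝ) (a i) x))) t₀) :
    deriv (fun t => ε t y₀) t₀ = s y₀ + ∑ i, fderiv ℝ (J i) y₀ (stdVec i) := by
  -- a compact neighbourhood of `(t₀, y₀)` on which everything is continuously differentiable
  have hεn := hε.eventually (by simp)
  have hsn := hs.eventually (by simp)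
  have hJn : ∀ᶠ y in 𝓝 y₀, ∀ i, ContDiffAt ℝ 1 (J i) y :=
    Filter.eventually_all.2 fun i => (hJ i).eventually (by simp)
  obtain ⟨V, hV, W, hW, hVW⟩ :=
    Filter.eventually_prod_iff.1 (nhds_prod_eq (x := t₀) (y := y₀) ▸ hεn)
  have hall : ∀ᶠ y in 𝓝 y₀, W y ∧ ContDiffAt ℝ 1 s y ∧ (∀ i, ContDiffAt ℝ 1 (J i) y) ∧ y ∈ U :=
    hW.and (hsn.and (hJn.and hU))
  obtain ⟨δ, hδ, hball⟩ := Metric.nhds_basis_closedBall.eventually_iff.1 hall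
  obtain ⟨τ, hτ, hVτ⟩ := Metric.nhds_basis_closedBall.eventually_iff.1 hV
  set D : ℝ → Vec d → ℝ := fun t y => fderiv ℝ (fun q : ℝ × Vec d => ε q.1 q.2) (t, y) (1, 0)
    with hD
  have hderiv : ∀ t ∈ Metric.closedBall t₀ τ, ∀ y ∈ Metric.closedBall y₀ δ,
      HasDerivAt (fun t => ε t y) (D t y) t := fun t ht y hy => by
    have h1 := ((hVW (hVτ ht) (hball hy).1).differentiableAt one_ne_zero).hasFDerivAt
    exact h1.comp_hasDerivAt t ((hasDerivAt_id t).prodMk (hasDerivAt_const t y))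
  have hDcont : ContinuousOn (fun q : ℝ × Vec d => D q.1 q.2)
      (Metric.closedBall t₀ τ ×ˢ Metric.closedBall y₀ δ) := fun q hq =>
    (((hVW (hVτ hq.1) (hball hq.2).1).fderiv_right (m := 0) (by simp)).continuousAt.clm_apply
      continuousAt_const).continuousWithinAt
  have hDcont' : ∀ t ∈ Metric.closedBall t₀ τ,
      ContinuousOn (D t) (Metric.closedBall y₀ δ) := fun t ht =>
    hDcont.comp (continuousOn_const.prodMk continuousOn_id) fun y hy => ⟨ht, hy⟩
  obtain ⟨C, hC⟩ := ((isCompact_closedBall t₀ τ).prod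
    (isCompact_closedBall y₀ δ)).exists_bound_of_continuousOn hDcont
  have hs' : ContinuousOn s (Metric.closedBall y₀ δ) := fun y hy =>
    (hball hy).2.1.continuousAt.continuousWithinAt
  have hJ' : ContinuousOn (fun y => ∑ i, fderiv ℝ (J i) y (stdVec i))
      (Metric.closedBall y₀ δ) := continuousOn_finsetSum _ fun i _ y hy =>
    ((((hball hy).2.2.1 i).fderiv_right (m := 0) (by simp)).continuousAt.clm_apply
      continuousAt_const).continuousWithinAt
  have hD0 := hDcont' t₀ (Metric.mem_closedBall_self hτ.le)
  have hk : ContinuousOn (fun y => D t₀ y - (s y + ∑ i, fderiv ℝ (J i) y (stdVec i)))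
      (Metric.closedBall y₀ δ) := hD0.sub (hs'.add hJ')
  have hsmall : ∀ᶠ r in 𝓝[>] (0 : ℝ), r ∈ Ioo 0 δ := Ioo_mem_nhdsGT hδ
  have key := eq_zero_of_integral_cubes (y₀ := y₀)
    (hk.continuousAt (Metric.closedBall_mem_nhds y₀ hδ))
    (hsmall.mono fun r hr => (hk.mono (Metric.closedBall_subset_closedBall
      hr.2.le)).integrableOn_compact (isCompact_closedBall y₀ r))
    (hsmall.mono fun r hr => by
      have hsub : Metric.closedBall y₀ r ⊆ Metric.closedBall y₀ δ :=
        Metric.closedBall_subset_closedBall hr.2.le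
      have hK := isCompact_closedBall y₀ r
      -- balls of the sup norm are coordinate boxes, for which the divergence theorem is available
      set a : Vec d := fun i => y₀ i - r with ha
      set b : Vec d := fun i => y₀ i + r with hb
      have hab : Icc a b = Metric.closedBall y₀ r := by
        rw [closedBall_pi y₀ hr.1.le, ← pi_univ_Icc]
        simp only [Real.closedBall_eq_Icc, ha, hb]
      have hlt : ∀ i, a i < b i := fun i => by simp only [ha, hb]; linarith [hr.1]
      have h1 := h a b hlt (hab ▸ fun y hy => (hball (hsub hy)).2.2.2)
      have hle : a ≤ b := fun i => (hlt i).le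
      rw [← integral_divergence_of_hasFDerivAt_off_countable' a b hle J
        (fun i y => fderiv ℝ (J i) y) ∅ countable_empty] at h1
      rotate_left
      · exact fun i y hy =>
          ((hball (hsub (hab ▸ hy))).2.2.1 i).continuousAt.continuousWithinAt
      · intro y hy i
        have hy' : y ∈ Icc a b := ⟨fun j => (hy.1 j trivial).1.le, fun j => (hy.1 j trivial).2.le⟩
        exact (((hball (hsub (hab ▸ hy'))).2.2.1 i).differentiableAt one_ne_zero).hasFDerivAt
      · rw [hab]; exact (hJ'.mono hsub).integrableOn_compact hK
      rw [hab] at h1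
      -- differentiation under the integral sign
      have h2 := (hasDerivAt_integral_of_dominated_loc_of_deriv_le
        (μ := volume.restrict (Metric.closedBall y₀ r)) (F := ε) (F' := D) (x₀ := t₀)
        (bound := fun _ => C) (Metric.closedBall_mem_nhds t₀ hτ)
        (Filter.eventually_of_mem (Metric.closedBall_mem_nhds t₀ hτ) fun t ht =>
          (ContinuousOn.aestronglyMeasurable (fun y hy =>
            ((hVW (hVτ ht) (hball (hsub hy)).1).continuousAt.comp
              (f := fun y => (t, y)) (by fun_prop)).continuousWithinAt)
            hK.measurableSet))
        (ContinuousOn.integrableOn_compact hK fun y hy =>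
            ((hVW (hVτ (Metric.mem_closedBall_self hτ.le)) (hball (hsub hy)).1).continuousAt.comp
              (f := fun y => (t₀, y)) (by fun_prop)).continuousWithinAt)
        ((hD0.mono hsub).aestronglyMeasurable hK.measurableSet)
        ((ae_restrict_iff' hK.measurableSet).2 (.of_forall fun y hy t ht =>
          hC (t, y) ⟨ht, hsub hy⟩))
        (integrableOn_const hK.measure_lt_top.ne)
        ((ae_restrict_iff' hK.measurableSet).2 (.of_forall fun y hy t ht =>
          hderiv t ht y (hsub hy)))).2
      have h3 := h2.unique h1
      have h4 := (hs'.mono hsub).integrableOn_compact (μ := volume) hK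
      have h5 := (hJ'.mono hsub).integrableOn_compact (μ := volume) hK
      refine (integral_sub ((hD0.mono hsub).integrableOn_compact hK) (h4.add h5)).trans ?_
      rw [h3, sub_eq_zero]
      exact (integral_add h4 h5).symm)
  rw [(hderiv t₀ (Metric.mem_closedBall_self hτ.le) y₀ (Metric.mem_closedBall_self hδ.le)).deriv]
  linarith

end Localization

section Determinants

open Matrix

/-- Jacobi's formula. -/
theorem hasDerivAt_det {n : ℕ} {M : ℝ → Matrix (Fin n) (Fin n) ℝ} {M' : Matrix (Fin n) (Fin n) ℝ}
    {t : ℝ} (h : ∀ i j, HasDerivAt (fun s => M s i j) (M' i j) t) (hdet : (M t).det ≠ 0) :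
    HasDerivAt (fun s => (M s).det) ((M t).det * ((M t)⁻¹ * M').trace) t := by
  let f : ContinuousMultilinearMap ℝ (fun _ : Fin n => Fin n → ℝ) ℝ :=
    { (Matrix.detRowAlternating (R := ℝ) (n := Fin n)).toMultilinearMap with
      cont := Continuous.matrix_det continuous_id }
  have hM : HasDerivAt (fun s i => M s i) (fun i => M' i) t :=
    hasDerivAt_pi.2 fun i => hasDerivAt_pi.2 fun j => h i j
  have h1 := (f.hasFDerivAt (x := fun i => M t i)).comp_hasDerivAt t hM
  have h2 : f.linearDeriv (fun i => M t i) (fun i => M' i)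
      = (M t).det * ((M t)⁻¹ * M').trace := by
    rw [ContinuousMultilinearMap.linearDeriv_apply]
    have h3 : ∀ i, f (Function.update (fun i => M t i) i (M' i))
        = ∑ j, (M t).adjugate j i * M' i j := fun i => by
      have : f (Function.update (fun i => M t i) i (M' i)) = ((M t).updateRow i (M' i)).det := rfl
      rw [this, ← Matrix.cramer_transpose_apply, Matrix.cramer_eq_adjugate_mulVec,
        ← Matrix.adjugate_transpose]
      rfl
    rw [Finset.sum_congr rfl fun i _ => h3 i, Finset.sum_comm, Matrix.inv_def,
      Ring.inverse_eq_inv', Matrix.smul_mul, Matrix.trace_smul, smul_eq_mul,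
      mul_inv_cancel_left₀ hdet]
    rfl
  rw [← h2]
  exact h1

/-- The Gram matrix of a positive definite symmetric bilinear form is positive definite. -/
theorem posDef_of_bilin {n : ℕ} {b : (Fin n → ℝ) →L[ℝ] (Fin n → ℝ) →L[ℝ] ℝ}
    (hs : ∀ v w, b v w = b w v) (hp : ∀ v, v ≠ 0 → 0 < b v v) :
    (Matrix.of fun i j => b (Pi.single i 1) (Pi.single j 1)).PosDef := by
  refine Matrix.PosDef.of_dotProduct_mulVec_pos ?_ fun v hv => ?_
  · ext i j
    simp [hs (Pi.single j 1)]
  · refine (hp v hv).trans_eq ?_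
    have hv : v = ∑ i, v i • (Pi.single i (1 : ℝ) : Fin n → ℝ) := by
      simpa using (pi_eq_sum_univ' v)
    conv_lhs => rw [hv]
    simp only [map_sum, map_smul, _root_.sum_apply, _root_.smul_apply, smul_eq_mul, dotProduct,
      Matrix.mulVec, Matrix.of_apply, star_trivial, Finset.mul_sum]
    rw [Finset.sum_comm]
    exact Finset.sum_congr rfl fun i _ => Finset.sum_congr rfl fun j _ => by ring

/-- The area density of a coordinate face, divided by the norm of the coordinate covector, is the
volume density: this turns the surface integrals over faces into coordinate fluxes. By Cramer's rule
`h⁻¹ A A` is the quotient of the two determinants. -/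
theorem areaDensity_eq {d : ℕ} {h : Matrix (Fin (d + 1)) (Fin (d + 1)) ℝ} (hh : h.PosDef)
    (A : Fin (d + 1)) :
    (Real.sqrt (h⁻¹ A A))⁻¹ * areaDensity h A = volDensity h := by
  have h1 : h⁻¹ A A = (h.submatrix A.succAbove A.succAbove).det / h.det := by
    rw [Matrix.inv_def, Matrix.smul_apply, Matrix.adjugate_fin_succ_eq_det_submatrix, ← two_mul,
      pow_mul]
    simp [Ring.inverse_eq_inv', div_eq_inv_mul]
  have h2 : 0 < (h.submatrix A.succAbove A.succAbove).det :=
    (hh.submatrix Fin.succAbove_right_injective).det_pos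
  have h3 := hh.det_pos
  rw [h1, areaDensity, volDensity, Real.sqrt_div h2.le, inv_div, div_mul_cancel₀]
  exact (Real.sqrt_pos.2 h2).ne'

end Determinants

/-! ### Frame changes with prescribed rates -/

section FrameChanges

variable {d : ℕ}

/-- A perturbation of the identity of `ℝⁿ` by a smooth map with Lipschitz constant less than one is
a diffeomorphism. -/
theorem exists_homeomorph_id_add {w : Vec d → Vec d} (hw : ContDiff ℝ ∞ w) {K : NNReal}
    (hK : LipschitzWith K w) (hK1 : K < 1) :
    ∃ T : Vec d ≃ₜ Vec d, (∀ z, T z = z + w z) ∧ ContDiff ℝ ∞ T.symm := by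
  have happ : ApproximatesLinearOn (fun z => z + w z)
      ((ContinuousLinearEquiv.refl ℝ (Vec d) : Vec d ≃L[ℝ] Vec d) : Vec d →L[ℝ] Vec d)
      Set.univ K := by
    intro x _ y _
    have := hK.dist_le_mul x y
    rw [dist_eq_norm, dist_eq_norm] at this
    have h2 : (x + w x) - (y + w y) - (x - y) = w x - w y := by abel
    rw [← h2] at this
    exact this
  have hnorm : ‖((ContinuousLinearEquiv.refl ℝ (Vec d)).symm : Vec d →L[ℝ] Vec d)‖₊ = 1 := by
    have : ((ContinuousLinearEquiv.refl ℝ (Vec d)).symm : Vec d →L[ℝ] Vec d)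
        = ContinuousLinearMap.id ℝ (Vec d) := rfl
    rw [this]
    ext
    simp
  let T := happ.toHomeomorph _ (Or.inr (by rw [hnorm]; simpa using hK1))
  have hT : ∀ z, T z = z + w z := fun z => rfl
  have hT' : ContDiff ℝ ∞ T := contDiff_id.add hw
  have hlt : ∀ a, ‖-fderiv ℝ w a‖ < 1 := fun a => by
    rw [norm_neg]
    exact (norm_fderiv_le_of_lipschitz ℝ hK).trans_lt (by exact_mod_cast hK1)
  refine ⟨T, hT, T.contDiff_symm (f₀' := fun a =>
    ContinuousLinearEquiv.unitsEquiv ℝ (Vec d) (Units.oneSub _ (hlt a))) (fun a => ?_) hT'⟩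
  have h1 : HasFDerivAt (fun z => z + w z) (ContinuousLinearMap.id ℝ _ + fderiv ℝ w a) a :=
    (hasFDerivAt_id a).add ((hw.differentiable (by simp)) a).hasFDerivAt
  convert! h1 using 1
  ext v
  simp

variable {S : Type*} [TopologicalSpace S]

open Classical in
/-- The map of the manifold which in the chart `f` is `T`, and is the identity outside the domain of
the chart. -/
def transplant (f : OpenPartialHomeomorph S (Vec d)) (T : Vec d → Vec d) (x : S) : S :=
  if x ∈ f.source then f.symm (T (f x)) else x

theorem transplant_of_mem {f : OpenPartialHomeomorph S (Vec d)} {T : Vec d → Vec d} {x : S}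
    (hx : x ∈ f.source) : transplant f T x = f.symm (T (f x)) := if_pos hx

theorem transplant_of_notMem {f : OpenPartialHomeomorph S (Vec d)} {T : Vec d → Vec d} {x : S}
    (hx : x ∉ f.source) : transplant f T x = x := if_neg hx

theorem transplant_transplant {f : OpenPartialHomeomorph S (Vec d)} {T T' : Vec d → Vec d}
    (hT : Set.MapsTo T f.target f.target) (h : ∀ z, T' (T z) = z) (x : S) :
    transplant f T' (transplant f T x) = x := by
  by_cases hx : x ∈ f.source
  · have hz := hT (f.map_source hx)
    rw [transplant_of_mem hx, transplant_of_mem (f.map_target hz), f.right_inv hz, h,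
      f.left_inv hx]
  · rw [transplant_of_notMem (T := T) hx, transplant_of_notMem hx]

variable [ChartedSpace (Vec d) S]

/-- A map which is the identity off a compact subset of the image of a chart extends smoothly to a
Hausdorff manifold by the identity. -/
theorem contMDiff_transplant [T2Space S] [IsManifold (mdl d) ∞ S]
    {f : OpenPartialHomeomorph S (Vec d)} (hf : f ∈ atlas (Vec d) S) {T : ℝ → Vec d → Vec d}
    (hT : ContDiff ℝ ∞ (fun q : ℝ × Vec d => T q.1 q.2)) {K : Set (Vec d)} (hK : IsCompact K)
    (hKf : K ⊆ f.target) (hid : ∀ t, ∀ z ∉ K, T t z = z)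
    (hmaps : ∀ t, Set.MapsTo (T t) f.target f.target) :
    ContMDiff (𝓘(ℝ, ℝ).prod (mdl d)) (mdl d) ∞
      (fun q : ℝ × S => transplant f (T q.1) q.2) := by
  rintro ⟨t, x⟩
  by_cases hx : x ∈ f.source
  · have h1 : ContMDiffAt (𝓘(ℝ, ℝ).prod (mdl d)) (mdl d) ∞ (fun q : ℝ × S => f q.2) (t, x) :=
      (contMDiffAt_chart hf hx).comp (t, x) contMDiffAt_snd
    have h2 : ContMDiffAt (𝓘(ℝ, ℝ).prod (mdl d)) 𝓘(ℝ, ℝ × Vec d) ∞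
        (fun q : ℝ × S => (q.1, f q.2)) (t, x) := contMDiffAt_fst.prodMk_space h1
    have h3 : ContMDiffAt (𝓘(ℝ, ℝ).prod (mdl d)) (mdl d) ∞
        (fun q : ℝ × S => T q.1 (f q.2)) (t, x) :=
      ContMDiffAt.comp (g := fun q : ℝ × Vec d => T q.1 q.2) (t, x)
        hT.contDiffAt.contMDiffAt h2
    have h4 : ContMDiffAt (𝓘(ℝ, ℝ).prod (mdl d)) (mdl d) ∞
        (fun q : ℝ × S => f.symm (T q.1 (f q.2))) (t, x) :=
      ContMDiffAt.comp (g := f.symm) (t, x)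
        (contMDiffAt_chart_symm hf (hmaps t (f.map_source hx))) h3
    refine h4.congr_of_eventuallyEq ?_
    filter_upwards [(f.open_source.preimage continuous_snd).mem_nhds hx] with q hq
    exact transplant_of_mem hq
  · have hC : IsClosed (f.symm '' K) :=
      (hK.image_of_continuousOn (f.continuousOn_symm.mono hKf)).isClosed
    have hxC : x ∈ (f.symm '' K)ᶜ := by
      rintro ⟨z, hz, rfl⟩
      exact hx (f.map_target (hKf hz))
    refine (contMDiffAt_snd : ContMDiffAt (𝓘(ℝ, ℝ).prod (mdl d)) (mdl d) ∞
      (fun q : ℝ × S => q.2) (t, x)).congr_of_eventuallyEq ?_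
    filter_upwards [(hC.isOpen_compl.preimage continuous_snd).mem_nhds hxC] with q hq
    by_cases hq' : q.2 ∈ f.source
    · rw [transplant_of_mem hq', hid, f.left_inv hq']
      exact fun h => hq ⟨_, h, f.left_inv hq'⟩
    · exact transplant_of_notMem hq'

/-- There are frame changes with prescribed first-order data at a point: the velocity of the family
of diffeomorphisms and its spatial gradient at the point of a chart with coordinates `z₀`, and the
rate of the temperature rescaling. In the chart the diffeomorphisms are perturbations of the
identity in a fixed direction `w`, by a small amplitude `η`. -/
theorem exists_frameChange [T2Space S] [IsManifold (mdl d) ∞ S]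
    {f : OpenPartialHomeomorph S (Vec d)} (hf : f ∈ atlas (Vec d) S) {z₀ : Vec d}
    (hz₀ : z₀ ∈ f.target) (v : Vec d) (L : Vec d →L[ℝ] Vec d) (r : ℝ) (t₀ : ℝ) :
    ∃ (c : FrameChange d S t₀) (η : ℝ → ℝ) (w : Vec d → Vec d),
      ContDiff ℝ ∞ η ∧ η t₀ = 0 ∧ HasDerivAt η 1 t₀ ∧ ContDiff ℝ ∞ w ∧ w z₀ = v ∧
      fderiv ℝ w z₀ = L ∧ HasDerivAt c.ζ r t₀ ∧
      ∀ t, ∀ x ∈ f.source, c.ξ t x ∈ f.source ∧ f (c.ξ t x) = f x + η t • w (f x) := by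
  obtain ⟨R, hR, hball⟩ := Metric.nhds_basis_closedBall.mem_iff.1 (f.open_target.mem_nhds hz₀)
  let χ : ContDiffBump z₀ := ⟨R / 2, R, half_pos hR, half_lt_self hR⟩
  set w : Vec d → Vec d := fun z => χ z • (v + L (z - z₀)) with hw_def
  have hw : ContDiff ℝ ∞ w := by
    have : ContDiff ℝ ∞ χ := χ.contDiff
    fun_prop
  have hw0 : ∀ z ∉ Metric.closedBall z₀ R, w z = 0 := fun z hz => by
    rw [hw_def]
    have : χ z = 0 := χ.zero_of_le_dist (by
      rw [Metric.mem_closedBall, not_le] at hz; exact hz.le)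
    simp [this]
  have hsupp : HasCompactSupport w :=
    HasCompactSupport.intro (isCompact_closedBall z₀ R) hw0
  have hweq : w =ᶠ[𝓝 z₀] fun z => v + L (z - z₀) := by
    filter_upwards [χ.eventuallyEq_one] with z hz
    rw [hw_def]
    simp only [hz, Pi.one_apply, one_smul]
  have hwz : w z₀ = v := by rw [hweq.eq_of_nhds]; simp
  have hwL : fderiv ℝ w z₀ = L := by
    rw [hweq.fderiv_eq]
    have h1 : HasFDerivAt (fun z => v + L (z - z₀))
        (0 + L.comp (ContinuousLinearMap.id ℝ _ - 0)) z₀ :=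
      (hasFDerivAt_const v z₀).add (L.hasFDerivAt.comp z₀
        ((hasFDerivAt_id z₀).sub (hasFDerivAt_const z₀ z₀)))
    rw [h1.fderiv]
    ext1 k
    simp
  obtain ⟨K, hK⟩ := hw.lipschitzWith_of_hasCompactSupport hsupp (by simp)
  -- The amplitude has slope one at `t₀`, but stays so small that all maps are invertible.
  set ε : ℝ := 1 / (K + 1) / 2 with hε_def
  have hK0 : (0 : ℝ) ≤ K := K.2
  have hε : 0 < ε := by positivity
  set η : ℝ → ℝ := fun t => ε * Real.sin ((t - t₀) / ε) with hη_def
  have hη : ContDiff ℝ ∞ η := by fun_prop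
  have hη0 : η t₀ = 0 := by simp [hη_def]
  have hη1 : HasDerivAt η 1 t₀ := by
    have h1 : HasDerivAt (fun t : ℝ => (t - t₀) / ε) (1 / ε) t₀ :=
      ((hasDerivAt_id t₀).sub_const t₀).div_const ε
    have h2 := (h1.sin).const_mul ε
    refine h2.congr_deriv ?_
    simp [hε.ne']
  have hηε : ∀ t, |η t| ≤ ε := fun t => by
    rw [hη_def, abs_mul, abs_of_pos hε]
    exact mul_le_of_le_one_right hε.le (Real.abs_sin_le_one _)
  -- hence `η t • w` is a contraction
  have hlip : ∀ t, ∃ K' : NNReal, LipschitzWith K' (fun z => η t • w z) ∧ K' < 1 := fun t => by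
    refine ⟨‖η t‖₊ * K, ?_, ?_⟩
    · refine LipschitzWith.of_dist_le_mul fun x y => ?_
      rw [dist_smul₀, NNReal.coe_mul, coe_nnnorm, mul_assoc]
      exact mul_le_mul_of_nonneg_left (hK.dist_le_mul x y) (norm_nonneg _)
    · rw [← NNReal.coe_lt_coe]
      push_cast
      calc ‖η t‖ * (K : ℝ) ≤ ε * K := mul_le_mul_of_nonneg_right (hηε t) hK0
        _ = K / (K + 1) / 2 := by rw [hε_def]; ring
        _ < 1 := by
          have : (K : ℝ) / (K + 1) ≤ 1 := div_le_one_of_le₀ (by linarith) (by linarith)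
          linarith
  have hex : ∀ t, ∃ T : Vec d ≃ₜ Vec d, (∀ z, T z = z + η t • w z) ∧ ContDiff ℝ ∞ T.symm :=
    fun t => by
      obtain ⟨K', h1, h2⟩ := hlip t
      exact exists_homeomorph_id_add (by fun_prop) h1 h2
  choose T hT hTs using hex
  have hTid : ∀ t, ∀ z ∉ Metric.closedBall z₀ R, T t z = z := fun t z hz => by
    rw [hT, hw0 z hz, smul_zero, add_zero]
  have hTsid : ∀ t, ∀ z ∉ Metric.closedBall z₀ R, (T t).symm z = z := fun t z hz => by
    conv_lhs => rw [← hTid t z hz]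
    exact (T t).symm_apply_apply z
  -- a point leaving the image of the chart would be fixed by the inverse, hence not have moved
  have hTm : ∀ t, Set.MapsTo (T t) f.target f.target := fun t z hz => by
    by_contra h
    have h1 : T t z ∉ Metric.closedBall z₀ R := fun h' => h (hball h')
    have h2 := hTsid t _ h1
    rw [(T t).symm_apply_apply] at h2
    exact h (h2 ▸ hz)
  have hTsm : ∀ t, Set.MapsTo (T t).symm f.target f.target := fun t z hz => by
    by_contra h
    have h1 : (T t).symm z ∉ Metric.closedBall z₀ R := fun h' => h (hball h')
    have h2 := hTid t _ h1
    rw [(T t).apply_symm_apply] at h2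
    exact h (h2 ▸ hz)
  have hTsmooth : ContDiff ℝ ∞ (fun q : ℝ × Vec d => T q.1 q.2) := by
    simp only [hT]
    fun_prop
  have hξ := contMDiff_transplant hf (T := fun t => T t) hTsmooth (isCompact_closedBall z₀ R) hball
    hTid hTm
  have hslice : ∀ t : ℝ, ContMDiff (mdl d) (𝓘(ℝ, ℝ).prod (mdl d)) ∞ (fun x : S => (t, x)) :=
    fun t => contMDiff_const.prodMk contMDiff_id
  have hξs : ∀ t, ContMDiff (mdl d) (mdl d) ∞ (transplant f (T t).symm) := fun t =>
    ContMDiff.comp (contMDiff_transplant hf (T := fun _ => (T t).symm) ((hTs t).comp contDiff_snd)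
      (isCompact_closedBall z₀ R) hball (fun _ => hTsid t) (fun _ => hTsm t)) (hslice 0)
  let c : FrameChange d S t₀ :=
    { ξ := fun t =>
        { toFun := transplant f (T t)
          invFun := transplant f (T t).symm
          left_inv := transplant_transplant (hTm t) (T t).symm_apply_apply
          right_inv := transplant_transplant (hTsm t) (T t).apply_symm_apply
          contMDiff_toFun := hξ.comp (hslice t)
          contMDiff_invFun := hξs t }
      ξ_smooth := hξ
      ξ_t₀ := fun x => by
        change transplant f (T t₀) x = x
        by_cases hx : x ∈ f.source
        · rw [transplant_of_mem hx, hT, hη0, zero_smul, add_zero, f.left_inv hx]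
        · exact transplant_of_notMem hx
      ζ := fun t => Real.exp (r * (t - t₀))
      ζ_smooth := by fun_prop
      ζ_pos := fun t => Real.exp_pos _
      ζ_t₀ := by simp }
  refine ⟨c, η, w, hη, hη0, hη1, hw, hwz, hwL, ?_, fun t x hx => ?_⟩
  · have h1 : HasDerivAt (fun t : ℝ => r * (t - t₀)) (r * 1) t₀ :=
      ((hasDerivAt_id t₀).sub_const t₀).const_mul r
    refine h1.exp.congr_deriv ?_
    simp
  · have hz := hTm t (f.map_source hx)
    have h1 : c.ξ t x = f.symm (T t (f x)) := transplant_of_mem hx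
    rw [h1, f.right_inv hz, hT]
    exact ⟨hT t (f x) ▸ f.map_target hz, rfl⟩

end FrameChanges

/-! ### The acceleration in arbitrary charts -/

section Acceleration

variable {d : ℕ}

/-- The covariant components of the acceleration of a curve `u` in `ℝⁿ` with the metric `h`, in
Lagrangian form: `d/dt (∂T/∂u̇) - ∂T/∂u` for the kinetic energy `T = ½ h(u)(u̇, u̇)`. This form is
manifestly independent of coordinates. -/
def lowerAcc (h : Vec d → Vec d →L[ℝ] Vec d →L[ℝ] ℝ) (u : ℝ → Vec d) (t : ℝ) (b : Vec d) : ℝ :=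
  h (u t) (deriv (deriv u) t) b + fderiv ℝ h (u t) (deriv u t) (deriv u t) b
    - (1 / 2) * fderiv ℝ h (u t) b (deriv u t) (deriv u t)

theorem hasDerivAt_deriv_of_contDiffAt {E : Type*} [NormedAddCommGroup E] [NormedSpace ℝ E]
    {u : ℝ → E} {t : ℝ} (hu : ContDiffAt ℝ 2 u t) :
    HasDerivAt u (deriv u t) t ∧ HasDerivAt (deriv u) (deriv (deriv u) t) t := by
  refine ⟨(hu.differentiableAt (by simp)).hasDerivAt, ?_⟩
  have h1 : ContDiffAt ℝ 1 (fun s => fderiv ℝ u s 1) t :=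
    (hu.fderiv_right (m := 1) (by norm_num)).clm_apply contDiffAt_const
  exact (h1.differentiableAt (by simp)).hasDerivAt

/-- The rate of the kinetic energy is the power of the acceleration. -/
theorem hasDerivAt_kinetic {h : Vec d → Vec d →L[ℝ] Vec d →L[ℝ] ℝ} {u : ℝ → Vec d} {t : ℝ}
    (hh : DifferentiableAt ℝ h (u t)) (hs : ∀ v w, h (u t) v w = h (u t) w v)
    (hu : ContDiffAt ℝ 2 u t) :
    HasDerivAt (fun s => (1 / 2) * h (u s) (deriv u s) (deriv u s))
      (lowerAcc h u t (deriv u t)) t := by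
  obtain ⟨h1, h2⟩ := hasDerivAt_deriv_of_contDiffAt hu
  have h3 : HasDerivAt (fun s => h (u s)) (fderiv ℝ h (u t) (deriv u t)) t :=
    HasFDerivAt.comp_hasDerivAt (l := h) (l' := fderiv ℝ h (u t)) t hh.hasFDerivAt h1
  have h4 : HasDerivAt (fun s => h (u s) (deriv u s))
      (fderiv ℝ h (u t) (deriv u t) (deriv u t) + h (u t) (deriv (deriv u) t)) t :=
    h3.clm_apply h2
  have h5 : HasDerivAt (fun s => h (u s) (deriv u s) (deriv u s))
      ((fderiv ℝ h (u t) (deriv u t) (deriv u t) + h (u t) (deriv (deriv u) t)) (deriv u t)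
        + h (u t) (deriv u t) (deriv (deriv u) t)) t := h4.clm_apply h2
  refine (h5.const_mul (1 / 2)).congr_deriv ?_
  rw [lowerAcc, _root_.add_apply, hs (deriv u t)]
  ring

/-- The covariant acceleration does not depend on coordinates. -/
theorem lowerAcc_comp {h h₀ : Vec d → Vec d →L[ℝ] Vec d →L[ℝ] ℝ} {τ : Vec d → Vec d}
    {u : ℝ → Vec d} {t : ℝ} (hτ : ContDiffAt ℝ 2 τ (u t)) (hh : DifferentiableAt ℝ h (u t))
    (hh₀ : DifferentiableAt ℝ h₀ (τ (u t))) (hu : ContDiffAt ℝ 2 u t)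
    (hs : ∀ v w, h₀ (τ (u t)) v w = h₀ (τ (u t)) w v)
    (heq : ∀ᶠ z in 𝓝 (u t), ∀ a b, h z a b = h₀ (τ z) (fderiv ℝ τ z a) (fderiv ℝ τ z b))
    (b : Vec d) :
    lowerAcc h₀ (fun s => τ (u s)) t (fderiv ℝ τ (u t) b) = lowerAcc h u t b := by
  obtain ⟨h1, h2⟩ := hasDerivAt_deriv_of_contDiffAt hu
  set z := u t with hz
  set A := fderiv ℝ τ with hA
  have hτ1 : HasFDerivAt τ (A z) z := (hτ.differentiableAt (by simp)).hasFDerivAt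
  have hA1 : HasFDerivAt A (fderiv ℝ A z) z :=
    ((hτ.fderiv_right (m := 1) (by norm_num)).differentiableAt (by simp)).hasFDerivAt
  -- the terms with second derivatives of `τ` cancel by their symmetry
  have hsymm : ∀ v w, fderiv ℝ A z v w = fderiv ℝ A z w v := fun v w =>
    (hτ.isSymmSndFDerivAt (by simp)) v w
  have hder : ∀ k a b, fderiv ℝ h z k a b = fderiv ℝ h₀ (τ z) (A z k) (A z a) (A z b)
      + h₀ (τ z) (fderiv ℝ A z k a) (A z b) + h₀ (τ z) (A z a) (fderiv ℝ A z k b) := by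
    intro k a b
    have e1 : HasFDerivAt (fun z => h z a b) _ z :=
      (hh.hasFDerivAt.clm_apply (hasFDerivAt_const a z)).clm_apply (hasFDerivAt_const b z)
    have e2 : HasFDerivAt (fun z => h₀ (τ z) (A z a) (A z b)) _ z :=
      (((hh₀.hasFDerivAt.comp z hτ1).clm_apply
        (hA1.clm_apply (hasFDerivAt_const a z))).clm_apply
        (hA1.clm_apply (hasFDerivAt_const b z)))
    have e3 := e1.unique (e2.congr_of_eventuallyEq (heq.mono fun z hz => hz a b))
    have e4 := DFunLike.congr_fun e3 k
    simp at e4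
    linarith
  have hu0 : HasDerivAt (fun s => τ (u s)) (A z (deriv u t)) t := hτ1.comp_hasDerivAt t h1
  have hu0' : deriv (fun s => τ (u s)) =ᶠ[𝓝 t] fun s => A (u s) (deriv u s) := by
    have c1 : ∀ᶠ s in 𝓝 t, ContDiffAt ℝ 2 u s := hu.eventually (by simp)
    have c2 : ∀ᶠ s in 𝓝 t, ContDiffAt ℝ 2 τ (u s) :=
      h1.continuousAt.eventually (hτ.eventually (by simp))
    filter_upwards [c1, c2] with s hs1 hs2
    exact ((hs2.differentiableAt (by simp)).hasFDerivAt.comp_hasDerivAt s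
      (hs1.differentiableAt (by simp)).hasDerivAt).deriv
  have hu0'' : deriv (deriv (fun s => τ (u s))) t
      = fderiv ℝ A z (deriv u t) (deriv u t) + A z (deriv (deriv u) t) := by
    rw [hu0'.deriv_eq]
    exact ((hA1.comp_hasDerivAt t h1).clm_apply h2).deriv
  have hz0 := heq.self_of_nhds
  simp only [lowerAcc, hu0.deriv, hu0'', hder, hz0, map_add, _root_.add_apply, ← hz]
  rw [hsymm b (deriv u t), hs (A z (deriv u t)) (fderiv ℝ A z (deriv u t) b)]
  ring

/-- The Christoffel symbols as a bilinear map `Γ(v, w)^a = Γ^a_{bc} v^b w^c`. -/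
def christoffelMap (m : Vec d → Matrix (Fin (d + 1)) (Fin (d + 1)) ℝ) (y v w : Vec d) : Vec d :=
  fun a => ∑ b, ∑ k, christoffel m y a b k * v b * w k

theorem vec_eq_sum (v : Vec d) : v = ∑ I, v I • (stdVec I : Vec d) := by
  simpa using (pi_eq_sum_univ' v)

/-- The Koszul formula for the Christoffel symbols. -/
theorem metric_christoffelMap {h : Vec d → Vec d →L[ℝ] Vec d →L[ℝ] ℝ} {y : Vec d}
    (hh : DifferentiableAt ℝ h y) (hs : ∀ᶠ z in 𝓝 y, ∀ v w, h z v w = h z w v)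
    (hp : ∀ v, v ≠ 0 → 0 < h y v v) (v w k : Vec d) :
    h y (christoffelMap (fun z => Matrix.of fun I J => h z (stdVec I) (stdVec J)) y v w) k
      = (1 / 2) * (fderiv ℝ h y v w k + fderiv ℝ h y w v k - fderiv ℝ h y k v w) := by
  set m : Vec d → Matrix (Fin (d + 1)) (Fin (d + 1)) ℝ :=
    fun z => Matrix.of fun I J => h z (stdVec I) (stdVec J) with hm
  have hsy := hs.self_of_nhds
  have hdet : IsUnit (m y).det := (posDef_of_bilin hsy hp).det_pos.ne'.isUnit
  have hd : ∀ I J b, fderiv ℝ (fun z => m z I J) y (stdVec b)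
      = fderiv ℝ h y (stdVec b) (stdVec I) (stdVec J) := fun I J b => by
    have e1 : HasFDerivAt (fun z => m z I J) _ y :=
      (hh.hasFDerivAt.clm_apply (hasFDerivAt_const (stdVec I : Vec d) y)).clm_apply
        (hasFDerivAt_const (stdVec J : Vec d) y)
    rw [e1.fderiv]
    simp
  have hsd : ∀ k v w, fderiv ℝ h y k v w = fderiv ℝ h y k w v := fun k v w => by
    have e1 : ∀ v w, HasFDerivAt (fun z => h z v w) _ y := fun v w =>
      (hh.hasFDerivAt.clm_apply (hasFDerivAt_const v y)).clm_apply (hasFDerivAt_const w y)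
    have e2 := (e1 v w).unique ((e1 w v).congr_of_eventuallyEq (hs.mono fun z hz => hz v w))
    have e3 := DFunLike.congr_fun e2 k
    simpa using e3
  -- lowering the index of the Christoffel symbols cancels the inverse of the metric
  have hlow : ∀ K b c, ∑ a, christoffel m y a b c * h y (stdVec a) (stdVec K)
      = (1 / 2) * (fderiv ℝ h y (stdVec b) (stdVec c) (stdVec K)
        + fderiv ℝ h y (stdVec c) (stdVec b) (stdVec K)
        - fderiv ℝ h y (stdVec K) (stdVec b) (stdVec c)) := fun K b c => by
    simp only [christoffel, hd]
    set D : Fin (d + 1) → ℝ := fun k => fderiv ℝ h y (stdVec b) (stdVec k) (stdVec c)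
      + fderiv ℝ h y (stdVec c) (stdVec k) (stdVec b)
      - fderiv ℝ h y (stdVec k) (stdVec b) (stdVec c) with hD
    have e1 : ∑ a, (1 / 2) * (∑ k, (m y)⁻¹ a k * D k) * h y (stdVec a) (stdVec K)
        = (1 / 2) * ∑ k, (m y * (m y)⁻¹) K k * D k := by
      simp only [Matrix.mul_apply, Finset.mul_sum, Finset.sum_mul]
      rw [Finset.sum_comm]
      refine Finset.sum_congr rfl fun k _ => Finset.sum_congr rfl fun a _ => ?_
      rw [show m y K a = h y (stdVec a) (stdVec K) from hsy _ _]
      ring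
    refine e1.trans ?_
    rw [Matrix.mul_nonsing_inv _ hdet]
    simp only [Matrix.one_apply, ite_mul, one_mul, zero_mul, Finset.sum_ite_eq, Finset.mem_univ,
      if_true, hD]
    rw [hsd _ (stdVec K) (stdVec c), hsd _ (stdVec K) (stdVec b)]
  have hlin : ∀ (T : Vec d →L[ℝ] ℝ) (a : Vec d), T a = ∑ I, a I * T (stdVec I) := fun T a => by
    conv_lhs => rw [vec_eq_sum a]
    simp only [map_sum, map_smul, smul_eq_mul]
  have hlin₂ : ∀ (T : Vec d →L[ℝ] Vec d →L[ℝ] ℝ) (a b : Vec d),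
      T a b = ∑ I, a I * T (stdVec I) b := fun T a b => by
    conv_lhs => rw [vec_eq_sum a]
    simp only [map_sum, map_smul, _root_.sum_apply, _root_.smul_apply, smul_eq_mul]
  have hlin₃ : ∀ (T : Vec d →L[ℝ] Vec d →L[ℝ] Vec d →L[ℝ] ℝ) (a b c : Vec d),
      T a b c = ∑ I, a I * T (stdVec I) b c := fun T a b c => by
    conv_lhs => rw [vec_eq_sum a]
    simp only [map_sum, map_smul, _root_.sum_apply, _root_.smul_apply, smul_eq_mul]
  have e1 : fderiv ℝ h y v w k = ∑ b, ∑ c, ∑ K, v b * w c * k K *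
      fderiv ℝ h y (stdVec b) (stdVec c) (stdVec K) := by
    rw [hlin₃]
    refine Finset.sum_congr rfl fun b _ => ?_
    rw [hlin₂, Finset.mul_sum]
    refine Finset.sum_congr rfl fun c _ => ?_
    rw [hlin, Finset.mul_sum, Finset.mul_sum]
    exact Finset.sum_congr rfl fun K _ => by ring
  have e2 : fderiv ℝ h y w v k = ∑ b, ∑ c, ∑ K, v b * w c * k K *
      fderiv ℝ h y (stdVec c) (stdVec b) (stdVec K) := by
    rw [hlin₃, Finset.sum_comm]
    refine Finset.sum_congr rfl fun c _ => ?_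
    rw [hlin₂, Finset.mul_sum]
    refine Finset.sum_congr rfl fun b _ => ?_
    rw [hlin, Finset.mul_sum, Finset.mul_sum]
    exact Finset.sum_congr rfl fun K _ => by ring
  have e3 : fderiv ℝ h y k v w = ∑ b, ∑ c, ∑ K, v b * w c * k K *
      fderiv ℝ h y (stdVec K) (stdVec b) (stdVec c) := by
    have : ∀ b, (∑ c, ∑ K, v b * w c * k K * fderiv ℝ h y (stdVec K) (stdVec b) (stdVec c))
        = ∑ K, ∑ c, v b * w c * k K * fderiv ℝ h y (stdVec K) (stdVec b) (stdVec c) :=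
      fun b => Finset.sum_comm
    rw [hlin₃, Finset.sum_congr rfl fun b _ => this b, Finset.sum_comm]
    refine Finset.sum_congr rfl fun K _ => ?_
    rw [hlin₂, Finset.mul_sum]
    refine Finset.sum_congr rfl fun b _ => ?_
    rw [hlin, Finset.mul_sum, Finset.mul_sum]
    exact Finset.sum_congr rfl fun c _ => by ring
  have e4 : h y (christoffelMap m y v w) k = ∑ b, ∑ c, ∑ K, v b * w c * k K *
      ∑ a, christoffel m y a b c * h y (stdVec a) (stdVec K) := by
    rw [hlin₂]
    simp only [christoffelMap, Finset.sum_mul]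
    rw [Finset.sum_comm]
    refine Finset.sum_congr rfl fun b _ => ?_
    rw [Finset.sum_comm]
    refine Finset.sum_congr rfl fun c _ => ?_
    simp only [hlin _ k, Finset.mul_sum]
    rw [Finset.sum_comm]
    exact Finset.sum_congr rfl fun K _ => Finset.sum_congr rfl fun a _ => by ring
  rw [e4, e1, e2, e3]
  simp only [hlow, ← Finset.sum_add_distrib, ← Finset.sum_sub_distrib]
  simp only [Finset.mul_sum]
  exact Finset.sum_congr rfl fun b _ => Finset.sum_congr rfl fun c _ =>
    Finset.sum_congr rfl fun K _ => by ring

theorem lowerAcc_congr {h : Vec d → Vec d →L[ℝ] Vec d →L[ℝ] ℝ} {u u' : ℝ → Vec d} {t : ℝ}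
    (huu' : u =ᶠ[𝓝 t] u') (b : Vec d) : lowerAcc h u t b = lowerAcc h u' t b := by
  simp only [lowerAcc, huu'.eq_of_nhds, huu'.deriv_eq, huu'.deriv.deriv_eq]

variable {M : Type*} [TopologicalSpace M] [ChartedSpace (Vec d) M] [IsManifold (mdl d) ∞ M]

theorem fderiv_chart_comp {E : Type*} [NormedAddCommGroup E] [NormedSpace ℝ E]
    {f : OpenPartialHomeomorph M (Vec d)} (hf : f ∈ atlas (Vec d) M) {ψ : E → M} {q : E}
    (hψ : MDifferentiableAt 𝓘(ℝ, E) (mdl d) ψ q) (hq : ψ q ∈ f.source) (v : E) :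
    fderiv ℝ (fun q => f (ψ q)) q v = chartD f (ψ q) (mfderiv 𝓘(ℝ, E) (mdl d) ψ q v) := by
  have h1 := mfderiv_comp q ((contMDiffAt_chart hf hq).mdifferentiableAt (by simp)) hψ
  rw [← mfderiv_eq_fderiv]
  exact DFunLike.congr_fun h1 v

theorem deriv_chart_comp {f : OpenPartialHomeomorph M (Vec d)} (hf : f ∈ atlas (Vec d) M)
    {c : ℝ → M} {t : ℝ} (hc : MDifferentiableAt 𝓘(ℝ, ℝ) (mdl d) c t) (ht : c t ∈ f.source) :
    deriv (fun s => f (c s)) t = chartD f (c t) (mfderiv 𝓘(ℝ, ℝ) (mdl d) c t (1 : ℝ)) :=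
  fderiv_chart_comp hf hc ht 1

theorem contDiffAt_chart_comp {E : Type*} [NormedAddCommGroup E] [NormedSpace ℝ E]
    {f : OpenPartialHomeomorph M (Vec d)} (hf : f ∈ atlas (Vec d) M) {ψ : E → M} {q : E}
    (hψ : ContMDiffAt 𝓘(ℝ, E) (mdl d) ∞ ψ q) (hq : ψ q ∈ f.source) :
    ContDiffAt ℝ ∞ (fun q => f (ψ q)) q :=
  contMDiffAt_iff_contDiffAt.1 (ContMDiffAt.comp q (contMDiffAt_chart hf hq) hψ)

/-- In any chart the covariant acceleration of a curve is given by the Lagrangian formula, although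
the acceleration is defined by means of the preferred chart. -/
theorem inner_acceleration (g : Metric d M) {f : OpenPartialHomeomorph M (Vec d)}
    (hf : f ∈ atlas (Vec d) M) {c : ℝ → M} {t : ℝ}
    (hc : ContMDiffAt 𝓘(ℝ, ℝ) (mdl d) ∞ c t) (ht : c t ∈ f.source) (k : Vec d) :
    g.inner (c t) (acceleration g c t) k
      = lowerAcc (metricIn g f) (fun s => f (c s)) t (chartD f (c t) k) := by
  set f₀ := chartAt (Vec d) (c t) with hf₀_def
  have hf₀ : f₀ ∈ atlas (Vec d) M := chart_mem_atlas _ _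
  have ht₀ : c t ∈ f₀.source := mem_chart_source _ _
  set u₀ : ℝ → Vec d := fun s => f₀ (c s) with hu₀
  have hdiff : ∀ {e : OpenPartialHomeomorph M (Vec d)}, e ∈ atlas (Vec d) M → ∀ {y}, y ∈ e.target →
      DifferentiableAt ℝ (metricIn g e) y := fun he _ hy =>
    (contDiffAt_metricIn g he hy).differentiableAt (by simp)
  have h1 : g.inner (c t) (acceleration g c t) k = lowerAcc (metricIn g f₀) u₀ t k := by
    have e1 := inner_eq_metricIn g hf₀ ht₀ (acceleration g c t) k
    rw [chartD_chartAt] at e1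
    have e2 : (acceleration g c t : Vec d) = deriv (deriv u₀) t
        + christoffelMap (components g.inner f₀) (u₀ t) (deriv u₀ t) (deriv u₀ t) := rfl
    have e3 := metric_christoffelMap (hdiff hf₀ (f₀.map_source ht₀))
      (.of_forall fun z v w => metricIn_symm g f₀ z v w)
      (metricIn_pos g hf₀ (f₀.map_source ht₀)) (deriv u₀ t) (deriv u₀ t) k
    have e4 : metricIn g f₀ (u₀ t) (christoffelMap (components g.inner f₀) (u₀ t)
      (deriv u₀ t) (deriv u₀ t)) k = _ := e3
    refine e1.trans ?_
    change metricIn g f₀ (u₀ t) (acceleration g c t : Vec d) k = _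
    rw [e2, map_add, _root_.add_apply, e4, lowerAcc]
    ring
  -- the transition map from `f` to the preferred chart
  set τ : Vec d → Vec d := fun z => f₀ (f.symm z) with hτ
  set u : ℝ → Vec d := fun s => f (c s) with hu
  have hz : u t ∈ f.target := f.map_source ht
  have hsrc : ∀ᶠ z in 𝓝 (u t), z ∈ f.target ∧ f.symm z ∈ f₀.source := by
    refine (f.open_target.eventually_mem hz).and ?_
    refine (f.continuousAt_symm hz).eventually (f₀.open_source.eventually_mem ?_)
    rwa [hu, f.left_inv ht]
  have hτd : ∀ z, z ∈ f.target → f.symm z ∈ f₀.source → ∀ a,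
      fderiv ℝ τ z a = chartD f₀ (f.symm z) (chartDi f z a) := fun z h1 h2 a =>
    fderiv_chart_comp hf₀ ((contMDiffAt_chart_symm hf h1).mdifferentiableAt (by simp)) h2 a
  have hsym : f.symm (u t) = c t := f.left_inv ht
  have hτc : ContDiffAt ℝ ∞ τ (u t) :=
    contDiffAt_chart_comp hf₀ (contMDiffAt_chart_symm hf hz) hsrc.self_of_nhds.2
  have hτt : τ (u t) = u₀ t := by simp only [hτ, hsym, hu₀]
  have h2 := lowerAcc_comp (h := metricIn g f) (h₀ := metricIn g f₀) (τ := τ) (u := u) (t := t)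
    (hτc.of_le (by norm_cast)) (hdiff hf hz)
    (by rw [hτt]; exact hdiff hf₀ (f₀.map_source ht₀))
    ((contDiffAt_chart_comp hf hc ht).of_le (by norm_cast))
    (fun v w => metricIn_symm _ _ _ _ _)
    (hsrc.mono fun z hz' a b => by
      rw [hτd z hz'.1 hz'.2, hτd z hz'.1 hz'.2, metricIn_apply, inner_eq_metricIn g hf₀ hz'.2])
    (chartD f (c t) k)
  have h3 : fderiv ℝ τ (u t) (chartD f (c t) k) = k := by
    rw [hτd _ hz hsrc.self_of_nhds.2, chartDi_chartD hf ht, hsym, chartD_chartAt]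
    rfl
  have h4 : (fun s => τ (u s)) =ᶠ[𝓝 t] u₀ := by
    filter_upwards [hc.continuousAt.eventually (f.open_source.eventually_mem ht)] with s hs
    simp only [hτ, hu, hu₀, f.left_inv hs]
  rw [h1, ← h2, h3]
  exact lowerAcc_congr h4.symm k

end Acceleration

/-! ### Motions and response functions in charts -/

section Motions

variable {d : ℕ} {B S : Type*} [TopologicalSpace B] [ChartedSpace (Vec d) B]
  [IsManifold (mdl d) ∞ B] [TopologicalSpace S] [ChartedSpace (Vec d) S] [IsManifold (mdl d) ∞ S]

/-- A time-dependent field on a manifold, smooth in time and place, is smooth in time and the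
coordinates of a chart. -/
theorem contMDiffAt_inChart {EN : Type*} [NormedAddCommGroup EN] [NormedSpace ℝ EN] {HN : Type*}
    [TopologicalSpace HN] {J : ModelWithCorners ℝ EN HN} {N : Type*} [TopologicalSpace N]
    [ChartedSpace HN N] {F : ℝ × B → N} (hF : ContMDiff (𝓘(ℝ, ℝ).prod (mdl d)) J ∞ F)
    {e : OpenPartialHomeomorph B (Vec d)} (he : e ∈ atlas (Vec d) B) {q : ℝ × Vec d}
    (hq : q.2 ∈ e.target) :
    ContMDiffAt 𝓘(ℝ, ℝ × Vec d) J ∞ (fun q : ℝ × Vec d => F (q.1, e.symm q.2)) q := by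
  have h1 : ContMDiffAt 𝓘(ℝ, ℝ × Vec d) 𝓘(ℝ, ℝ) ∞ (fun q : ℝ × Vec d => q.1) q :=
    contDiffAt_fst.contMDiffAt
  have h2 : ContMDiffAt 𝓘(ℝ, ℝ × Vec d) (mdl d) ∞ (fun q : ℝ × Vec d => e.symm q.2) q :=
    ContMDiffAt.comp (g := e.symm) q (contMDiffAt_chart_symm he hq) contDiffAt_snd.contMDiffAt
  exact ContMDiffAt.comp q hF.contMDiffAt (h1.prodMk h2)

theorem contDiffAt_inChart {EN : Type*} [NormedAddCommGroup EN] [NormedSpace ℝ EN] {F : ℝ × B → EN}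
    (hF : ContMDiff (𝓘(ℝ, ℝ).prod (mdl d)) 𝓘(ℝ, EN) ∞ F)
    {e : OpenPartialHomeomorph B (Vec d)} (he : e ∈ atlas (Vec d) B) {q : ℝ × Vec d}
    (hq : q.2 ∈ e.target) :
    ContDiffAt ℝ ∞ (fun q : ℝ × Vec d => F (q.1, e.symm q.2)) q :=
  contMDiffAt_iff_contDiffAt.1 (contMDiffAt_inChart hF he hq)

/-- A motion in charts of the body and of the ambient space. -/
def motionIn (φ : ℝ → B → S) (e : OpenPartialHomeomorph B (Vec d))
    (f : OpenPartialHomeomorph S (Vec d)) (q : ℝ × Vec d) : Vec d := f (φ q.1 (e.symm q.2))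

variable {φ : ℝ → B → S}
  (hφ : ContMDiff (𝓘(ℝ, ℝ).prod (mdl d)) (mdl d) ∞ (fun q : ℝ × B => φ q.1 q.2))
  {e : OpenPartialHomeomorph B (Vec d)} (he : e ∈ atlas (Vec d) B)
  {f : OpenPartialHomeomorph S (Vec d)} (hf : f ∈ atlas (Vec d) S)

include hφ

omit [IsManifold (mdl d) ∞ B] [IsManifold (mdl d) ∞ S] in
theorem contMDiff_slice (t : ℝ) : ContMDiff (mdl d) (mdl d) ∞ (φ t) :=
  ContMDiff.comp (g := fun q : ℝ × B => φ q.1 q.2) hφ (contMDiff_const.prodMk contMDiff_id)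

omit [IsManifold (mdl d) ∞ B] [IsManifold (mdl d) ∞ S] in
theorem contMDiff_path (X : B) : ContMDiff 𝓘(ℝ, ℝ) (mdl d) ∞ (fun t => φ t X) :=
  ContMDiff.comp (g := fun q : ℝ × B => φ q.1 q.2) hφ (contMDiff_id.prodMk contMDiff_const)

include he

omit [IsManifold (mdl d) ∞ S] in
theorem eventually_mem_charts {t : ℝ} {y : Vec d} (hy : y ∈ e.target)
    (hx : φ t (e.symm y) ∈ f.source) :
    ∀ᶠ q : ℝ × Vec d in 𝓝 (t, y), q.2 ∈ e.target ∧ φ q.1 (e.symm q.2) ∈ f.source := by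
  have h1 := (contMDiffAt_inChart hφ he (q := (t, y)) hy).continuousAt
  exact (continuousAt_snd.eventually (e.open_target.eventually_mem hy)).and
    (h1.eventually (f.open_source.eventually_mem hx))

include hf

theorem contDiffAt_motionIn {t : ℝ} {y : Vec d} (hy : y ∈ e.target)
    (hx : φ t (e.symm y) ∈ f.source) : ContDiffAt ℝ ∞ (motionIn φ e f) (t, y) :=
  contDiffAt_chart_comp hf (contMDiffAt_inChart hφ he (q := (t, y)) hy) hx

theorem hasDerivAt_motionIn {t : ℝ} {y : Vec d} (hy : y ∈ e.target)
    (hx : φ t (e.symm y) ∈ f.source) :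
    HasDerivAt (fun s => motionIn φ e f (s, y)) (fderiv ℝ (motionIn φ e f) (t, y) (1, 0)) t :=
  HasFDerivAt.comp_hasDerivAt (l := motionIn φ e f) t
    ((contDiffAt_motionIn hφ he hf hy hx).differentiableAt (by simp)).hasFDerivAt
    ((hasDerivAt_id t).prodMk (hasDerivAt_const t y))

theorem hasFDerivAt_motionIn {t : ℝ} {y : Vec d} (hy : y ∈ e.target)
    (hx : φ t (e.symm y) ∈ f.source) :
    HasFDerivAt (fun z => motionIn φ e f (t, z))
      ((fderiv ℝ (motionIn φ e f) (t, y)).comp (ContinuousLinearMap.inr ℝ ℝ (Vec d))) y :=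
  (((contDiffAt_motionIn hφ he hf hy hx).differentiableAt (by simp)).hasFDerivAt).comp y
    (hasFDerivAt_prodMk_right t y)

theorem chartD_velocity {t : ℝ} {y : Vec d} (hy : y ∈ e.target)
    (hx : φ t (e.symm y) ∈ f.source) :
    chartD f (φ t (e.symm y)) (mfderiv 𝓘(ℝ, ℝ) (mdl d) (fun s => φ s (e.symm y)) t (1 : ℝ))
      = fderiv ℝ (motionIn φ e f) (t, y) (1, 0) := by
  rw [← (hasDerivAt_motionIn hφ he hf hy hx).deriv]
  exact (deriv_chart_comp hf ((contMDiff_path hφ (e.symm y)).contMDiffAt.mdifferentiableAt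
    (by simp)) hx).symm

theorem chartD_gradient {t : ℝ} {y : Vec d} (hy : y ∈ e.target)
    (hx : φ t (e.symm y) ∈ f.source) (v : Vec d) :
    chartD f (φ t (e.symm y)) (mfderiv (mdl d) (mdl d) (φ t) (e.symm y) (chartDi e y v))
      = fderiv ℝ (motionIn φ e f) (t, y) (0, v) := by
  have hφt : MDifferentiableAt (mdl d) (mdl d) (φ t) (e.symm y) :=
    (contMDiff_slice hφ t).contMDiffAt.mdifferentiableAt (by simp)
  have hes : MDifferentiableAt (mdl d) (mdl d) e.symm y :=
    (contMDiffAt_chart_symm he hy).mdifferentiableAt (by simp)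
  have h1 := fderiv_chart_comp hf (ψ := fun z => φ t (e.symm z)) (hφt.comp y hes) hx v
  have h2 : fderiv ℝ (fun z => motionIn φ e f (t, z)) y v
      = fderiv ℝ (motionIn φ e f) (t, y) (0, v) := by
    rw [(hasFDerivAt_motionIn hφ he hf hy hx).fderiv]
    simp
  have h3 := mfderiv_comp y hφt hes
  rw [← h2]
  refine Eq.trans ?_ h1.symm
  exact congrArg (chartD f (φ t (e.symm y))) (DFunLike.congr_fun h3 v).symm

end Motions

section Responses

variable {d : ℕ} {B S : Type*} [TopologicalSpace B] [ChartedSpace (Vec d) B]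
  [IsManifold (mdl d) ∞ B] [TopologicalSpace S] [ChartedSpace (Vec d) S] [IsManifold (mdl d) ∞ S]

/-- The states at which a response function in charts is smooth. -/
def stateSet (e : OpenPartialHomeomorph B (Vec d)) (f : OpenPartialHomeomorph S (Vec d))
    (T : Set ℝ) : Set (Vec d × ℝ × (Vec d →L[ℝ] Vec d →L[ℝ] ℝ) × Vec d × (Vec d →L[ℝ] Vec d) ×
      (Vec d →L[ℝ] Vec d →L[ℝ] ℝ)) :=
  {q | q.1 ∈ e.target ∧ q.2.1 ∈ T ∧
        ((∀ v w, q.2.2.1 v w = q.2.2.1 w v) ∧ ∀ v, v ≠ 0 → 0 < q.2.2.1 v v) ∧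
        q.2.2.2.1 ∈ f.target ∧ Function.Bijective q.2.2.2.2.1 ∧
        ((∀ v w, q.2.2.2.2.2 v w = q.2.2.2.2.2 w v) ∧ ∀ v, v ≠ 0 → 0 < q.2.2.2.2.2 v v)}

/-- A response function in terms of its representation in charts. -/
theorem Response.eq_inCharts (W : Response d B S) {e : OpenPartialHomeomorph B (Vec d)}
    (he : e ∈ atlas (Vec d) B) {f : OpenPartialHomeomorph S (Vec d)} (hf : f ∈ atlas (Vec d) S)
    {y : Vec d} (hy : y ∈ e.target) (θ : ℝ) (G : Vec d →L[ℝ] Vec d →L[ℝ] ℝ) {x : S}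
    (hx : x ∈ f.source) (F : Vec d →L[ℝ] Vec d) (h : Vec d →L[ℝ] Vec d →L[ℝ] ℝ) :
    W (e.symm y) θ G x F h = W.inCharts e f (y, θ, pullBack G (chartDi e y), f x,
      (chartD f x).comp (F.comp (chartDi e y)), pullBack h (chartDi f (f x))) := by
  have hW : ∀ (x' : S), x' = x → ∀ (G' : Vec d →L[ℝ] Vec d →L[ℝ] ℝ), G' = G →
      ∀ (F' : Vec d →L[ℝ] Vec d), F' = F → ∀ (h' : Vec d →L[ℝ] Vec d →L[ℝ] ℝ), h' = h →
      W (e.symm y) θ G x F h = W (e.symm y) θ G' x' F' h' := by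
    rintro _ rfl _ rfl _ rfl _ rfl
    rfl
  have h1 : ∀ v, chartDi e y (chartD e (e.symm y) v) = v := fun v => by
    have := chartDi_chartD he (e.map_target hy) v
    rwa [e.right_inv hy] at this
  have h2 : ∀ v, chartDi f (f x) (chartD f (f.symm (f x)) v) = v := fun v => by
    rw [f.left_inv hx, chartDi_chartD hf hx]
  refine hW _ (f.left_inv hx) _ ?_ _ ?_ _ ?_
  · exact ContinuousLinearMap.ext fun v => ContinuousLinearMap.ext fun w =>
      congrArg₂ (fun a b => G a b) (h1 v) (h1 w)
  · refine ContinuousLinearMap.ext fun v => ?_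
    exact (chartDi_chartD hf hx _).trans (congrArg F (h1 v))
  · exact ContinuousLinearMap.ext fun v => ContinuousLinearMap.ext fun w =>
      congrArg₂ (fun a b => h a b) (h2 v) (h2 w)

end Responses

/-! ### Partial derivatives in time and bilinear forms -/

section PartialDerivatives

variable {V F : Type*} [NormedAddCommGroup V] [NormedSpace ℝ V] [NormedAddCommGroup F]
  [NormedSpace ℝ F]

theorem deriv_time {U : ℝ × V → F} {t : ℝ} {y : V} (hU : DifferentiableAt ℝ U (t, y)) :
    HasDerivAt (fun s => U (s, y)) (fderiv ℝ U (t, y) (1, 0)) t :=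
  HasFDerivAt.comp_hasDerivAt (l := U) t hU.hasFDerivAt
    ((hasDerivAt_id t).prodMk (hasDerivAt_const t y))

theorem contDiffAt_fderiv_apply {E : Type*} [NormedAddCommGroup E] [NormedSpace ℝ E] {U : E → F}
    {q : E} (hU : ContDiffAt ℝ ∞ U q) (v : E) : ContDiffAt ℝ ∞ (fun q => fderiv ℝ U q v) q :=
  (hU.fderiv_right (m := ∞) (by simp)).clm_apply contDiffAt_const

theorem deriv_deriv_time {U : ℝ × V → F} {t : ℝ} {y : V} (hU : ContDiffAt ℝ 2 U (t, y)) :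
    deriv (deriv (fun s => U (s, y))) t
      = fderiv ℝ (fun q => fderiv ℝ U q (1, 0)) (t, y) (1, 0) := by
  have h1 : deriv (fun s => U (s, y)) =ᶠ[𝓝 t] fun s => fderiv ℝ U (s, y) (1, 0) := by
    have h2 : ∀ᶠ q in 𝓝 (t, y), ContDiffAt ℝ 2 U q := hU.eventually (by simp)
    have h3 : ContinuousAt (fun s : ℝ => (s, y)) t := by fun_prop
    filter_upwards [h3.eventually h2] with s hs
    exact (deriv_time (hs.differentiableAt (by simp))).deriv
  rw [h1.deriv_eq]
  have h4 : ContDiffAt ℝ 1 (fun q => fderiv ℝ U q (1, 0)) (t, y) :=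
    (hU.fderiv_right (m := 1) (by norm_num)).clm_apply contDiffAt_const
  exact (deriv_time (h4.differentiableAt (by simp))).deriv

theorem contDiffAt_prodMk_right {t : ℝ} {y : V} : ContDiffAt ℝ ∞ (fun y : V => (t, y)) y :=
  contDiffAt_const.prodMk contDiffAt_id

end PartialDerivatives

section Forms

variable {d : ℕ}

/-- Pull-back of bilinear forms along a fixed linear map is linear and continuous. -/
def pullBackCLM (L : Vec d →L[ℝ] Vec d) :
    (Vec d →L[ℝ] Vec d →L[ℝ] ℝ) →L[ℝ] (Vec d →L[ℝ] Vec d →L[ℝ] ℝ) :=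
  (ContinuousLinearMap.compL ℝ (Vec d) (Vec d →L[ℝ] ℝ) (Vec d →L[ℝ] ℝ)
    (ContinuousLinearMap.precomp ℝ L)).comp
    ((ContinuousLinearMap.compL ℝ (Vec d) (Vec d) (Vec d →L[ℝ] ℝ)).flip L)

/-- Positive definiteness is an open condition on bilinear forms. -/
theorem eventually_posDef {b₀ : Vec d →L[ℝ] Vec d →L[ℝ] ℝ} (hb : ∀ v, v ≠ 0 → 0 < b₀ v v) :
    ∀ᶠ b in 𝓝 b₀, ∀ v, v ≠ 0 → 0 < b v v := by
  have hcont : ContinuousOn (fun v => b₀ v v) (Metric.sphere 0 1) := by fun_prop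
  have hne : (Metric.sphere (0 : Vec d) 1).Nonempty := NormedSpace.sphere_nonempty.2 zero_le_one
  obtain ⟨v₀, hv₀, hmin⟩ := (isCompact_sphere (0 : Vec d) 1).exists_isMinOn hne hcont
  have hv₀' : v₀ ≠ 0 := by
    rintro rfl
    simp at hv₀
  have hpos := hb v₀ hv₀'
  -- the minimum of `b₀` on the unit sphere is a radius which keeps forms positive definite
  filter_upwards [Metric.ball_mem_nhds b₀ hpos] with b hbb v hv
  have hn : 0 < ‖v‖ := norm_pos_iff.2 hv
  obtain ⟨x, hx1, hvx⟩ : ∃ x : Vec d, ‖x‖ = 1 ∧ v = ‖v‖ • x := by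
    refine ⟨‖v‖⁻¹ • v, ?_, ?_⟩
    · rw [norm_smul, norm_inv, norm_norm, inv_mul_cancel₀ hn.ne']
    · rw [smul_smul, mul_inv_cancel₀ hn.ne', one_smul]
  have h1 : b₀ v₀ v₀ ≤ b₀ x x := hmin (by simpa using hx1)
  have h2 : |(b - b₀) x x| ≤ ‖b - b₀‖ := by
    have := (b - b₀).le_opNorm₂ x x
    rwa [hx1, mul_one, mul_one] at this
  have h3 : ‖b - b₀‖ < b₀ v₀ v₀ := by rwa [Metric.mem_ball, dist_eq_norm] at hbb
  have h4 : (b - b₀) x x = b x x - b₀ x x := rfl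
  have h5 : 0 < b x x := by
    rw [h4] at h2
    linarith [neg_le_of_abs_le h2]
  have h6 : b v v = ‖v‖ * (‖v‖ * b x x) := by
    conv_lhs => rw [hvx]
    simp only [map_smul, _root_.smul_apply, smul_eq_mul]
  rw [h6]
  positivity

theorem contDiffAt_lowerAcc {h : Vec d → Vec d →L[ℝ] Vec d →L[ℝ] ℝ} {U : ℝ × Vec d → Vec d}
    {t : ℝ} {y : Vec d} {b : Vec d → Vec d} (hU : ContDiffAt ℝ ∞ U (t, y))
    (hh : ContDiffAt ℝ ∞ h (U (t, y))) (hb : ContDiffAt ℝ ∞ b y) :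
    ContDiffAt ℝ ∞ (fun z => lowerAcc h (fun s => U (s, z)) t (b z)) y := by
  have hs : ContDiffAt ℝ ∞ (fun z : Vec d => (t, z)) y := contDiffAt_prodMk_right
  have h0 : ContDiffAt ℝ ∞ (fun z => U (t, z)) y := ContDiffAt.comp (g := U) y hU hs
  have h1 : ContDiffAt ℝ ∞ (fun z => fderiv ℝ U (t, z) (1, 0)) y :=
    ContDiffAt.comp (g := fun q => fderiv ℝ U q (1, 0)) y (contDiffAt_fderiv_apply hU _) hs
  have h2 : ContDiffAt ℝ ∞
      (fun z => fderiv ℝ (fun q => fderiv ℝ U q (1, 0)) (t, z) (1, 0)) y :=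
    ContDiffAt.comp (g := fun q => fderiv ℝ (fun q => fderiv ℝ U q (1, 0)) q (1, 0)) y
      (contDiffAt_fderiv_apply (contDiffAt_fderiv_apply hU _) _) hs
  have h3 : ContDiffAt ℝ ∞ (fun z => h (U (t, z))) y := ContDiffAt.comp (g := h) y hh h0
  have h4 : ContDiffAt ℝ ∞ (fun z => fderiv ℝ h (U (t, z))) y :=
    ContDiffAt.comp (g := fderiv ℝ h) y (hh.fderiv_right (m := ∞) (by simp)) h0
  have h5 : ContDiffAt ℝ ∞ (fun z =>
      h (U (t, z)) (fderiv ℝ (fun q => fderiv ℝ U q (1, 0)) (t, z) (1, 0)) (b z)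
      + fderiv ℝ h (U (t, z)) (fderiv ℝ U (t, z) (1, 0)) (fderiv ℝ U (t, z) (1, 0)) (b z)
      - (1 / 2) * fderiv ℝ h (U (t, z)) (b z) (fderiv ℝ U (t, z) (1, 0))
        (fderiv ℝ U (t, z) (1, 0))) y :=
    ((((h3.clm_apply h2).clm_apply hb).add (((h4.clm_apply h1).clm_apply h1).clm_apply hb)).sub
      (contDiffAt_const.mul (((h4.clm_apply hb).clm_apply h1).clm_apply h1)))
  refine h5.congr_of_eventuallyEq ?_
  have hev : ∀ᶠ z in 𝓝 y, ContDiffAt ℝ 2 U (t, z) :=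
    hs.continuousAt.eventually ((hU.of_le (by norm_cast)).eventually (by simp))
  filter_upwards [hev] with z hz
  rw [lowerAcc, deriv_deriv_time hz, (deriv_time (hz.differentiableAt (by simp))).deriv]

end Forms

/-! ### Processes in charts -/

section ProcessesInCharts

variable {d : ℕ} {B S : Type*} [TopologicalSpace B] [ChartedSpace (Vec d) B]
  [IsManifold (mdl d) ∞ B] [TopologicalSpace S] [ChartedSpace (Vec d) S] [IsManifold (mdl d) ∞ S]

theorem posDef_components (G : Metric d B) {e : OpenPartialHomeomorph B (Vec d)}
    (he : e ∈ atlas (Vec d) B) {y : Vec d} (hy : y ∈ e.target) :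
    (components G.inner e y).PosDef := by
  have h1 : components G.inner e y
      = Matrix.of fun I J => metricIn G e y (Pi.single I 1) (Pi.single J 1) := rfl
  rw [h1]
  exact posDef_of_bilin (metricIn_symm G e y) (metricIn_pos G he hy)

theorem contDiffAt_det {E : Type*} [NormedAddCommGroup E] [NormedSpace ℝ E] {n : ℕ}
    {M : E → Matrix (Fin n) (Fin n) ℝ} {q : E}
    (hM : ∀ I J, ContDiffAt ℝ ∞ (fun q => M q I J) q) :
    ContDiffAt ℝ ∞ (fun q => (M q).det) q := by
  simp only [Matrix.det_apply']
  exact ContDiffAt.sum fun σ _ => contDiffAt_const.mul (contDiffAt_prod fun i _ => hM _ _)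

namespace GrowthProcess

variable (p : GrowthProcess d B S) (g : Metric d S) (e : OpenPartialHomeomorph B (Vec d))
  (f : OpenPartialHomeomorph S (Vec d))

/-- The state of a process, with thermal variable `θ`, in charts. -/
def stateIn (θ : ℝ → B → ℝ) (q : ℝ × Vec d) :
    Vec d × ℝ × (Vec d →L[ℝ] Vec d →L[ℝ] ℝ) × Vec d × (Vec d →L[ℝ] Vec d) ×
      (Vec d →L[ℝ] Vec d →L[ℝ] ℝ) :=
  (q.2, θ q.1 (e.symm q.2), metricIn (p.G q.1) e q.2, motionIn p.φ e f q,
    (fderiv ℝ (motionIn p.φ e f) q).comp (ContinuousLinearMap.inr ℝ ℝ (Vec d)),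
    metricIn g f (motionIn p.φ e f q))

/-- The material metric in a chart, as a function of time and the coordinates. -/
def materialMetricIn (q : ℝ × Vec d) : Vec d →L[ℝ] Vec d →L[ℝ] ℝ := metricIn (p.G q.1) e q.2

/-- The density of the material volume element in a chart. -/
def volIn (q : ℝ × Vec d) : ℝ := volDensity (components (p.G q.1).inner e q.2)

/-- The velocity in charts. -/
def velIn (q : ℝ × Vec d) : Vec d := fderiv ℝ (motionIn p.φ e f) q (1, 0)

/-- The smoothness of a process which is needed for the localization of its energy balance. -/
structure IsSmoothMotion : Prop where
  φ_smooth : ContMDiff (𝓘(ℝ, ℝ).prod (mdl d)) (mdl d) ∞ (fun q : ℝ × B => p.φ q.1 q.2)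
  F_bijective : ∀ t X, Function.Bijective (p.F t X)
  G_smooth : ∀ e ∈ atlas (Vec d) B, ∀ I J, ContDiffOn ℝ ∞
    (fun q : ℝ × Vec d => components (p.G q.1).inner e q.2 I J) (Set.univ ×ˢ e.target)

variable {p g e f}

theorem IsRegular.isSmoothMotion (hp : p.IsRegular) : p.IsSmoothMotion :=
  ⟨hp.φ_smooth, hp.F_bijective, hp.G_smooth⟩

variable (hp : p.IsSmoothMotion) (he : e ∈ atlas (Vec d) B) (hf : f ∈ atlas (Vec d) S)

include hp he

omit [IsManifold (mdl d) ∞ S] in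
theorem contDiffAt_components {q : ℝ × Vec d} (hq : q.2 ∈ e.target) (I J : Fin (d + 1)) :
    ContDiffAt ℝ ∞ (fun q : ℝ × Vec d => components (p.G q.1).inner e q.2 I J) q :=
  (hp.G_smooth e he I J).contDiffAt
    ((isOpen_univ.prod e.open_target).mem_nhds ⟨trivial, hq⟩)

omit [IsManifold (mdl d) ∞ S] in
theorem contDiffAt_materialMetricIn {q : ℝ × Vec d} (hq : q.2 ∈ e.target) :
    ContDiffAt ℝ ∞ (p.materialMetricIn e) q :=
  contDiffAt_bilin fun I J => contDiffAt_components hp he hq I J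

omit [IsManifold (mdl d) ∞ S] in
theorem contDiffAt_volIn {q : ℝ × Vec d} (hq : q.2 ∈ e.target) :
    ContDiffAt ℝ ∞ (p.volIn e) q :=
  (contDiffAt_det fun I J => contDiffAt_components hp he hq I J).sqrt
    (posDef_components (p.G q.1) he hq).det_pos.ne'

include hf

theorem stateIn_mem {θ : ℝ → B → ℝ} {T : Set ℝ} {q : ℝ × Vec d} (hq : q.2 ∈ e.target)
    (hx : p.φ q.1 (e.symm q.2) ∈ f.source) (hθ : θ q.1 (e.symm q.2) ∈ T) :
    p.stateIn g e f θ q ∈ stateSet e f T := by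
  refine ⟨hq, hθ, ⟨metricIn_symm _ _ _, metricIn_pos _ he hq⟩, f.map_source hx, ?_,
    metricIn_symm _ _ _, metricIn_pos _ hf (f.map_source hx)⟩
  have h1 : (p.stateIn g e f θ q).2.2.2.2.1
      = fun v => chartD f (p.φ q.1 (e.symm q.2)) (p.F q.1 (e.symm q.2) (chartDi e q.2 v)) := by
    funext v
    refine Eq.trans ?_ (chartD_gradient hp.φ_smooth he hf (t := q.1) (y := q.2) hq hx v).symm
    simp [stateIn]
  rw [h1]
  exact (chartD_bijective hf hx).comp ((hp.F_bijective q.1 (e.symm q.2)).comp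
    (chartDi_bijective he hq))

/-- A response function evaluated along the process is its representation in charts evaluated at the
state of the process in these charts. -/
theorem value_eq (W : Response d B S) (θ : ℝ → B → ℝ) {q : ℝ × Vec d} (hq : q.2 ∈ e.target)
    (hx : p.φ q.1 (e.symm q.2) ∈ f.source) :
    p.value g W θ q.1 (e.symm q.2) = W.inCharts e f (p.stateIn g e f θ q) := by
  refine (W.eq_inCharts he hf hq _ ((p.G q.1).inner (e.symm q.2)) hx (p.F q.1 (e.symm q.2))
    (g.inner (p.φ q.1 (e.symm q.2)))).trans (congrArg _ ?_)
  have h1 : (chartD f (p.φ q.1 (e.symm q.2))).comp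
      ((p.F q.1 (e.symm q.2) : Vec d →L[ℝ] Vec d).comp (chartDi e q.2))
      = (fderiv ℝ (motionIn p.φ e f) q).comp (ContinuousLinearMap.inr ℝ ℝ (Vec d)) := by
    ext1 v
    refine (chartD_gradient hp.φ_smooth he hf (t := q.1) (y := q.2) hq hx v).trans ?_
    simp
  have h2 : pullBack (E := Vec d) (F := Vec d) (g.inner (p.φ q.1 (e.symm q.2)))
      (chartDi f (f (p.φ q.1 (e.symm q.2)))) = metricIn g f (motionIn p.φ e f q) := by
    refine ContinuousLinearMap.ext fun v => ContinuousLinearMap.ext fun w => ?_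
    rw [metricIn_apply, motionIn, f.left_inv hx]
    rfl
  rw [stateIn, ← h1, ← h2]
  rfl

theorem contDiffAt_stateIn {θ : ℝ → B → ℝ}
    (hθ : ContMDiff (𝓘(ℝ, ℝ).prod (mdl d)) 𝓘(ℝ, ℝ) ∞ (fun q : ℝ × B => θ q.1 q.2))
    {q : ℝ × Vec d} (hq : q.2 ∈ e.target) (hx : p.φ q.1 (e.symm q.2) ∈ f.source) :
    ContDiffAt ℝ ∞ (p.stateIn g e f θ) q := by
  have h1 := contDiffAt_motionIn hp.φ_smooth he hf (t := q.1) (y := q.2) hq hx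
  have h2 : ContDiffAt ℝ ∞ (fun q => metricIn g f (motionIn p.φ e f q)) q :=
    ContDiffAt.comp (g := metricIn g f) q (contDiffAt_metricIn g hf (f.map_source hx)) h1
  have h3 : ContDiffAt ℝ ∞ (fun q => (fderiv ℝ (motionIn p.φ e f) q).comp
      (ContinuousLinearMap.inr ℝ ℝ (Vec d))) q :=
    (h1.fderiv_right (m := ∞) (by simp)).clm_comp contDiffAt_const
  exact contDiffAt_snd.prodMk ((contDiffAt_inChart hθ he hq).prodMk
    ((contDiffAt_materialMetricIn hp he hq).prodMk (h1.prodMk (h3.prodMk h2))))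

theorem contDiffAt_response {W : Response d B S} {T : Set ℝ} (hW : W.IsSmooth T)
    {θ : ℝ → B → ℝ}
    (hθ : ContMDiff (𝓘(ℝ, ℝ).prod (mdl d)) 𝓘(ℝ, ℝ) ∞ (fun q : ℝ × B => θ q.1 q.2))
    (hθT : ∀ t X, θ t X ∈ T)
    {q : ℝ × Vec d} (hq : q.2 ∈ e.target) (hx : p.φ q.1 (e.symm q.2) ∈ f.source) :
    ContDiffAt ℝ ∞ (fun q => W.inCharts e f (p.stateIn g e f θ q)) q := by
  have hmem : ∀ᶠ q' in 𝓝 q, p.stateIn g e f θ q' ∈ stateSet e f T :=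
    (eventually_mem_charts hp.φ_smooth he hq hx).mono fun q' hq' =>
      stateIn_mem hp he hf hq'.1 hq'.2 (hθT _ _)
  have h1 : ContDiffWithinAt ℝ ∞ (W.inCharts e f) (stateSet e f T) (p.stateIn g e f θ q) :=
    hW e he f hf _ hmem.self_of_nhds
  have h2 := h1.comp (t := stateSet e f T) (s := {q' | p.stateIn g e f θ q' ∈ stateSet e f T}) q
    (contDiffAt_stateIn hp he hf hθ hq hx).contDiffWithinAt (fun q' hq' => hq')
  exact h2.contDiffAt hmem

theorem inner_velocity {q : ℝ × Vec d} (hq : q.2 ∈ e.target)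
    (hx : p.φ q.1 (e.symm q.2) ∈ f.source) (k : Vec d) :
    g.inner (p.φ q.1 (e.symm q.2)) k (p.V q.1 (e.symm q.2))
      = metricIn g f (motionIn p.φ e f q) (chartD f (p.φ q.1 (e.symm q.2)) k)
        (p.velIn e f q) := by
  rw [velIn, ← chartD_velocity hp.φ_smooth he hf (t := q.1) (y := q.2) hq hx]
  exact inner_eq_metricIn g hf hx _ _

theorem inner_velocity_velocity {q : ℝ × Vec d} (hq : q.2 ∈ e.target)
    (hx : p.φ q.1 (e.symm q.2) ∈ f.source) :
    g.inner (p.φ q.1 (e.symm q.2)) (p.V q.1 (e.symm q.2)) (p.V q.1 (e.symm q.2))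
      = metricIn g f (motionIn p.φ e f q) (p.velIn e f q) (p.velIn e f q) := by
  have h1 := chartD_velocity hp.φ_smooth he hf (t := q.1) (y := q.2) hq hx
  exact (inner_eq_metricIn g hf hx (p.V q.1 (e.symm q.2)) (p.V q.1 (e.symm q.2))).trans
    (congrArg₂ (fun a b => metricIn g f (motionIn p.φ e f q) a b) h1 h1)

/-- The specific energy in terms of the free energy. -/
theorem specificEnergy_eq {E Ψ : Response d B S} (hEΨ : p.Helmholtz g E Ψ)
    {q : ℝ × Vec d} (hq : q.2 ∈ e.target) (hx : p.φ q.1 (e.symm q.2) ∈ f.source) :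
    p.specificEnergy g E q.1 (e.symm q.2) = Ψ.inCharts e f (p.stateIn g e f p.Θ q)
      + p.Θ q.1 (e.symm q.2) * p.N q.1 (e.symm q.2)
      + (1 / 2) * metricIn g f (motionIn p.φ e f q) (p.velIn e f q) (p.velIn e f q) := by
  rw [specificEnergy, hEΨ, value_eq hp he hf Ψ p.Θ hq hx, inner_velocity_velocity hp he hf hq hx]

theorem contDiffAt_velIn {q : ℝ × Vec d} (hq : q.2 ∈ e.target)
    (hx : p.φ q.1 (e.symm q.2) ∈ f.source) : ContDiffAt ℝ ∞ (p.velIn e f) q :=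
  contDiffAt_fderiv_apply (contDiffAt_motionIn hp.φ_smooth he hf (t := q.1) (y := q.2) hq hx) _

theorem contDiffAt_metricIn_motionIn {q : ℝ × Vec d} (hq : q.2 ∈ e.target)
    (hx : p.φ q.1 (e.symm q.2) ∈ f.source) :
    ContDiffAt ℝ ∞ (fun q => metricIn g f (motionIn p.φ e f q)) q :=
  ContDiffAt.comp (g := metricIn g f) q (contDiffAt_metricIn g hf (f.map_source hx))
    (contDiffAt_motionIn hp.φ_smooth he hf (t := q.1) (y := q.2) hq hx)

theorem contDiffAt_specificEnergy {E Ψ : Response d B S} (hEΨ : p.Helmholtz g E Ψ)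
    (hΨ : Ψ.IsSmooth (Set.Ioi 0))
    (hΘ : ContMDiff (𝓘(ℝ, ℝ).prod (mdl d)) 𝓘(ℝ, ℝ) ∞ (fun q : ℝ × B => p.Θ q.1 q.2))
    (hΘ_pos : ∀ t X, 0 < p.Θ t X)
    (hN : ContMDiff (𝓘(ℝ, ℝ).prod (mdl d)) 𝓘(ℝ, ℝ) ∞ (fun q : ℝ × B => p.N q.1 q.2))
    {q : ℝ × Vec d} (hq : q.2 ∈ e.target) (hx : p.φ q.1 (e.symm q.2) ∈ f.source) :
    ContDiffAt ℝ ∞ (fun q : ℝ × Vec d => p.specificEnergy g E q.1 (e.symm q.2)) q := by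
  have hv := contDiffAt_velIn hp he hf hq hx
  refine (((contDiffAt_response hp he hf hΨ hΘ hΘ_pos hq hx (g := g)).add
    ((contDiffAt_inChart hΘ he hq).mul (contDiffAt_inChart hN he hq))).add
    ((contDiffAt_const (c := (1 / 2 : ℝ))).mul (((contDiffAt_metricIn_motionIn hp he hf hq hx
      (g := g)).clm_apply hv).clm_apply hv))).congr_of_eventuallyEq ?_
  filter_upwards [eventually_mem_charts hp.φ_smooth he hq hx] with q' hq'
  exact specificEnergy_eq hp he hf hEΨ hq'.1 hq'.2

end GrowthProcess

end ProcessesInCharts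

/-! ### The power of the evolving material metric -/

section MetricPower

variable {d : ℕ} {B S : Type*} [TopologicalSpace B] [ChartedSpace (Vec d) B]
  [IsManifold (mdl d) ∞ B] [TopologicalSpace S] [ChartedSpace (Vec d) S] [IsManifold (mdl d) ∞ S]

namespace GrowthProcess

variable {p : GrowthProcess d B S} {g : Metric d S} {e : OpenPartialHomeomorph B (Vec d)}
  {f : OpenPartialHomeomorph S (Vec d)}
  (hp : p.IsSmoothMotion) (he : e ∈ atlas (Vec d) B) (hf : f ∈ atlas (Vec d) S)

include hp he

omit [IsManifold (mdl d) ∞ S] in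
/-- The rate of the material metric in a chart. -/
theorem pullBack_Gdot {t : ℝ} {y : Vec d} (hy : y ∈ e.target) :
    pullBack (E := Vec d) (F := Vec d) (p.Gdot t (e.symm y)) (chartDi e y)
      = fderiv ℝ (p.materialMetricIn e) (t, y) (1, 0) := by
  set b' := fderiv ℝ (p.materialMetricIn e) (t, y) (1, 0) with hb'
  have h1 : HasDerivAt (fun s => p.materialMetricIn e (s, y)) b' t :=
    deriv_time ((contDiffAt_materialMetricIn hp he (q := (t, y)) hy).differentiableAt (by simp))
  have h2 : HasDerivAt (fun s => pullBackCLM (chartD e (e.symm y)) (p.materialMetricIn e (s, y)))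
      (pullBackCLM (chartD e (e.symm y)) b') t :=
    HasFDerivAt.comp_hasDerivAt (l := pullBackCLM (chartD e (e.symm y))) t
      (pullBackCLM (chartD e (e.symm y))).hasFDerivAt h1
  have h3 : ∀ v, chartDi e y (chartD e (e.symm y) v) = v := fun v => by
    have := chartDi_chartD he (e.map_target hy) v
    rwa [e.right_inv hy] at this
  have h4 : (fun s => pullBackCLM (chartD e (e.symm y)) (p.materialMetricIn e (s, y)))
      = fun s => (p.G s).inner (e.symm y) := by
    funext s
    refine ContinuousLinearMap.ext fun v => ContinuousLinearMap.ext fun w => ?_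
    exact congrArg₂ (fun a b => (p.G s).inner (e.symm y) a b) (h3 v) (h3 w)
  rw [h4] at h2
  have h5 : p.Gdot t (e.symm y) = pullBackCLM (chartD e (e.symm y)) b' := h2.deriv
  rw [h5]
  refine ContinuousLinearMap.ext fun v => ContinuousLinearMap.ext fun w => ?_
  exact congrArg₂ (fun a b => b' a b) (chartD_chartDi he hy v) (chartD_chartDi he hy w)

omit [IsManifold (mdl d) ∞ S] in
theorem fderiv_materialMetricIn_symm {t : ℝ} {y : Vec d} (hy : y ∈ e.target) (v w : Vec d) :
    fderiv ℝ (p.materialMetricIn e) (t, y) (1, 0) v w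
      = fderiv ℝ (p.materialMetricIn e) (t, y) (1, 0) w v := by
  have h1 : HasDerivAt (fun s => p.materialMetricIn e (s, y))
      (fderiv ℝ (p.materialMetricIn e) (t, y) (1, 0)) t :=
    deriv_time ((contDiffAt_materialMetricIn hp he (q := (t, y)) hy).differentiableAt (by simp))
  have h2 : ∀ v w : Vec d, HasDerivAt (fun s => p.materialMetricIn e (s, y) v w)
      (fderiv ℝ (p.materialMetricIn e) (t, y) (1, 0) v w) t := fun v w => by
    have h3 := (h1.clm_apply (hasDerivAt_const t v)).clm_apply (hasDerivAt_const t w)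
    simpa using h3
  have h4 : (fun s => p.materialMetricIn e (s, y) v w) = fun s => p.materialMetricIn e (s, y) w v :=
    funext fun s => metricIn_symm _ _ _ _ _
  exact (h2 v w).unique (h4 ▸ h2 w v)

include hf

/-- The power density of the evolution of the material metric is smooth. -/
theorem contDiffAt_metricPower {E : Response d B S} {T : Set ℝ} (hE : E.IsSmooth T)
    (hN : ContMDiff (𝓘(ℝ, ℝ).prod (mdl d)) 𝓘(ℝ, ℝ) ∞ (fun q : ℝ × B => p.N q.1 q.2))
    (hNT : ∀ t X, p.N t X ∈ T) {t : ℝ} {y : Vec d} (hy : y ∈ e.target)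
    (hx : p.φ t (e.symm y) ∈ f.source) :
    ContDiffAt ℝ ∞ (fun y => p.metricPower g E t (e.symm y)) y := by
  set b' : Vec d → Vec d →L[ℝ] Vec d →L[ℝ] ℝ :=
    fun y => fderiv ℝ (p.materialMetricIn e) (t, y) (1, 0) with hb'
  -- the states occurring in the definition, as a function of the parameter and the coordinates
  set σ : ℝ × Vec d → Vec d × ℝ × (Vec d →L[ℝ] Vec d →L[ℝ] ℝ) × Vec d × (Vec d →L[ℝ] Vec d) ×
      (Vec d →L[ℝ] Vec d →L[ℝ] ℝ) := fun r =>
    ((p.stateIn g e f p.N (t, r.2)).1, (p.stateIn g e f p.N (t, r.2)).2.1,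
      (p.stateIn g e f p.N (t, r.2)).2.2.1 + r.1 • b' r.2,
      (p.stateIn g e f p.N (t, r.2)).2.2.2) with hσ
  have hpt : ContDiffAt ℝ ∞ (fun y : Vec d => (t, y)) y := contDiffAt_prodMk_right
  have hst : ContDiffAt ℝ ∞ (fun y => p.stateIn g e f p.N (t, y)) y :=
    ContDiffAt.comp (g := p.stateIn g e f p.N) y
      (contDiffAt_stateIn hp he hf hN (q := (t, y)) hy hx) hpt
  have hb'c : ContDiffAt ℝ ∞ b' y :=
    ContDiffAt.comp (g := fun q => fderiv ℝ (p.materialMetricIn e) q (1, 0)) y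
      (contDiffAt_fderiv_apply (contDiffAt_materialMetricIn hp he (q := (t, y)) hy) _) hpt
  have hsnd : ContDiffAt ℝ ∞ (fun r : ℝ × Vec d => r.2) ((0 : ℝ), y) := contDiffAt_snd
  have hst' : ContDiffAt ℝ ∞ (fun r : ℝ × Vec d => p.stateIn g e f p.N (t, r.2)) ((0 : ℝ), y) :=
    ContDiffAt.comp (g := fun y => p.stateIn g e f p.N (t, y)) ((0 : ℝ), y) hst hsnd
  have hb'' : ContDiffAt ℝ ∞ (fun r : ℝ × Vec d => b' r.2) ((0 : ℝ), y) :=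
    ContDiffAt.comp (g := b') ((0 : ℝ), y) hb'c hsnd
  have hGs : ContDiffAt ℝ ∞ (fun r : ℝ × Vec d =>
      (p.stateIn g e f p.N (t, r.2)).2.2.1 + r.1 • b' r.2) ((0 : ℝ), y) :=
    hst'.snd.snd.fst.add (ContDiffAt.smul (f := fun r : ℝ × Vec d => r.1) contDiffAt_fst hb'')
  have hσc : ContDiffAt ℝ ∞ σ ((0 : ℝ), y) :=
    hst'.fst.prodMk (hst'.snd.fst.prodMk (hGs.prodMk hst'.snd.snd.snd))
  have hmem₀ : ∀ᶠ r : ℝ × Vec d in 𝓝 ((0 : ℝ), y), r.2 ∈ e.target ∧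
      p.φ t (e.symm r.2) ∈ f.source := by
    have h1 : ContinuousAt (fun r : ℝ × Vec d => (t, r.2)) ((0 : ℝ), y) := by fun_prop
    exact h1.eventually (eventually_mem_charts hp.φ_smooth he (t := t) hy hx)
  have hpos₀ : ∀ᶠ r : ℝ × Vec d in 𝓝 ((0 : ℝ), y), ∀ v, v ≠ 0 → 0 <
      ((p.stateIn g e f p.N (t, r.2)).2.2.1 + r.1 • b' r.2) v v := by
    refine hGs.continuousAt.eventually (eventually_posDef ?_)
    intro v hv
    have := metricIn_pos (p.G t) he hy v hv
    simpa [stateIn] using this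
  have hmem : ∀ᶠ r in 𝓝 ((0 : ℝ), y), σ r ∈ stateSet e f T := by
    filter_upwards [hmem₀, hpos₀] with r hr hr'
    have h1 := stateIn_mem hp he hf (g := g) (θ := p.N) (q := (t, r.2)) hr.1 hr.2 (hNT _ _)
    refine ⟨h1.1, h1.2.1, ⟨fun v w => ?_, hr'⟩, h1.2.2.2⟩
    have h2 := fderiv_materialMetricIn_symm hp he (t := t) hr.1 v w
    have h3 := h1.2.2.1.1 v w
    simp only [hσ, hb', _root_.add_apply, _root_.smul_apply, h2, h3]
  have hcomp : ContDiffAt ℝ ∞ (fun r => E.inCharts e f (σ r)) ((0 : ℝ), y) := by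
    have h1 : ContDiffWithinAt ℝ ∞ (E.inCharts e f) (stateSet e f T) (σ (0, y)) :=
      hE e he f hf _ hmem.self_of_nhds
    exact (h1.comp (t := stateSet e f T) (s := {r | σ r ∈ stateSet e f T}) _
      hσc.contDiffWithinAt (fun r hr => hr)).contDiffAt hmem
  have hcomp' : ContDiffAt ℝ ∞
      (fun z => fderiv ℝ (fun r => E.inCharts e f (σ r)) ((0 : ℝ), z) (1, 0)) y :=
    ContDiffAt.comp (g := fun r => fderiv ℝ (fun r => E.inCharts e f (σ r)) r (1, 0)) y
      (contDiffAt_fderiv_apply hcomp _) contDiffAt_prodMk_right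
  refine hcomp'.congr_of_eventuallyEq ?_
  have hev₁ : ∀ᶠ z in 𝓝 y, DifferentiableAt ℝ (fun r => E.inCharts e f (σ r)) ((0 : ℝ), z) := by
    have h1 : ContinuousAt (fun z : Vec d => ((0 : ℝ), z)) y := by fun_prop
    exact h1.eventually (((hcomp.of_le (m := 1) (by norm_cast)).eventually (by simp)).mono
      fun r hr => hr.differentiableAt (by simp))
  filter_upwards [hev₁, hpt.continuousAt.eventually
    (eventually_mem_charts hp.φ_smooth he (t := t) hy hx)] with z hz hz'
  rw [← (deriv_time hz).deriv, metricPower]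
  congr 1
  funext s
  refine (E.eq_inCharts he hf hz'.1 _ ((p.G t).inner (e.symm z) + s • p.Gdot t (e.symm z)) hz'.2
    (p.F t (e.symm z)) (g.inner (p.φ t (e.symm z)))).trans (congrArg _ ?_)
  have h1 : (chartD f (p.φ t (e.symm z))).comp
      ((p.F t (e.symm z) : Vec d →L[ℝ] Vec d).comp (chartDi e z))
      = (fderiv ℝ (motionIn p.φ e f) (t, z)).comp (ContinuousLinearMap.inr ℝ ℝ (Vec d)) := by
    ext1 v
    refine (chartD_gradient hp.φ_smooth he hf (t := t) (y := z) hz'.1 hz'.2 v).trans ?_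
    simp
  have h2 : pullBack (E := Vec d) (F := Vec d) (g.inner (p.φ t (e.symm z)))
      (chartDi f (f (p.φ t (e.symm z)))) = metricIn g f (motionIn p.φ e f (t, z)) := by
    refine ContinuousLinearMap.ext fun v => ContinuousLinearMap.ext fun w => ?_
    rw [metricIn_apply, motionIn, f.left_inv hz'.2]
    rfl
  have h3 : pullBack (E := Vec d) (F := Vec d)
      ((p.G t).inner (e.symm z) + s • p.Gdot t (e.symm z)) (chartDi e z)
      = metricIn (p.G t) e z + s • b' z := by
    rw [hb']
    dsimp only
    rw [← pullBack_Gdot hp he hz'.1]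
    rfl
  rw [hσ]
  dsimp only [stateIn]
  rw [← h1, ← h2, ← h3]
  rfl

end GrowthProcess

end MetricPower

/-! ### Forces and fluxes in a new frame -/

section TransformedProcess

variable {d : ℕ} {B S : Type*} [TopologicalSpace B] [ChartedSpace (Vec d) B]
  [IsManifold (mdl d) ∞ B] [TopologicalSpace S] [ChartedSpace (Vec d) S] [IsManifold (mdl d) ∞ S]

namespace GrowthProcess

variable {p : GrowthProcess d B S} {g : Metric d S} {e : OpenPartialHomeomorph B (Vec d)}
  {f : OpenPartialHomeomorph S (Vec d)} {t₀ : ℝ} {c : FrameChange d S t₀} {N' R' : ℝ → B → ℝ}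

theorem transform_φ_t₀ : (p.transform g c N' R').φ t₀ = p.φ t₀ :=
  funext fun X => c.ξ_t₀ (p.φ t₀ X)

theorem transform_isSmoothMotion (hp : p.IsRegular) :
    (p.transform g c N' R').IsSmoothMotion := by
  refine ⟨ContMDiff.comp (g := fun q : ℝ × S => c.ξ q.1 q.2) c.ξ_smooth
    (contMDiff_fst.prodMk hp.φ_smooth), fun t X => ?_, hp.G_smooth⟩
  have h1 : MDifferentiableAt (mdl d) (mdl d) (p.φ t) X :=
    (contMDiff_slice hp.φ_smooth t).contMDiffAt.mdifferentiableAt (by simp)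
  have h2 : MDifferentiableAt (mdl d) (mdl d) (c.ξ t) (p.φ t X) :=
    (c.ξ t).contMDiff.contMDiffAt.mdifferentiableAt (by simp)
  have h3 : (p.transform g c N' R').F t X
      = (mfderiv (mdl d) (mdl d) (c.ξ t) (p.φ t X)).comp (p.F t X) := mfderiv_comp X h2 h1
  rw [h3]
  exact (((c.ξ t).mfderivToContinuousLinearEquiv (by simp) (p.φ t X)).bijective).comp
    (hp.F_bijective t X)

theorem motionIn_transform_t₀ (y : Vec d) :
    motionIn (p.transform g c N' R').φ e f (t₀, y) = motionIn p.φ e f (t₀, y) := by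
  rw [motionIn, motionIn, transform_φ_t₀]

/-- The power of the material metric does not depend on the frame: at time `t₀` the place, the
deformation gradient and the entropy are the same in all frames. -/
theorem transform_metricPower (E : Response d B S) (hN' : ∀ X, N' t₀ X = p.N t₀ X) (X : B) :
    (p.transform g c N' R').metricPower g E t₀ X = p.metricPower g E t₀ X := by
  have h1 : ∀ φ₁ φ₂ : B → S, φ₁ = φ₂ → ∀ n₁ n₂ : ℝ, n₁ = n₂ →
      deriv (fun s : ℝ => E X n₁ ((p.G t₀).inner X + s • p.Gdot t₀ X) (φ₁ X)
        (mfderiv (mdl d) (mdl d) φ₁ X) (g.inner (φ₁ X))) 0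
      = deriv (fun s : ℝ => E X n₂ ((p.G t₀).inner X + s • p.Gdot t₀ X) (φ₂ X)
        (mfderiv (mdl d) (mdl d) φ₂ X) (g.inner (φ₂ X))) 0 := by
    rintro _ _ rfl _ _ rfl
    rfl
  exact h1 _ _ transform_φ_t₀ _ _ (hN' X)

omit [IsManifold (mdl d) ∞ S] in
/-- At time `t₀` the derivative of the frame change is the identity. -/
theorem chartD_mfderiv_frame (c : FrameChange d S t₀) (f : OpenPartialHomeomorph S (Vec d)) (x : S)
    (k : Vec d) :
    chartD f (c.ξ t₀ x) (mfderiv (mdl d) (mdl d) (c.ξ t₀) x k : Vec d) = chartD f x k := by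
  have h1 : ∀ ξ : S → S, ξ = id → chartD f (ξ x) (mfderiv (mdl d) (mdl d) ξ x k : Vec d)
      = chartD f x k := by
    rintro _ rfl
    rw [mfderiv_id]
    rfl
  exact h1 _ (funext c.ξ_t₀)

/-- The body force in charts. -/
def forceIn (p : GrowthProcess d B S) (e : OpenPartialHomeomorph B (Vec d))
    (f : OpenPartialHomeomorph S (Vec d)) (q : ℝ × Vec d) : Vec d :=
  chartD f (p.φ q.1 (e.symm q.2)) (p.force q.1 (e.symm q.2))

/-- The stress vector `P^{·I}` in charts. -/
def stressIn (p : GrowthProcess d B S) (e : OpenPartialHomeomorph B (Vec d))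
    (f : OpenPartialHomeomorph S (Vec d)) (q : ℝ × Vec d) (I : Fin (d + 1)) : Vec d :=
  fun a => p.Pcomp e f q.1 q.2 a I

/-- The heat flux in a chart. -/
def heatIn (p : GrowthProcess d B S) (e : OpenPartialHomeomorph B (Vec d)) (q : ℝ × Vec d) :
    Vec d :=
  chartD e (e.symm q.2) (p.Q q.1 (e.symm q.2))

variable (hp : p.IsRegular) (he : e ∈ atlas (Vec d) B) (hf : f ∈ atlas (Vec d) S)

include hp he hf

/-- The power of the body force in the new frame at time `t₀`. By the transformation rule for
`B - A` it contains the power of the new acceleration. -/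
theorem transform_forcePower {y : Vec d} (hy : y ∈ e.target)
    (hx : p.φ t₀ (e.symm y) ∈ f.source) :
    g.inner ((p.transform g c N' R').φ t₀ (e.symm y))
        ((p.transform g c N' R').force t₀ (e.symm y)) ((p.transform g c N' R').V t₀ (e.symm y))
      = lowerAcc (metricIn g f) (fun s => motionIn (p.transform g c N' R').φ e f (s, y)) t₀
          ((p.transform g c N' R').velIn e f (t₀, y))
        + metricIn g f (motionIn p.φ e f (t₀, y)) (p.forceIn e f (t₀, y))
          ((p.transform g c N' R').velIn e f (t₀, y))
        - lowerAcc (metricIn g f) (fun s => motionIn p.φ e f (s, y)) t₀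
          ((p.transform g c N' R').velIn e f (t₀, y)) := by
  set p' := p.transform g c N' R' with hp'_def
  have hp' : p'.IsSmoothMotion := transform_isSmoothMotion hp
  set X := e.symm y with hX
  have hx' : p'.φ t₀ X ∈ f.source := by rw [transform_φ_t₀]; exact hx
  have hvel : chartD f (p'.φ t₀ X) (p'.V t₀ X) = p'.velIn e f (t₀, y) :=
    chartD_velocity hp'.φ_smooth he hf hy hx'
  have h1 : g.inner (p'.φ t₀ X) (acceleration g (fun s => p'.φ s X) t₀) (p'.V t₀ X)
      = lowerAcc (metricIn g f) (fun s => motionIn p'.φ e f (s, y)) t₀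
        (p'.velIn e f (t₀, y)) := by
    rw [← hvel]
    exact inner_acceleration g hf (contMDiff_path hp'.φ_smooth X).contMDiffAt hx' (p'.V t₀ X)
  have h2 : g.inner (p'.φ t₀ X) (mfderiv (mdl d) (mdl d) (c.ξ t₀) (p.φ t₀ X)
      (p.force t₀ X - p.A g t₀ X)) (p'.V t₀ X)
      = metricIn g f (motionIn p.φ e f (t₀, y)) (p.forceIn e f (t₀, y)) (p'.velIn e f (t₀, y))
        - lowerAcc (metricIn g f) (fun s => motionIn p.φ e f (s, y)) t₀
          (p'.velIn e f (t₀, y)) := by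
    have e1 := inner_velocity (g := g) hp' he hf (q := (t₀, y)) hy hx'
      (mfderiv (mdl d) (mdl d) (c.ξ t₀) (p.φ t₀ X) (p.force t₀ X - p.A g t₀ X))
    refine e1.trans ?_
    rw [motionIn_transform_t₀]
    have e2 : chartD f (p'.φ t₀ X) (mfderiv (mdl d) (mdl d) (c.ξ t₀) (p.φ t₀ X)
        (p.force t₀ X - p.A g t₀ X) : Vec d)
        = p.forceIn e f (t₀, y) - chartD f (p.φ t₀ X) (p.A g t₀ X) :=
      (chartD_mfderiv_frame c f (p.φ t₀ X) _).trans
        (map_sub (chartD f (p.φ t₀ X)) (p.force t₀ X : Vec d) (p.A g t₀ X : Vec d))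
    have e3 : metricIn g f (motionIn p.φ e f (t₀, y)) (chartD f (p.φ t₀ X) (p.A g t₀ X))
        (p'.velIn e f (t₀, y))
        = lowerAcc (metricIn g f) (fun s => motionIn p.φ e f (s, y)) t₀
          (p'.velIn e f (t₀, y)) := by
      have e4 : chartD f (p.φ t₀ X) (chartDi f (f (p.φ t₀ X)) (p'.velIn e f (t₀, y)))
          = p'.velIn e f (t₀, y) := by
        have := chartD_chartDi hf (f.map_source hx) (p'.velIn e f (t₀, y))
        rwa [f.left_inv hx] at this
      have e5 := inner_acceleration g hf (contMDiff_path hp.φ_smooth X).contMDiffAt hx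
        (t := t₀) (chartDi f (f (p.φ t₀ X)) (p'.velIn e f (t₀, y)))
      have e6 := inner_eq_metricIn g hf hx (p.A g t₀ X)
        (chartDi f (f (p.φ t₀ X)) (p'.velIn e f (t₀, y)))
      rw [e4] at e5 e6
      exact e6.symm.trans e5
    have e7 : metricIn g f (motionIn p.φ e f (t₀, y)) (p.forceIn e f (t₀, y)
        - chartD f (p.φ t₀ X) (p.A g t₀ X)) (p'.velIn e f (t₀, y)) = _ :=
      DFunLike.congr_fun (map_sub (metricIn g f (motionIn p.φ e f (t₀, y))) _ _) _
    rw [← e3]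
    refine (congrArg (fun a => metricIn g f (motionIn p.φ e f (t₀, y)) a
      (p'.velIn e f (t₀, y))) e2).trans ?_
    exact e7
  have h3 : g.inner (p'.φ t₀ X) (p'.force t₀ X) (p'.V t₀ X)
      = g.inner (p'.φ t₀ X) (acceleration g (fun s => p'.φ s X) t₀) (p'.V t₀ X)
        + g.inner (p'.φ t₀ X) (mfderiv (mdl d) (mdl d) (c.ξ t₀) (p.φ t₀ X)
      (p.force t₀ X - p.A g t₀ X)) (p'.V t₀ X) :=
    DFunLike.congr_fun (map_add (g.inner (p'.φ t₀ X)) _ _) _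
  rw [h3, h1, h2]
  ring

/-- The energy flux in the new frame at time `t₀`, per unit coordinate area. -/
theorem transform_surfacePower {y : Vec d} (hy : y ∈ e.target)
    (hx : p.φ t₀ (e.symm y) ∈ f.source) (i : Fin (d + 1)) :
    (p.transform g c N' R').surfacePower g t₀ (e.symm y)
        (unitConormal (p.G t₀).inner e y i) * areaDensity (components (p.G t₀).inner e y) i
      = p.volIn e (t₀, y) * (metricIn g f (motionIn p.φ e f (t₀, y)) (p.stressIn e f (t₀, y) i)
          ((p.transform g c N' R').velIn e f (t₀, y)) - p.heatIn e (t₀, y) i) := by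
  set p' := p.transform g c N' R' with hp'_def
  have hp' : p'.IsSmoothMotion := transform_isSmoothMotion hp
  set X := e.symm y with hX
  have hx' : p'.φ t₀ X ∈ f.source := by rw [transform_φ_t₀]; exact hx
  have h1 : ∀ (r : ℝ) (ν : Cotan d X),
      p'.surfacePower g t₀ X (r • ν) = r * p'.surfacePower g t₀ X ν := fun r ν => by
    rw [surfacePower, surfacePower, map_smul, map_smul, _root_.smul_apply, _root_.smul_apply]
    simp only [smul_eq_mul]
    ring
  have h2 : p'.surfacePower g t₀ X (coordCovec e y i)
      = metricIn g f (motionIn p.φ e f (t₀, y)) (p.stressIn e f (t₀, y) i)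
          (p'.velIn e f (t₀, y)) - p.heatIn e (t₀, y) i := by
    have e1 := inner_velocity (g := g) hp' he hf (q := (t₀, y)) hy hx'
      (p'.P t₀ X (coordCovec e y i))
    rw [motionIn_transform_t₀] at e1
    have e2 : chartD f (p'.φ t₀ X) (p'.P t₀ X (coordCovec e y i))
        = p.stressIn e f (t₀, y) i := chartD_mfderiv_frame c f (p.φ t₀ X) _
    have e3 : coordCovec e y i (p'.Q t₀ X) = p.heatIn e (t₀, y) i := by
      have : p'.Q t₀ X = p.Q t₀ X := by
        change c.ζ t₀ • p.Q t₀ X = p.Q t₀ X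
        rw [c.ζ_t₀, one_smul]
      rw [this]
      rfl
    rw [surfacePower, e3]
    congr 1
    exact e1.trans (congrArg (fun a => metricIn g f (motionIn p.φ e f (t₀, y)) a
      (p'.velIn e f (t₀, y))) e2)
  have h3 := areaDensity_eq (posDef_components (p.G t₀) he hy) i
  rw [unitConormal, h1, h2, volIn]
  dsimp only
  rw [← h3]
  ring

end GrowthProcess

end TransformedProcess

/-! ### The local energy balance in a new frame -/

section LocalBalance

variable {d : ℕ} {B S : Type*} [TopologicalSpace B] [ChartedSpace (Vec d) B]
  [IsManifold (mdl d) ∞ B] [TopologicalSpace S] [ChartedSpace (Vec d) S] [IsManifold (mdl d) ∞ S]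

namespace GrowthProcess

variable {p : GrowthProcess d B S} {g : Metric d S} {e : OpenPartialHomeomorph B (Vec d)}
  {f : OpenPartialHomeomorph S (Vec d)} {t₀ : ℝ} {c : FrameChange d S t₀} {N' R' : ℝ → B → ℝ}
  (hp : p.IsRegular) (he : e ∈ atlas (Vec d) B) (hf : f ∈ atlas (Vec d) S)

include hp he

theorem contDiffAt_heatIn {q : ℝ × Vec d} (hq : q.2 ∈ e.target) :
    ContDiffAt ℝ ∞ (p.heatIn e) q :=
  contMDiffAt_iff_contDiffAt.1 (contMDiffAt_chartD_section he
    (b := fun q : ℝ × Vec d => e.symm q.2) (V := fun q : ℝ × Vec d => p.Q q.1 (e.symm q.2))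
    (contMDiffAt_inChart hp.Q_smooth he hq) (e.map_target hq))

include hf

theorem contDiffAt_forceIn {q : ℝ × Vec d} (hq : q.2 ∈ e.target)
    (hx : p.φ q.1 (e.symm q.2) ∈ f.source) : ContDiffAt ℝ ∞ (p.forceIn e f) q :=
  contMDiffAt_iff_contDiffAt.1 (contMDiffAt_chartD_section hf
    (b := fun q : ℝ × Vec d => p.φ q.1 (e.symm q.2))
    (V := fun q : ℝ × Vec d => p.force q.1 (e.symm q.2))
    (contMDiffAt_inChart hp.force_smooth he hq) hx)

theorem contDiffAt_stressIn {q : ℝ × Vec d} (hq : q.2 ∈ e.target)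
    (hx : p.φ q.1 (e.symm q.2) ∈ f.source) (I : Fin (d + 1)) :
    ContDiffAt ℝ ∞ (fun q => p.stressIn e f q I) q :=
  contDiffAt_pi.2 fun a => (hp.P_smooth e he f hf a I).contDiffAt
    (eventually_mem_charts hp.φ_smooth he (t := q.1) (y := q.2) hq hx)

/-- The energy balance in a new frame, localized at a point and expressed in charts. The entropy and
the heat supply of the new frame enter only through `∂N'/∂t`, since `R'` is eliminated by its
transformation rule. -/
theorem transform_local_balance {E Ψ : Response d B S} {entropies : Set ℝ}
    (hN : ∀ t X, p.N t X ∈ entropies) (hE : E.IsSmooth entropies) (hΨ : Ψ.IsSmooth (Set.Ioi 0))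
    (hN'_smooth : ContMDiff (𝓘(ℝ, ℝ).prod (mdl d)) 𝓘(ℝ, ℝ) ∞ (fun q : ℝ × B => N' q.1 q.2))
    (hN' : ∀ X, N' t₀ X = p.N t₀ X)
    (hR' : ∀ t X, deriv (fun s => N' s X) t * (c.ζ t * p.Θ t X) - R' t X =
      c.ζ t * (deriv (fun s => p.N s X) t * p.Θ t X - p.R t X))
    (hH : (p.transform g c N' R').Helmholtz g E Ψ)
    (hB : (p.transform g c N' R').EnergyBalance g E t₀)
    {y : Vec d} (hy : y ∈ e.target) (hx : p.φ t₀ (e.symm y) ∈ f.source) :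
    deriv (fun t => p.ρ t (e.symm y) * (p.transform g c N' R').specificEnergy g E t (e.symm y)
        * p.volIn e (t, y)) t₀
      = (p.ρ t₀ (e.symm y) *
          (lowerAcc (metricIn g f) (fun s => motionIn (p.transform g c N' R').φ e f (s, y)) t₀
            ((p.transform g c N' R').velIn e f (t₀, y))
          + metricIn g f (motionIn p.φ e f (t₀, y)) (p.forceIn e f (t₀, y))
            ((p.transform g c N' R').velIn e f (t₀, y))
          - lowerAcc (metricIn g f) (fun s => motionIn p.φ e f (s, y)) t₀
            ((p.transform g c N' R').velIn e f (t₀, y))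
          + (deriv (fun s => N' s (e.symm y)) t₀ * p.Θ t₀ (e.symm y)
            - (deriv (fun s => p.N s (e.symm y)) t₀ * p.Θ t₀ (e.symm y) - p.R t₀ (e.symm y))))
          + p.ρ t₀ (e.symm y) * p.metricPower g E t₀ (e.symm y)
          + p.Sm t₀ (e.symm y) * (p.transform g c N' R').specificEnergy g E t₀ (e.symm y))
          * p.volIn e (t₀, y)
        + ∑ i, fderiv ℝ (fun z => p.volIn e (t₀, z) *
            (metricIn g f (motionIn p.φ e f (t₀, z)) (p.stressIn e f (t₀, z) i)
              ((p.transform g c N' R').velIn e f (t₀, z)) - p.heatIn e (t₀, z) i)) y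
            (stdVec i) := by
  set p' := p.transform g c N' R' with hp'_def
  have hp' : p'.IsSmoothMotion := transform_isSmoothMotion hp
  have hpm := hp.isSmoothMotion
  have hx' : p'.φ t₀ (e.symm y) ∈ f.source := by rw [transform_φ_t₀]; exact hx
  have hpt : ContDiffAt ℝ ∞ (fun y : Vec d => (t₀, y)) y := contDiffAt_prodMk_right
  have hslice : ∀ {F : Type} [NormedAddCommGroup F] [NormedSpace ℝ F] {U : ℝ × Vec d → F},
      ContDiffAt ℝ ∞ U (t₀, y) → ContDiffAt ℝ ∞ (fun z => U (t₀, z)) y := fun {F} _ _ {U} hU =>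
    ContDiffAt.comp (g := U) y hU hpt
  have hΘ' : ContMDiff (𝓘(ℝ, ℝ).prod (mdl d)) 𝓘(ℝ, ℝ) ∞ (fun q : ℝ × B => p'.Θ q.1 q.2) := by
    have h1 : ContMDiff (𝓘(ℝ, ℝ).prod (mdl d)) 𝓘(ℝ, ℝ) ∞ (fun q : ℝ × B => c.ζ q.1) :=
      ContMDiff.comp (g := c.ζ) c.ζ_smooth.contMDiff contMDiff_fst
    exact h1.mul hp.Θ_smooth
  have hΘ'_pos : ∀ t X, 0 < p'.Θ t X := fun t X => mul_pos (c.ζ_pos t) (hp.Θ_pos t X)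
  have hvol := contDiffAt_volIn hpm he (q := (t₀, y)) hy
  have hvel := hslice (contDiffAt_velIn hp' he hf (q := (t₀, y)) hy hx')
  have hu := contDiffAt_motionIn hp.φ_smooth he hf hy hx
  have hu' := contDiffAt_motionIn hp'.φ_smooth he hf hy hx'
  have hh := hslice (contDiffAt_metricIn_motionIn hpm he hf (g := g) (q := (t₀, y)) hy hx)
  have hgu := contDiffAt_metricIn g hf (f.map_source hx)
  have hgu' := contDiffAt_metricIn g hf (f.map_source hx')
  have hsp : ContDiffAt ℝ ∞ (fun q : ℝ × Vec d => p'.specificEnergy g E q.1 (e.symm q.2))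
      (t₀, y) :=
    contDiffAt_specificEnergy hp' he hf hH hΨ hΘ' hΘ'_pos hN'_smooth hy hx'
  have hrate : ∀ {F : ℝ → B → ℝ},
      ContMDiff (𝓘(ℝ, ℝ).prod (mdl d)) 𝓘(ℝ, ℝ) ∞ (fun q : ℝ × B => F q.1 q.2) →
      ContDiffAt ℝ ∞ (fun z => deriv (fun s => F s (e.symm z)) t₀) y := fun {F} hF => by
    have h1 := hslice (contDiffAt_fderiv_apply (contDiffAt_inChart hF he (q := (t₀, y)) hy) (1, 0))
    refine h1.congr_of_eventuallyEq ?_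
    filter_upwards [e.open_target.mem_nhds hy] with z hz
    exact (deriv_time ((contDiffAt_inChart hF he (q := (t₀, z)) hz).differentiableAt
      (by simp))).deriv
  -- the supply terms in charts
  set σ : Vec d → ℝ := fun z => (p.ρ t₀ (e.symm z) *
          (lowerAcc (metricIn g f) (fun s => motionIn p'.φ e f (s, z)) t₀ (p'.velIn e f (t₀, z))
          + metricIn g f (motionIn p.φ e f (t₀, z)) (p.forceIn e f (t₀, z)) (p'.velIn e f (t₀, z))
          - lowerAcc (metricIn g f) (fun s => motionIn p.φ e f (s, z)) t₀ (p'.velIn e f (t₀, z))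
          + (deriv (fun s => N' s (e.symm z)) t₀ * p.Θ t₀ (e.symm z)
            - (deriv (fun s => p.N s (e.symm z)) t₀ * p.Θ t₀ (e.symm z) - p.R t₀ (e.symm z))))
          + p.ρ t₀ (e.symm z) * p.metricPower g E t₀ (e.symm z)
          + p.Sm t₀ (e.symm z) * p'.specificEnergy g E t₀ (e.symm z))
          * p.volIn e (t₀, z) with hσ
  have hσ_smooth : ContDiffAt ℝ ∞ σ y := by
    have hρ := hslice (contDiffAt_inChart hp.ρ_smooth he (q := (t₀, y)) hy)
    have hSm := hslice (contDiffAt_inChart hp.Sm_smooth he (q := (t₀, y)) hy)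
    have hR := hslice (contDiffAt_inChart hp.R_smooth he (q := (t₀, y)) hy)
    have hΘ := hslice (contDiffAt_inChart hp.Θ_smooth he (q := (t₀, y)) hy)
    have hforce := hslice (contDiffAt_forceIn hp he hf (q := (t₀, y)) hy hx)
    have hA' := contDiffAt_lowerAcc hu' hgu' hvel
    have hA := contDiffAt_lowerAcc hu hgu hvel
    have hMP := contDiffAt_metricPower hpm he hf (g := g) hE hp.N_smooth hN hy hx
    exact ((((hρ.mul (((hA'.add ((hh.clm_apply hforce).clm_apply hvel)).sub hA).add
      (((hrate hN'_smooth).mul hΘ).sub (((hrate hp.N_smooth).mul hΘ).sub hR)))).add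
      (hρ.mul hMP)).add (hSm.mul (hslice hsp)))).mul (hslice hvol)
  set J : Fin (d + 1) → Vec d → ℝ := fun i z => p.volIn e (t₀, z) *
      (metricIn g f (motionIn p.φ e f (t₀, z)) (p.stressIn e f (t₀, z) i)
        (p'.velIn e f (t₀, z)) - p.heatIn e (t₀, z) i) with hJ
  have hJ_smooth : ∀ i, ContDiffAt ℝ ∞ (J i) y := fun i => by
    have h1 := hslice (contDiffAt_stressIn hp he hf (q := (t₀, y)) hy hx i)
    have h2 := contDiffAt_pi.1 (hslice (contDiffAt_heatIn hp he (q := (t₀, y)) hy)) i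
    exact (hslice hvol).mul (((hh.clm_apply h1).clm_apply hvel).sub h2)
  have hε : ContDiffAt ℝ ∞ (fun q : ℝ × Vec d => p.ρ q.1 (e.symm q.2)
      * p'.specificEnergy g E q.1 (e.symm q.2) * p.volIn e (q.1, q.2)) (t₀, y) :=
    ((contDiffAt_inChart hp.ρ_smooth he (q := (t₀, y)) hy).mul hsp).mul hvol
  have hU : {z | z ∈ e.target ∧ p.φ t₀ (e.symm z) ∈ f.source} ∈ 𝓝 y :=
    hpt.continuousAt.eventually (eventually_mem_charts hp.φ_smooth he (t := t₀) hy hx)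
  have hsupply : ∀ z, z ∈ e.target → p.φ t₀ (e.symm z) ∈ f.source →
      p'.supply g E t₀ (e.symm z) * volDensity (components (p'.G t₀).inner e z) = σ z :=
    fun z hz hzx => by
      have e1 := transform_forcePower (g := g) (c := c) (N' := N') (R' := R') hp he hf hz hzx
      have e2 := hR' t₀ (e.symm z)
      rw [c.ζ_t₀, one_mul, one_mul] at e2
      have e3 : p'.R t₀ (e.symm z) = deriv (fun s => N' s (e.symm z)) t₀ * p.Θ t₀ (e.symm z)
          - (deriv (fun s => p.N s (e.symm z)) t₀ * p.Θ t₀ (e.symm z) - p.R t₀ (e.symm z)) := by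
        rw [← e2]
        change R' t₀ (e.symm z) = _
        ring
      rw [supply, e1, e3, transform_metricPower E hN']
      rfl
  have hflux : ∀ i z, z ∈ e.target → p.φ t₀ (e.symm z) ∈ f.source →
      p'.surfacePower g t₀ (e.symm z) (unitConormal (p'.G t₀).inner e z i)
        * areaDensity (components (p'.G t₀).inner e z) i = J i z := fun i z hz hzx =>
    transform_surfacePower hp he hf hz hzx i
  have hflux' : ∀ i z, z ∈ e.target → p.φ t₀ (e.symm z) ∈ f.source →
      p'.surfacePower g t₀ (e.symm z) (-unitConormal (p'.G t₀).inner e z i)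
        * areaDensity (components (p'.G t₀).inner e z) i = -J i z := fun i z hz hzx => by
    rw [← hflux i z hz hzx, surfacePower, surfacePower, map_neg, map_neg, neg_apply,
      neg_apply]
    ring
  refine deriv_eq_add_divergence_of_balance
    (ε := fun t z => p.ρ t (e.symm z) * p'.specificEnergy g E t (e.symm z) * p.volIn e (t, z))
    (s := σ) (J := J) hU (hε.of_le (m := 1) (by norm_cast))
    (hσ_smooth.of_le (m := 1) (by norm_cast))
    (fun i => (hJ_smooth i).of_le (m := 1) (by norm_cast)) ?_
  intro a b hab hsub
  have hle : ∀ i, a i ≤ b i := fun i => (hab i).le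
  have hface : ∀ (i : Fin (d + 1)) (r : ℝ), r ∈ Set.Icc (a i) (b i) →
      ∀ x ∈ Set.Icc (a ∘ i.succAbove) (b ∘ i.succAbove),
      i.insertNth (α := fun _ => ℝ) r x ∈ Set.Icc a b := fun i r hr x hx => by
    rw [Fin.insertNth_mem_Icc]
    exact ⟨hr, hx⟩
  have h1 := hB e he a b hab (hsub.trans fun z hz => hz.1)
  have e1 : (∫ z in Set.Icc a b, p'.supply g E t₀ (e.symm z)
      * volDensity (components (p'.G t₀).inner e z)) = ∫ z in Set.Icc a b, σ z :=
    MeasureTheory.setIntegral_congr_fun measurableSet_Icc fun z hz =>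
      hsupply z (hsub hz).1 (hsub hz).2
  have e2 : ∀ i : Fin (d + 1), (∫ x in Set.Icc (a ∘ i.succAbove) (b ∘ i.succAbove),
      (fun z : Vec d => p'.surfacePower g t₀ (e.symm z) (unitConormal (p'.G t₀).inner e z i) *
        areaDensity (components (p'.G t₀).inner e z) i) (i.insertNth (α := fun _ => ℝ) (b i) x))
      = ∫ x in Set.Icc (a ∘ i.succAbove) (b ∘ i.succAbove),
        J i (i.insertNth (α := fun _ => ℝ) (b i) x) := fun i =>
    MeasureTheory.setIntegral_congr_fun measurableSet_Icc fun x hx => by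
      have := hsub (hface i (b i) ⟨hle i, le_rfl⟩ x hx)
      exact hflux i _ this.1 this.2
  have e3 : ∀ i : Fin (d + 1), (∫ x in Set.Icc (a ∘ i.succAbove) (b ∘ i.succAbove),
      (fun z : Vec d => p'.surfacePower g t₀ (e.symm z) (-unitConormal (p'.G t₀).inner e z i) *
        areaDensity (components (p'.G t₀).inner e z) i) (i.insertNth (α := fun _ => ℝ) (a i) x))
      = -∫ x in Set.Icc (a ∘ i.succAbove) (b ∘ i.succAbove),
        J i (i.insertNth (α := fun _ => ℝ) (a i) x) := fun i => by
    rw [← MeasureTheory.integral_neg]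
    refine MeasureTheory.setIntegral_congr_fun measurableSet_Icc fun x hx => ?_
    have := hsub (hface i (a i) ⟨le_rfl, hle i⟩ x hx)
    exact hflux' i _ this.1 this.2
  rw [e1, Finset.sum_congr rfl fun i _ => by rw [e2 i, e3 i, ← sub_eq_add_neg]] at h1
  exact h1

end GrowthProcess

end LocalBalance

/-! ### Rates of the state in a new frame -/

section FrameRates

variable {d : ℕ} {B S : Type*} [TopologicalSpace B] [ChartedSpace (Vec d) B]
  [IsManifold (mdl d) ∞ B] [TopologicalSpace S] [ChartedSpace (Vec d) S] [IsManifold (mdl d) ∞ S]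

namespace GrowthProcess

/-- In the chart `f` the diffeomorphisms of a frame change are `z ↦ z + η_t w(z)`, where `η`
vanishes at `t₀` and has derivative one there; so `w` is their velocity at `t₀`. The rate of the
temperature rescaling at `t₀` is `r`. -/
structure HasRates {t₀ : ℝ} (c : FrameChange d S t₀) (f : OpenPartialHomeomorph S (Vec d))
    (η : ℝ → ℝ) (w : Vec d → Vec d) (r : ℝ) : Prop where
  η_smooth : ContDiff ℝ ∞ η
  η_t₀ : η t₀ = 0
  hasDerivAt_η : HasDerivAt η 1 t₀
  w_smooth : ContDiff ℝ ∞ w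
  hasDerivAt_ζ : HasDerivAt c.ζ r t₀
  mem_source : ∀ t, ∀ x ∈ f.source, c.ξ t x ∈ f.source
  eq_add : ∀ t, ∀ x ∈ f.source, f (c.ξ t x) = f x + η t • w (f x)

variable {p : GrowthProcess d B S} {g : Metric d S} {e : OpenPartialHomeomorph B (Vec d)}
  {f : OpenPartialHomeomorph S (Vec d)} {t₀ : ℝ} {c : FrameChange d S t₀} {N' R' : ℝ → B → ℝ}
  {η : ℝ → ℝ} {w : Vec d → Vec d} {r : ℝ}
  (hc : HasRates c f η w r) (hp : p.IsRegular) (he : e ∈ atlas (Vec d) B)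
  (hf : f ∈ atlas (Vec d) S)

include hc in
theorem motionIn_transform {q : ℝ × Vec d} (hx : p.φ q.1 (e.symm q.2) ∈ f.source) :
    motionIn (p.transform g c N' R').φ e f q
      = motionIn p.φ e f q + η q.1 • w (motionIn p.φ e f q) :=
  hc.eq_add q.1 _ hx

include hc hp he hf

theorem hasFDerivAt_motionIn_transform {q : ℝ × Vec d} (hq : q.2 ∈ e.target)
    (hx : p.φ q.1 (e.symm q.2) ∈ f.source) :
    HasFDerivAt (motionIn (p.transform g c N' R').φ e f)
      (fderiv ℝ (motionIn p.φ e f) q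
        + (η q.1 • (fderiv ℝ w (motionIn p.φ e f q)).comp (fderiv ℝ (motionIn p.φ e f) q)
          + (deriv η q.1 • ContinuousLinearMap.fst ℝ ℝ (Vec d)).smulRight
            (w (motionIn p.φ e f q)))) q := by
  have h1 : HasFDerivAt (motionIn p.φ e f) (fderiv ℝ (motionIn p.φ e f) q) q :=
    ((contDiffAt_motionIn hp.φ_smooth he hf (t := q.1) (y := q.2) hq hx).differentiableAt
      (by simp)).hasFDerivAt
  have h2 : HasFDerivAt w (fderiv ℝ w (motionIn p.φ e f q)) (motionIn p.φ e f q) :=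
    (hc.w_smooth.differentiable (by simp) _).hasFDerivAt
  have h3 : HasFDerivAt (fun q : ℝ × Vec d => η q.1)
      (deriv η q.1 • ContinuousLinearMap.fst ℝ ℝ (Vec d)) q :=
    (hc.η_smooth.differentiable (by simp) q.1).hasDerivAt.comp_hasFDerivAt q hasFDerivAt_fst
  have h4 := h1.add (h3.smul (h2.comp q h1))
  refine h4.congr_of_eventuallyEq ?_
  filter_upwards [eventually_mem_charts hp.φ_smooth he (t := q.1) (y := q.2) hq hx] with q' hq'
  exact motionIn_transform hc hq'.2

/-- The velocity in the new frame at time `t₀` is the old one plus the velocity of the frame. -/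
theorem velIn_transform {y : Vec d} (hy : y ∈ e.target) (hx : p.φ t₀ (e.symm y) ∈ f.source) :
    (p.transform g c N' R').velIn e f (t₀, y)
      = p.velIn e f (t₀, y) + w (motionIn p.φ e f (t₀, y)) := by
  rw [velIn, (hasFDerivAt_motionIn_transform hc hp he hf (q := (t₀, y)) hy hx).fderiv]
  simp [velIn, hc.η_t₀, hc.hasDerivAt_η.deriv]

omit hp he hf [IsManifold (mdl d) ∞ S] in
theorem hasDerivAt_amplitude_smul {F : Type*} [NormedAddCommGroup F] [NormedSpace ℝ F] {k : ℝ → F}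
    (hk : DifferentiableAt ℝ k t₀) : HasDerivAt (fun t => η t • k t) (k t₀) t₀ := by
  refine (hc.hasDerivAt_η.smul hk.hasDerivAt).congr_deriv ?_
  rw [hc.η_t₀, zero_smul, zero_add, one_smul]

/-- The rate of change of the state in the new frame. -/
theorem hasDerivAt_stateIn_transform {y : Vec d} (hy : y ∈ e.target)
    (hx : p.φ t₀ (e.symm y) ∈ f.source) :
    HasDerivAt (fun t => (p.transform g c N' R').stateIn g e f (p.transform g c N' R').Θ (t, y))
      (fderiv ℝ (p.stateIn g e f p.Θ) (t₀, y) (1, 0)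
        + (0, r * p.Θ t₀ (e.symm y), 0, w (motionIn p.φ e f (t₀, y)),
          (fderiv ℝ w (motionIn p.φ e f (t₀, y))).comp
            ((fderiv ℝ (motionIn p.φ e f) (t₀, y)).comp (ContinuousLinearMap.inr ℝ ℝ (Vec d))),
          fderiv ℝ (metricIn g f) (motionIn p.φ e f (t₀, y)) (w (motionIn p.φ e f (t₀, y)))))
      t₀ := by
  set U := motionIn p.φ e f with hU_def
  set p' := p.transform g c N' R' with hp'_def
  have hmem : ∀ᶠ t in 𝓝 t₀, p.φ t (e.symm y) ∈ f.source := by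
    have h1 : ContinuousAt (fun t : ℝ => (t, y)) t₀ := by fun_prop
    exact (h1.eventually (eventually_mem_charts hp.φ_smooth he hy hx)).mono fun t ht => ht.2
  have hUs := contDiffAt_motionIn hp.φ_smooth he hf hy hx
  have hst : ContDiffAt ℝ ∞ (fun t : ℝ => (t, y)) t₀ := contDiffAt_id.prodMk contDiffAt_const
  have hUt : ContDiffAt ℝ ∞ (fun t => U (t, y)) t₀ := ContDiffAt.comp (g := U) t₀ hUs hst
  have hDU : ContDiffAt ℝ ∞ (fun t => fderiv ℝ U (t, y)) t₀ :=
    ContDiffAt.comp (g := fderiv ℝ U) t₀ (hUs.fderiv_right (m := ∞) (by simp)) hst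
  have hwU : ContDiffAt ℝ ∞ (fun t => w (U (t, y))) t₀ :=
    hc.w_smooth.contDiffAt.comp t₀ hUt
  have hDw : ContDiffAt ℝ ∞ (fun t => fderiv ℝ w (U (t, y))) t₀ :=
    (hc.w_smooth.fderiv_right (m := ∞) (by simp)).contDiffAt.comp t₀ hUt
  have hη := fun {F : Type} [NormedAddCommGroup F] [NormedSpace ℝ F] {k : ℝ → F} hk =>
    hasDerivAt_amplitude_smul hc (F := F) (k := k) hk
  have h0 := deriv_time ((contDiffAt_stateIn hp.isSmoothMotion he hf hp.Θ_smooth (g := g)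
    (q := (t₀, y)) hy hx).differentiableAt (by simp))
  have d2 : HasDerivAt (fun t => c.ζ t * p.Θ t (e.symm y) - p.Θ t (e.symm y))
      (r * p.Θ t₀ (e.symm y)) t₀ := by
    have hΘ := deriv_time ((contDiffAt_inChart hp.Θ_smooth he (q := (t₀, y)) hy).differentiableAt
      (by simp))
    refine ((hc.hasDerivAt_ζ.mul hΘ).sub hΘ).congr_deriv ?_
    rw [c.ζ_t₀]
    ring
  have d4 : HasDerivAt (fun t => η t • w (U (t, y))) (w (U (t₀, y))) t₀ :=
    hη (hwU.differentiableAt (by simp))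
  have d5 : HasDerivAt (fun t => η t • (fderiv ℝ w (U (t, y))).comp
      ((fderiv ℝ U (t, y)).comp (ContinuousLinearMap.inr ℝ ℝ (Vec d))))
      ((fderiv ℝ w (U (t₀, y))).comp
        ((fderiv ℝ U (t₀, y)).comp (ContinuousLinearMap.inr ℝ ℝ (Vec d)))) t₀ :=
    hη ((hDw.clm_comp (hDU.clm_comp contDiffAt_const)).differentiableAt (by simp))
  have d6 : HasDerivAt (fun t => metricIn g f (U (t, y) + η t • w (U (t, y)))
      - metricIn g f (U (t, y))) (fderiv ℝ (metricIn g f) (U (t₀, y)) (w (U (t₀, y)))) t₀ := by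
    have hg : HasFDerivAt (metricIn g f) (fderiv ℝ (metricIn g f) (U (t₀, y))) (U (t₀, y)) :=
      ((contDiffAt_metricIn g hf (f.map_source hx)).differentiableAt (by simp)).hasFDerivAt
    have hu := (hUt.differentiableAt (by simp)).hasDerivAt
    have e1 := hg.comp_hasDerivAt t₀ hu
    have e2 : HasDerivAt (fun t => metricIn g f (U (t, y) + η t • w (U (t, y))))
        (fderiv ℝ (metricIn g f) (U (t₀, y)) (deriv (fun t => U (t, y)) t₀ + w (U (t₀, y)))) t₀ :=
      HasFDerivAt.comp_hasDerivAt_of_eq (l := metricIn g f) t₀ hg (hu.add d4) (by simp [hc.η_t₀])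
    refine (e2.sub e1).congr_deriv ?_
    rw [map_add]
    abel
  have key := h0.add ((hasDerivAt_const t₀ (0 : Vec d)).prodMk (d2.prodMk
    ((hasDerivAt_const t₀ (0 : Vec d →L[ℝ] Vec d →L[ℝ] ℝ)).prodMk (d4.prodMk (d5.prodMk d6)))))
  refine key.congr_of_eventuallyEq ?_
  filter_upwards [hmem, hst.continuousAt.eventually
    (eventually_mem_charts hp.φ_smooth he hy hx)] with t ht hty
  have e1 : motionIn p'.φ e f (t, y) = U (t, y) + η t • w (U (t, y)) := motionIn_transform hc ht
  have e2 : (fderiv ℝ (motionIn p'.φ e f) (t, y)).comp (ContinuousLinearMap.inr ℝ ℝ (Vec d))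
      = (fderiv ℝ U (t, y)).comp (ContinuousLinearMap.inr ℝ ℝ (Vec d))
        + η t • (fderiv ℝ w (U (t, y))).comp
          ((fderiv ℝ U (t, y)).comp (ContinuousLinearMap.inr ℝ ℝ (Vec d))) := by
    rw [(hasFDerivAt_motionIn_transform hc hp he hf (q := (t, y)) hty.1 ht).fderiv]
    ext1 v
    simp [U]
  have e3 : p'.materialMetricIn e (t, y) = p.materialMetricIn e (t, y) := rfl
  refine Prod.ext (by simp [stateIn]) (Prod.ext ?_ (Prod.ext (by simp [stateIn]; rfl)
    (Prod.ext e1 (Prod.ext e2 ?_))))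
  · change c.ζ t * p.Θ t (e.symm y)
      = p.Θ t (e.symm y) + (c.ζ t * p.Θ t (e.symm y) - p.Θ t (e.symm y))
    ring
  · change metricIn g f (motionIn p'.φ e f (t, y)) = metricIn g f (U (t, y))
      + (metricIn g f (U (t, y) + η t • w (U (t, y))) - metricIn g f (U (t, y)))
    rw [e1]
    abel

end GrowthProcess

end FrameRates

/-! ### The energy balance in a frame with given rates -/

section VirtualPower

variable {d : ℕ} {B S : Type*} [TopologicalSpace B] [ChartedSpace (Vec d) B]
  [IsManifold (mdl d) ∞ B] [TopologicalSpace S] [ChartedSpace (Vec d) S] [IsManifold (mdl d) ∞ S]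

omit [IsManifold (mdl d) ∞ B] [IsManifold (mdl d) ∞ S] in
theorem Response.IsSmooth.hasFDerivWithinAt {W : Response d B S} {T : Set ℝ} (hW : W.IsSmooth T)
    {e : OpenPartialHomeomorph B (Vec d)} (he : e ∈ atlas (Vec d) B)
    {f : OpenPartialHomeomorph S (Vec d)} (hf : f ∈ atlas (Vec d) S) {q} (hq : q ∈ stateSet e f T) :
    HasFDerivWithinAt (W.inCharts e f) (fderivWithin ℝ (W.inCharts e f) (stateSet e f T) q)
      (stateSet e f T) q :=
  (((hW e he f hf).differentiableOn (by simp)) q hq).hasFDerivWithinAt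

namespace GrowthProcess

variable {p : GrowthProcess d B S} {g : Metric d S} {e : OpenPartialHomeomorph B (Vec d)}
  {f : OpenPartialHomeomorph S (Vec d)} {t₀ : ℝ} {c : FrameChange d S t₀} {N' R' : ℝ → B → ℝ}
  {η : ℝ → ℝ} {w : Vec d → Vec d} {r : ℝ}

/-- The response derivative of the free energy at the state of the process, in charts. -/
def responseDeriv (p : GrowthProcess d B S) (g : Metric d S) (Ψ : Response d B S)
    (e : OpenPartialHomeomorph B (Vec d)) (f : OpenPartialHomeomorph S (Vec d)) (q : ℝ × Vec d) :
    (Vec d × ℝ × (Vec d →L[ℝ] Vec d →L[ℝ] ℝ) × Vec d × (Vec d →L[ℝ] Vec d) ×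
      (Vec d →L[ℝ] Vec d →L[ℝ] ℝ)) →L[ℝ] ℝ :=
  fderivWithin ℝ (Ψ.inCharts e f) (stateSet e f (Set.Ioi 0)) (p.stateIn g e f p.Θ q)

/-- The deformation gradient in charts. -/
def gradIn (p : GrowthProcess d B S) (e : OpenPartialHomeomorph B (Vec d))
    (f : OpenPartialHomeomorph S (Vec d)) (q : ℝ × Vec d) : Vec d →L[ℝ] Vec d :=
  (fderiv ℝ (motionIn p.φ e f) q).comp (ContinuousLinearMap.inr ℝ ℝ (Vec d))

variable (hp : p.IsRegular) (he : e ∈ atlas (Vec d) B) (hf : f ∈ atlas (Vec d) S)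

include hp he hf

theorem hasFDerivWithinAt_response {Ψ : Response d B S} (hΨ : Ψ.IsSmooth (Set.Ioi 0))
    {q : ℝ × Vec d} (hq : q.2 ∈ e.target) (hx : p.φ q.1 (e.symm q.2) ∈ f.source) :
    HasFDerivWithinAt (Ψ.inCharts e f) (p.responseDeriv g Ψ e f q) (stateSet e f (Set.Ioi 0))
      (p.stateIn g e f p.Θ q) :=
  hΨ.hasFDerivWithinAt he hf (stateIn_mem hp.isSmoothMotion he hf hq hx (hp.Θ_pos _ _))

/-- At time `t₀` the state is the same in all frames. -/
theorem stateIn_transform {y : Vec d} (hc : HasRates c f η w r) (hy : y ∈ e.target)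
    (hx : p.φ t₀ (e.symm y) ∈ f.source) :
    (p.transform g c N' R').stateIn g e f (p.transform g c N' R').Θ (t₀, y)
      = p.stateIn g e f p.Θ (t₀, y) := by
  have e2 : (fderiv ℝ (motionIn (p.transform g c N' R').φ e f) (t₀, y)).comp
      (ContinuousLinearMap.inr ℝ ℝ (Vec d))
      = (fderiv ℝ (motionIn p.φ e f) (t₀, y)).comp (ContinuousLinearMap.inr ℝ ℝ (Vec d)) := by
    rw [(hasFDerivAt_motionIn_transform hc hp he hf (q := (t₀, y)) hy hx).fderiv]
    ext1 v
    simp [hc.η_t₀]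
  have e3 : (p.transform g c N' R').Θ t₀ (e.symm y) = p.Θ t₀ (e.symm y) := by
    change c.ζ t₀ * p.Θ t₀ (e.symm y) = _
    rw [c.ζ_t₀, one_mul]
  simp only [stateIn, e2, e3, motionIn_transform_t₀]
  rfl

/-- The rate of the specific energy in the new frame. -/
theorem hasDerivAt_specificEnergy_transform {E Ψ : Response d B S} (hc : HasRates c f η w r)
    (hΨ : Ψ.IsSmooth (Set.Ioi 0))
    (hN'_smooth : ContMDiff (𝓘(ℝ, ℝ).prod (mdl d)) 𝓘(ℝ, ℝ) ∞ (fun q : ℝ × B => N' q.1 q.2))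
    (hN' : ∀ X, N' t₀ X = p.N t₀ X)
    (hH : (p.transform g c N' R').Helmholtz g E Ψ)
    {y : Vec d} (hy : y ∈ e.target) (hx : p.φ t₀ (e.symm y) ∈ f.source) :
    HasDerivAt (fun t => (p.transform g c N' R').specificEnergy g E t (e.symm y))
      (p.responseDeriv g Ψ e f (t₀, y) (fderiv ℝ (p.stateIn g e f p.Θ) (t₀, y) (1, 0))
        + p.responseDeriv g Ψ e f (t₀, y) (0, r * p.Θ t₀ (e.symm y), 0,
            w (motionIn p.φ e f (t₀, y)),
            (fderiv ℝ w (motionIn p.φ e f (t₀, y))).comp (p.gradIn e f (t₀, y)),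
            fderiv ℝ (metricIn g f) (motionIn p.φ e f (t₀, y)) (w (motionIn p.φ e f (t₀, y))))
        + ((r * p.Θ t₀ (e.symm y) + deriv (fun t => p.Θ t (e.symm y)) t₀) * p.N t₀ (e.symm y)
          + p.Θ t₀ (e.symm y) * deriv (fun t => N' t (e.symm y)) t₀)
        + lowerAcc (metricIn g f) (fun s => motionIn (p.transform g c N' R').φ e f (s, y)) t₀
            ((p.transform g c N' R').velIn e f (t₀, y))) t₀ := by
  set p' := p.transform g c N' R' with hp'_def
  have hp' : p'.IsSmoothMotion := transform_isSmoothMotion hp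
  have hx' : p'.φ t₀ (e.symm y) ∈ f.source := by rw [transform_φ_t₀]; exact hx
  have hst : ContDiffAt ℝ ∞ (fun t : ℝ => (t, y)) t₀ := contDiffAt_id.prodMk contDiffAt_const
  have hmem : ∀ᶠ t in 𝓝 t₀, p'.φ t (e.symm y) ∈ f.source :=
    (hst.continuousAt.eventually (eventually_mem_charts hp'.φ_smooth he hy hx')).mono
      fun t ht => ht.2
  have hΘ' : ∀ t X, 0 < p'.Θ t X := fun t X => mul_pos (c.ζ_pos t) (hp.Θ_pos t X)
  have h1 : HasDerivAt (fun t => Ψ.inCharts e f (p'.stateIn g e f p'.Θ (t, y)))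
      (p.responseDeriv g Ψ e f (t₀, y) (fderiv ℝ (p.stateIn g e f p.Θ) (t₀, y) (1, 0)
        + (0, r * p.Θ t₀ (e.symm y), 0, w (motionIn p.φ e f (t₀, y)),
          (fderiv ℝ w (motionIn p.φ e f (t₀, y))).comp (p.gradIn e f (t₀, y)),
          fderiv ℝ (metricIn g f) (motionIn p.φ e f (t₀, y)) (w (motionIn p.φ e f (t₀, y)))))) t₀ :=
    HasFDerivWithinAt.comp_hasDerivAt_of_eq (l := Ψ.inCharts e f) t₀
      (hasFDerivWithinAt_response hp he hf hΨ (q := (t₀, y)) hy hx)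
      (hasDerivAt_stateIn_transform hc hp he hf hy hx)
      (hmem.mono fun t ht => stateIn_mem hp' he hf hy ht (hΘ' _ _))
      (stateIn_transform hp he hf hc hy hx).symm
  have h2 : HasDerivAt (fun t => p'.Θ t (e.symm y) * p'.N t (e.symm y))
      ((r * p.Θ t₀ (e.symm y) + deriv (fun t => p.Θ t (e.symm y)) t₀) * p.N t₀ (e.symm y)
          + p.Θ t₀ (e.symm y) * deriv (fun t => N' t (e.symm y)) t₀) t₀ := by
    have a1 := deriv_time ((contDiffAt_inChart hp.Θ_smooth he (q := (t₀, y)) hy).differentiableAt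
      (by simp))
    have a2 := deriv_time ((contDiffAt_inChart hN'_smooth he (q := (t₀, y)) hy).differentiableAt
      (by simp))
    rw [← a1.deriv] at a1
    rw [← a2.deriv] at a2
    refine ((hc.hasDerivAt_ζ.mul a1).mul a2).congr_deriv ?_
    simp only [c.ζ_t₀, one_mul, Pi.mul_apply, hN' (e.symm y)]
  have hu := contDiffAt_motionIn hp'.φ_smooth he hf hy hx'
  have hpath : ContDiffAt ℝ ∞ (fun t => motionIn p'.φ e f (t, y)) t₀ :=
    ContDiffAt.comp (g := motionIn p'.φ e f) t₀ hu hst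
  have h3 := hasDerivAt_kinetic
    ((contDiffAt_metricIn g hf (f.map_source hx')).differentiableAt (by simp))
    (fun v w => metricIn_symm g f _ v w) (hpath.of_le (m := 2) (by norm_cast))
  have h4 : ∀ᶠ t in 𝓝 t₀, deriv (fun s => motionIn p'.φ e f (s, y)) t = p'.velIn e f (t, y) :=
    hmem.mono fun t ht => (hasDerivAt_motionIn hp'.φ_smooth he hf hy ht).deriv
  rw [h4.self_of_nhds] at h3
  refine ((h1.add h2).add h3).congr_of_eventuallyEq ?_ |>.congr_deriv ?_
  · filter_upwards [hmem, h4] with t ht ht4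
    simp only [Pi.add_apply]
    rw [ht4]
    exact specificEnergy_eq hp' he hf hH (q := (t, y)) hy ht
  · rw [map_add]

/-- The local energy balance in a frame with velocity `v`, velocity gradient `L` and rate `r` of the
temperature rescaling. The acceleration in the new frame and `∂N'/∂t` have cancelled; the remaining
terms are those of the frame at rest and explicit functions of `v`, `L` and `r`. -/
theorem transform_energy_identity {E Ψ : Response d B S} {entropies : Set ℝ}
    (hN : ∀ t X, p.N t X ∈ entropies) (hE : E.IsSmooth entropies) (hΨ : Ψ.IsSmooth (Set.Ioi 0))
    (hc : HasRates c f η w r)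
    (hN'_smooth : ContMDiff (𝓘(ℝ, ℝ).prod (mdl d)) 𝓘(ℝ, ℝ) ∞ (fun q : ℝ × B => N' q.1 q.2))
    (hN' : ∀ X, N' t₀ X = p.N t₀ X)
    (hR' : ∀ t X, deriv (fun s => N' s X) t * (c.ζ t * p.Θ t X) - R' t X =
      c.ζ t * (deriv (fun s => p.N s X) t * p.Θ t X - p.R t X))
    (hH : (p.transform g c N' R').Helmholtz g E Ψ)
    (hB : (p.transform g c N' R').EnergyBalance g E t₀)
    {y : Vec d} (hy : y ∈ e.target) (hx : p.φ t₀ (e.symm y) ∈ f.source)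
    {v : Vec d} (hv : w (motionIn p.φ e f (t₀, y)) = v)
    {L : Vec d →L[ℝ] Vec d} (hL : fderiv ℝ w (motionIn p.φ e f (t₀, y)) = L) :
    (deriv (fun t => p.ρ t (e.symm y) * p.volIn e (t, y)) t₀
        - p.Sm t₀ (e.symm y) * p.volIn e (t₀, y))
      * (Ψ.inCharts e f (p.stateIn g e f p.Θ (t₀, y)) + p.Θ t₀ (e.symm y) * p.N t₀ (e.symm y)
        + (1 / 2) * metricIn g f (motionIn p.φ e f (t₀, y)) (p.velIn e f (t₀, y) + v)
          (p.velIn e f (t₀, y) + v))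
      + p.ρ t₀ (e.symm y) * p.volIn e (t₀, y) *
        (p.responseDeriv g Ψ e f (t₀, y) (fderiv ℝ (p.stateIn g e f p.Θ) (t₀, y) (1, 0))
        + p.responseDeriv g Ψ e f (t₀, y) (0, r * p.Θ t₀ (e.symm y), 0, v,
            L.comp (p.gradIn e f (t₀, y)),
            fderiv ℝ (metricIn g f) (motionIn p.φ e f (t₀, y)) v)
        + (r * p.Θ t₀ (e.symm y) + deriv (fun t => p.Θ t (e.symm y)) t₀) * p.N t₀ (e.symm y)
        + lowerAcc (metricIn g f) (fun s => motionIn p.φ e f (s, y)) t₀ (p.velIn e f (t₀, y) + v)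
        - metricIn g f (motionIn p.φ e f (t₀, y)) (p.forceIn e f (t₀, y))
            (p.velIn e f (t₀, y) + v)
        + (deriv (fun s => p.N s (e.symm y)) t₀ * p.Θ t₀ (e.symm y) - p.R t₀ (e.symm y))
        - p.metricPower g E t₀ (e.symm y))
    = ∑ i, fderiv ℝ (fun z => p.volIn e (t₀, z) *
          (metricIn g f (motionIn p.φ e f (t₀, z)) (p.stressIn e f (t₀, z) i)
            (p.velIn e f (t₀, z)) - p.heatIn e (t₀, z) i)) y (stdVec i)
      + (metricIn g f (motionIn p.φ e f (t₀, y))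
          (∑ i, fderiv ℝ (fun z => p.volIn e (t₀, z) • p.stressIn e f (t₀, z) i) y (stdVec i)) v
        + p.volIn e (t₀, y) * ∑ i, (fderiv ℝ (metricIn g f) (motionIn p.φ e f (t₀, y))
            (p.gradIn e f (t₀, y) (stdVec i)) (p.stressIn e f (t₀, y) i) v
          + metricIn g f (motionIn p.φ e f (t₀, y)) (p.stressIn e f (t₀, y) i)
            (L (p.gradIn e f (t₀, y) (stdVec i))))) := by
  have hlb := transform_local_balance hp he hf hN hE hΨ hN'_smooth hN' hR' hH hB hy hx
  have hrate := hasDerivAt_specificEnergy_transform hp he hf hc hΨ hN'_smooth hN' hH hy hx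
  have hvel := velIn_transform (g := g) (N' := N') (R' := R') hc hp he hf hy hx
  have hspec : (p.transform g c N' R').specificEnergy g E t₀ (e.symm y)
      = Ψ.inCharts e f (p.stateIn g e f p.Θ (t₀, y)) + p.Θ t₀ (e.symm y) * p.N t₀ (e.symm y)
        + (1 / 2) * metricIn g f (motionIn p.φ e f (t₀, y)) (p.velIn e f (t₀, y) + v)
          (p.velIn e f (t₀, y) + v) := by
    have hx' : (p.transform g c N' R').φ t₀ (e.symm y) ∈ f.source := by
      rw [transform_φ_t₀]; exact hx
    refine (specificEnergy_eq (transform_isSmoothMotion hp) he hf hH (q := (t₀, y)) hy hx').trans ?_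
    rw [stateIn_transform hp he hf hc hy hx, motionIn_transform_t₀, hvel, hv]
    refine congrArg (fun a => _ + a + _) ?_
    change c.ζ t₀ * p.Θ t₀ (e.symm y) * N' t₀ (e.symm y) = _
    rw [c.ζ_t₀, one_mul, hN']
  -- the left-hand side of the balance
  have hρ : HasDerivAt (fun t => p.ρ t (e.symm y))
      (fderiv ℝ (fun q : ℝ × Vec d => p.ρ q.1 (e.symm q.2)) (t₀, y) (1, 0)) t₀ :=
    deriv_time ((contDiffAt_inChart hp.ρ_smooth he (q := (t₀, y)) hy).differentiableAt (by simp))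
  have hvol := deriv_time ((contDiffAt_volIn hp.isSmoothMotion he (q := (t₀, y))
    hy).differentiableAt (by simp))
  have hρv := hρ.mul hvol
  have hlhs := ((hρ.mul hrate).mul hvol).deriv
  have hm : deriv (fun t => p.ρ t (e.symm y) * p.volIn e (t, y)) t₀ = _ := hρv.deriv
  -- the divergence of the energy flux
  have hU := hasFDerivAt_motionIn hp.φ_smooth he hf hy hx
  have hpt : ContDiffAt ℝ ∞ (fun y : Vec d => (t₀, y)) y := contDiffAt_prodMk_right
  have hslice : ∀ {F : Type} [NormedAddCommGroup F] [NormedSpace ℝ F] {U : ℝ × Vec d → F},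
      ContDiffAt ℝ ∞ U (t₀, y) → DifferentiableAt ℝ (fun z => U (t₀, z)) y :=
    fun {F} _ _ {U} hU => (ContDiffAt.comp (g := U) y hU hpt).differentiableAt (by simp)
  have hdiv : ∀ i, fderiv ℝ (fun z => p.volIn e (t₀, z) *
          (metricIn g f (motionIn p.φ e f (t₀, z)) (p.stressIn e f (t₀, z) i)
            ((p.transform g c N' R').velIn e f (t₀, z)) - p.heatIn e (t₀, z) i)) y (stdVec i)
      = fderiv ℝ (fun z => p.volIn e (t₀, z) *
          (metricIn g f (motionIn p.φ e f (t₀, z)) (p.stressIn e f (t₀, z) i)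
            (p.velIn e f (t₀, z)) - p.heatIn e (t₀, z) i)) y (stdVec i)
        + (metricIn g f (motionIn p.φ e f (t₀, y))
            (fderiv ℝ (fun z => p.volIn e (t₀, z) • p.stressIn e f (t₀, z) i) y (stdVec i)) v
          + p.volIn e (t₀, y) * (fderiv ℝ (metricIn g f) (motionIn p.φ e f (t₀, y))
            (p.gradIn e f (t₀, y) (stdVec i)) (p.stressIn e f (t₀, y) i) v
          + metricIn g f (motionIn p.φ e f (t₀, y)) (p.stressIn e f (t₀, y) i)
            (L (p.gradIn e f (t₀, y) (stdVec i))))) := fun i => by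
    have hvol' := hslice (contDiffAt_volIn hp.isSmoothMotion he (q := (t₀, y)) hy)
    have hP := hslice (contDiffAt_stressIn hp he hf (q := (t₀, y)) hy hx i)
    have hQ := hslice (contDiffAt_pi.1 (contDiffAt_heatIn hp he (q := (t₀, y)) hy) i)
    have hV := hslice (contDiffAt_velIn hp.isSmoothMotion he hf (q := (t₀, y)) hy hx)
    have hh := hslice (contDiffAt_metricIn_motionIn hp.isSmoothMotion he hf (g := g)
      (q := (t₀, y)) hy hx)
    have hA : DifferentiableAt ℝ (fun z => p.volIn e (t₀, z) *
          (metricIn g f (motionIn p.φ e f (t₀, z)) (p.stressIn e f (t₀, z) i)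
            (p.velIn e f (t₀, z)) - p.heatIn e (t₀, z) i)) y :=
      hvol'.mul (((hh.clm_apply hP).clm_apply hV).sub hQ)
    have hg : HasFDerivAt (metricIn g f) (fderiv ℝ (metricIn g f) (motionIn p.φ e f (t₀, y)))
        (motionIn p.φ e f (t₀, y)) :=
      ((contDiffAt_metricIn g hf (f.map_source hx)).differentiableAt (by simp)).hasFDerivAt
    have hk : HasFDerivAt (fun z => p.volIn e (t₀, z) • p.stressIn e f (t₀, z) i)
        (fderiv ℝ (fun z => p.volIn e (t₀, z) • p.stressIn e f (t₀, z) i) y) y :=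
      (hvol'.smul hP).hasFDerivAt
    have hw : HasFDerivAt w L (motionIn p.φ e f (t₀, y)) :=
      hL ▸ (hc.w_smooth.differentiable (by simp) _).hasFDerivAt
    have hB' := (((hg.comp y hU).clm_apply hk).clm_apply (hw.comp y hU))
    have hsum := (hA.hasFDerivAt.add hB').congr_of_eventuallyEq (f₁ := fun z => p.volIn e (t₀, z) *
          (metricIn g f (motionIn p.φ e f (t₀, z)) (p.stressIn e f (t₀, z) i)
            ((p.transform g c N' R').velIn e f (t₀, z)) - p.heatIn e (t₀, z) i)) (by
      filter_upwards [hpt.continuousAt.eventually (eventually_mem_charts hp.φ_smooth he hy hx)]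
        with z hz
      rw [velIn_transform (g := g) hc hp he hf hz.1 hz.2]
      simp only [Pi.add_apply, Function.comp_apply, map_add, map_smul, _root_.smul_apply,
        smul_eq_mul]
      ring)
    rw [hsum.fderiv]
    simp only [_root_.add_apply, ContinuousLinearMap.comp_apply, ContinuousLinearMap.flip_apply,
      Function.comp_apply, hv, map_smul, _root_.smul_apply, smul_eq_mul, gradIn]
    ring
  -- the powers of the new acceleration and the terms with `∂N'/∂t` on both sides cancel
  have hmain := hlhs.symm.trans hlb
  rw [Finset.sum_congr rfl fun i _ => hdiv i, Finset.sum_add_distrib, Finset.sum_add_distrib,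
    ← Finset.mul_sum, Pi.mul_apply, hspec, hvel, hv, hL] at hmain
  rw [hm, map_sum, _root_.sum_apply]
  linear_combination hmain

end GrowthProcess

end VirtualPower

/-! ### The principle of virtual power -/

section Localized

variable {d : ℕ} {B S : Type*} [TopologicalSpace B] [ChartedSpace (Vec d) B]
  [IsManifold (mdl d) ∞ B] [TopologicalSpace S] [ChartedSpace (Vec d) S] [IsManifold (mdl d) ∞ S]

theorem lowerAcc_add (h : Vec d → Vec d →L[ℝ] Vec d →L[ℝ] ℝ) (u : ℝ → Vec d) (t : ℝ)
    (b b' : Vec d) : lowerAcc h u t (b + b') = lowerAcc h u t b + lowerAcc h u t b' := by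
  simp only [lowerAcc, map_add, _root_.add_apply]
  ring

namespace GrowthProcess

variable {p : GrowthProcess d B S} {g : Metric d S} {e : OpenPartialHomeomorph B (Vec d)}
  {f : OpenPartialHomeomorph S (Vec d)} {t₀ : ℝ}
  (hp : p.IsRegular) (he : e ∈ atlas (Vec d) B) (hf : f ∈ atlas (Vec d) S)

/-- The principle of virtual power which covariance of the energy balance amounts to: it holds for
every velocity `v` and velocity gradient `L` of a frame, and for every rate `r` of the temperature
rescaling. -/
theorem EnergyBalanceCovariant.virtual_power [T2Space S] {E Ψ : Response d B S}
    {entropies : Set ℝ} (hcov : p.EnergyBalanceCovariant g E Ψ t₀) (hp : p.IsRegular)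
    (he : e ∈ atlas (Vec d) B) (hf : f ∈ atlas (Vec d) S)
    (hN : ∀ t X, p.N t X ∈ entropies) (hE : E.IsSmooth entropies) (hΨ : Ψ.IsSmooth (Set.Ioi 0))
    {y : Vec d} (hy : y ∈ e.target) (hx : p.φ t₀ (e.symm y) ∈ f.source)
    (v : Vec d) (L : Vec d →L[ℝ] Vec d) (r : ℝ) :
    (deriv (fun t => p.ρ t (e.symm y) * p.volIn e (t, y)) t₀
        - p.Sm t₀ (e.symm y) * p.volIn e (t₀, y))
      * (metricIn g f (motionIn p.φ e f (t₀, y)) (p.velIn e f (t₀, y)) v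
        + (1 / 2) * metricIn g f (motionIn p.φ e f (t₀, y)) v v)
      + p.ρ t₀ (e.symm y) * p.volIn e (t₀, y) *
        (p.responseDeriv g Ψ e f (t₀, y) (0, r * p.Θ t₀ (e.symm y), 0, v,
            L.comp (p.gradIn e f (t₀, y)),
            fderiv ℝ (metricIn g f) (motionIn p.φ e f (t₀, y)) v)
        + r * p.Θ t₀ (e.symm y) * p.N t₀ (e.symm y)
        + lowerAcc (metricIn g f) (fun s => motionIn p.φ e f (s, y)) t₀ v
        - metricIn g f (motionIn p.φ e f (t₀, y)) (p.forceIn e f (t₀, y)) v)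
    = metricIn g f (motionIn p.φ e f (t₀, y))
          (∑ i, fderiv ℝ (fun z => p.volIn e (t₀, z) • p.stressIn e f (t₀, z) i) y (stdVec i)) v
        + p.volIn e (t₀, y) * ∑ i, (fderiv ℝ (metricIn g f) (motionIn p.φ e f (t₀, y))
            (p.gradIn e f (t₀, y) (stdVec i)) (p.stressIn e f (t₀, y) i) v
          + metricIn g f (motionIn p.φ e f (t₀, y)) (p.stressIn e f (t₀, y) i)
            (L (p.gradIn e f (t₀, y) (stdVec i)))) := by
  have frame : ∀ (v : Vec d) (L : Vec d →L[ℝ] Vec d) (r : ℝ), ∃ (c : FrameChange d S t₀) (η : ℝ → ℝ)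
      (w : Vec d → Vec d), HasRates c f η w r ∧ w (motionIn p.φ e f (t₀, y)) = v ∧
        fderiv ℝ w (motionIn p.φ e f (t₀, y)) = L := fun v L r => by
    obtain ⟨c, η, w, hη, hη0, hη1, hw, hwv, hwL, hζ, hξ⟩ :=
      exists_frameChange hf (f.map_source hx) v L r t₀
    exact ⟨c, η, w, ⟨hη, hη0, hη1, hw, hζ, fun t x hx => (hξ t x hx).1,
      fun t x hx => (hξ t x hx).2⟩, hwv, hwL⟩
  obtain ⟨c, η, w, hc, hwv, hwL⟩ := frame v L r
  obtain ⟨N', R', hN'_smooth, hN', hR', hH, hB⟩ := hcov c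
  have h1 := transform_energy_identity hp he hf hN hE hΨ hc hN'_smooth hN' hR' hH hB hy hx hwv hwL
  -- the frame at rest, in which all terms are present that do not depend on the frame
  obtain ⟨c, η, w, hc, hwv, hwL⟩ := frame 0 0 0
  obtain ⟨N', R', hN'_smooth, hN', hR', hH, hB⟩ := hcov c
  have h0 := transform_energy_identity hp he hf hN hE hΨ hc hN'_smooth hN' hR' hH hB hy hx hwv hwL
  have hz : p.responseDeriv g Ψ e f (t₀, y) (0, 0, 0, 0, 0, 0) = 0 :=
    map_zero (p.responseDeriv g Ψ e f (t₀, y))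
  simp only [zero_mul, ContinuousLinearMap.zero_comp, map_zero, _root_.zero_apply, hz, add_zero,
    zero_add, Finset.sum_const_zero, mul_zero] at h0
  have hsymm := metricIn_symm g f (motionIn p.φ e f (t₀, y)) v (p.velIn e f (t₀, y))
  simp only [lowerAcc_add, map_add, _root_.add_apply, hsymm] at h1
  linear_combination h1 - h0

end GrowthProcess

end Localized

/-! ### Tensoriality of the free energy -/

section Tensoriality

variable {d : ℕ}

/-- The rate of change of a pull-back along a family of linear maps through the identity. -/
theorem hasDerivAt_pullBack {b : ℝ → Vec d →L[ℝ] Vec d →L[ℝ] ℝ} {b' : Vec d →L[ℝ] Vec d →L[ℝ] ℝ}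
    {A : ℝ → Vec d →L[ℝ] Vec d} {L : Vec d →L[ℝ] Vec d} {t : ℝ} (hb : HasDerivAt b b' t)
    (hA : HasDerivAt A L t) (hAt : A t = ContinuousLinearMap.id ℝ (Vec d)) :
    HasDerivAt (fun s => pullBack (b s) (A s))
      (b' + (b t).comp L + (ContinuousLinearMap.precomp ℝ L).comp (b t)) t := by
  have h1 : HasDerivAt (fun s => (ContinuousLinearMap.compL ℝ (Vec d) (Vec d) ℝ).flip (A s))
      ((ContinuousLinearMap.compL ℝ (Vec d) (Vec d) ℝ).flip L) t :=
    ((ContinuousLinearMap.compL ℝ (Vec d) (Vec d) ℝ).flip.hasFDerivAt).comp_hasDerivAt t hA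
  refine (h1.clm_comp (hb.clm_comp hA)).congr_deriv ?_
  ext v w
  simp [hAt]
  ring

theorem pullBack_symm {b : Vec d →L[ℝ] Vec d →L[ℝ] ℝ} (hb : ∀ v w, b v w = b w v)
    (L : Vec d →L[ℝ] Vec d) (v w : Vec d) : pullBack b L v w = pullBack b L w v :=
  hb (L v) (L w)

theorem pullBack_pos {b : Vec d →L[ℝ] Vec d →L[ℝ] ℝ} (hb : ∀ v, v ≠ 0 → 0 < b v v)
    {L : Vec d →L[ℝ] Vec d} (hL : Function.Injective L) (v : Vec d) (hv : v ≠ 0) :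
    0 < pullBack b L v v :=
  hb (L v) fun h => hv (hL (h.trans (map_zero L).symm))

theorem pullBack_id (b : Vec d →L[ℝ] Vec d →L[ℝ] ℝ) :
    pullBack b (ContinuousLinearMap.id ℝ (Vec d)) = b := by
  ext v w
  rfl

/-- If a function of states does not distinguish between moving the place and stretching the
deformation gradient on the one hand, and pulling back the metric on the other hand, then its
derivative identifies the corresponding rates. -/
theorem hasFDerivWithinAt_frame_eq
    {W : Vec d × ℝ × (Vec d →L[ℝ] Vec d →L[ℝ] ℝ) × Vec d × (Vec d →L[ℝ] Vec d) ×
      (Vec d →L[ℝ] Vec d →L[ℝ] ℝ) → ℝ}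
    {Λ : (Vec d × ℝ × (Vec d →L[ℝ] Vec d →L[ℝ] ℝ) × Vec d × (Vec d →L[ℝ] Vec d) ×
      (Vec d →L[ℝ] Vec d →L[ℝ] ℝ)) →L[ℝ] ℝ} {s : Set _} {y u v : Vec d} {θ t₀ : ℝ}
    {G : Vec d →L[ℝ] Vec d →L[ℝ] ℝ} {F L : Vec d →L[ℝ] Vec d}
    {h : Vec d → Vec d →L[ℝ] Vec d →L[ℝ] ℝ} {η : ℝ → ℝ} (hη0 : η t₀ = 0)
    (hη1 : HasDerivAt η 1 t₀) (hh : DifferentiableAt ℝ h u)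
    (hW : HasFDerivWithinAt W Λ s (y, θ, G, u, F, h u))
    (hmem₁ : ∀ t, (y, θ, G, u + η t • v, (ContinuousLinearMap.id ℝ (Vec d) + η t • L).comp F,
      h (u + η t • v)) ∈ s)
    (hmem₂ : ∀ t, (y, θ, G, u, F,
      pullBack (h (u + η t • v)) (ContinuousLinearMap.id ℝ (Vec d) + η t • L)) ∈ s)
    (heq : ∀ t, W (y, θ, G, u + η t • v,
      (ContinuousLinearMap.id ℝ (Vec d) + η t • L).comp F, h (u + η t • v))
      = W (y, θ, G, u, F,
        pullBack (h (u + η t • v)) (ContinuousLinearMap.id ℝ (Vec d) + η t • L))) :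
    Λ (0, 0, 0, v, L.comp F, fderiv ℝ h u v) = Λ (0, 0, 0, 0, 0,
      fderiv ℝ h u v + (h u).comp L + (ContinuousLinearMap.precomp ℝ L).comp (h u)) := by
  have hu1 : HasDerivAt (fun t => u + η t • v) v t₀ := by
    simpa using (hη1.smul_const v).const_add u
  have hA1 : HasDerivAt (fun t => ContinuousLinearMap.id ℝ (Vec d) + η t • L) L t₀ := by
    simpa using (hη1.smul_const L).const_add (ContinuousLinearMap.id ℝ (Vec d))
  have hg1 : HasDerivAt (fun t => h (u + η t • v)) (fderiv ℝ h u v) t₀ :=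
    HasFDerivAt.comp_hasDerivAt_of_eq (l := h) t₀ hh.hasFDerivAt hu1 (by simp [hη0])
  have h1 : HasDerivAt (fun t => (ContinuousLinearMap.id ℝ (Vec d) + η t • L).comp F)
      (L.comp F) t₀ := by
    simpa using hA1.clm_comp (hasDerivAt_const t₀ F)
  have hγ₁ : HasDerivAt (fun t => (y, θ, G, u + η t • v,
      (ContinuousLinearMap.id ℝ (Vec d) + η t • L).comp F, h (u + η t • v)))
      (0, 0, 0, v, L.comp F, fderiv ℝ h u v) t₀ :=
    (hasDerivAt_const t₀ y).prodMk ((hasDerivAt_const t₀ θ).prodMk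
      ((hasDerivAt_const t₀ G).prodMk (hu1.prodMk (h1.prodMk hg1))))
  have h2 := hasDerivAt_pullBack hg1 hA1 (by simp [hη0])
  simp only [hη0, zero_smul, add_zero] at h2
  have hγ₂ : HasDerivAt (fun t => (y, θ, G, u, F,
      pullBack (h (u + η t • v)) (ContinuousLinearMap.id ℝ (Vec d) + η t • L)))
      (0, 0, 0, 0, 0,
        fderiv ℝ h u v + (h u).comp L + (ContinuousLinearMap.precomp ℝ L).comp (h u)) t₀ :=
    (hasDerivAt_const t₀ y).prodMk ((hasDerivAt_const t₀ θ).prodMk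
      ((hasDerivAt_const t₀ G).prodMk ((hasDerivAt_const t₀ u).prodMk
        ((hasDerivAt_const t₀ F).prodMk h2))))
  have d1 := HasFDerivWithinAt.comp_hasDerivAt_of_eq (l := W) t₀ hW hγ₁
    (.of_forall hmem₁) (by simp [hη0])
  have d2 := HasFDerivWithinAt.comp_hasDerivAt_of_eq (l := W) t₀ hW hγ₂
    (.of_forall hmem₂) (by
      simp only [hη0, zero_smul, add_zero, pullBack_id])
  exact d1.unique (d2.congr_of_eventuallyEq (.of_forall heq))

variable {B S : Type*} [TopologicalSpace B] [ChartedSpace (Vec d) B]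
  [IsManifold (mdl d) ∞ B] [TopologicalSpace S] [ChartedSpace (Vec d) S] [IsManifold (mdl d) ∞ S]

namespace GrowthProcess

variable {p : GrowthProcess d B S} {g : Metric d S} {e : OpenPartialHomeomorph B (Vec d)}
  {f : OpenPartialHomeomorph S (Vec d)} {t₀ : ℝ} {c : FrameChange d S t₀}
  {η : ℝ → ℝ} {w : Vec d → Vec d} {r : ℝ}

/-- The tangent map of the frame change in the chart is `1 + η_t Dw`. -/
theorem HasRates.chartD_mfderiv (hc : HasRates c f η w r) (hf : f ∈ atlas (Vec d) S) (t : ℝ) {x : S}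
    (hx : x ∈ f.source) (k : Vec d) :
    chartD f (c.ξ t x) (mfderiv (mdl d) (mdl d) (c.ξ t) x (chartDi f (f x) k))
      = (ContinuousLinearMap.id ℝ (Vec d) + η t • fderiv ℝ w (f x)) k := by
  have hsym : f.symm (f x) = x := f.left_inv hx
  have hξ : MDifferentiableAt (mdl d) (mdl d) (c.ξ t) (f.symm (f x)) :=
    (c.ξ t).contMDiff.contMDiffAt.mdifferentiableAt (by simp)
  have hfs : MDifferentiableAt (mdl d) (mdl d) f.symm (f x) :=
    (contMDiffAt_chart_symm hf (f.map_source hx)).mdifferentiableAt (by simp)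
  have hmem : c.ξ t (f.symm (f x)) ∈ f.source := by
    rw [hsym]; exact hc.mem_source t x hx
  have h1 := fderiv_chart_comp hf (ψ := fun z => c.ξ t (f.symm z)) (hξ.comp (f x) hfs) hmem k
  have h2 : HasFDerivAt (fun z => f (c.ξ t (f.symm z)))
      (ContinuousLinearMap.id ℝ (Vec d) + η t • fderiv ℝ w (f x)) (f x) := by
    have h3 : HasFDerivAt (fun z => z + η t • w z)
        (ContinuousLinearMap.id ℝ (Vec d) + η t • fderiv ℝ w (f x)) (f x) :=
      (hasFDerivAt_id (f x)).add
        ((hc.w_smooth.differentiable (by simp) (f x)).hasFDerivAt.const_smul (η t))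
    refine h3.congr_of_eventuallyEq ?_
    filter_upwards [f.open_target.mem_nhds (f.map_source hx)] with z hz
    rw [hc.eq_add t _ (f.map_target hz), f.right_inv hz]
  rw [h2.fderiv] at h1
  rw [h1]
  have h4 : ∀ x' : S, x' = x → chartD f (c.ξ t x) (mfderiv (mdl d) (mdl d) (c.ξ t) x
      (chartDi f (f x) k)) = chartD f (c.ξ t x') (mfderiv (mdl d) (mdl d) (c.ξ t) x'
      (chartDi f (f x) k)) := by
    rintro _ rfl
    rfl
  refine (h4 _ hsym).trans (congrArg (chartD f (c.ξ t (f.symm (f x)))) ?_)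
  exact (DFunLike.congr_fun (mfderiv_comp (f x) hξ hfs) k).symm

theorem metricIn_chart (g : Metric d S) (f : OpenPartialHomeomorph S (Vec d)) {x : S}
    (hx : x ∈ f.source) :
    pullBack (E := Vec d) (F := Vec d) (g.inner x) (chartDi f (f x)) = metricIn g f (f x) := by
  refine ContinuousLinearMap.ext fun v => ContinuousLinearMap.ext fun w => ?_
  rw [metricIn_apply, f.left_inv hx]
  rfl

variable (hp : p.IsRegular) (he : e ∈ atlas (Vec d) B) (hf : f ∈ atlas (Vec d) S)

include hp he hf

theorem gradIn_eq {y : Vec d} (hy : y ∈ e.target) (hx : p.φ t₀ (e.symm y) ∈ f.source) :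
    p.gradIn e f (t₀, y) = (chartD f (p.φ t₀ (e.symm y))).comp
      ((p.F t₀ (e.symm y) : Vec d →L[ℝ] Vec d).comp (chartDi e y)) := by
  ext1 v
  refine Eq.trans ?_ (chartD_gradient hp.φ_smooth he hf hy hx v).symm
  simp [gradIn]

theorem gradIn_bijective {y : Vec d} (hy : y ∈ e.target) (hx : p.φ t₀ (e.symm y) ∈ f.source) :
    Function.Bijective (p.gradIn e f (t₀, y)) := by
  rw [gradIn_eq hp he hf hy hx]
  exact (chartD_bijective hf hx).comp ((hp.F_bijective t₀ (e.symm y)).comp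
    (chartDi_bijective he hy))

/-- The infinitesimal form of the tensoriality of the free energy: under a frame with velocity `v`
and velocity gradient `L` it changes as if only the metric changed, by its Lie derivative. -/
theorem responseDeriv_frame [T2Space S] {Ψ : Response d B S} (hΨ : Ψ.IsSmooth (Set.Ioi 0))
    (hΨt : Ψ.IsTensorial (Set.Ioi 0)) {y : Vec d} (hy : y ∈ e.target)
    (hx : p.φ t₀ (e.symm y) ∈ f.source) (v : Vec d) (L : Vec d →L[ℝ] Vec d) :
    p.responseDeriv g Ψ e f (t₀, y) (0, 0, 0, v, L.comp (p.gradIn e f (t₀, y)),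
        fderiv ℝ (metricIn g f) (motionIn p.φ e f (t₀, y)) v)
      = p.responseDeriv g Ψ e f (t₀, y) (0, 0, 0, 0, 0,
          fderiv ℝ (metricIn g f) (motionIn p.φ e f (t₀, y)) v
          + (metricIn g f (motionIn p.φ e f (t₀, y))).comp L
          + (ContinuousLinearMap.precomp ℝ L).comp (metricIn g f (motionIn p.φ e f (t₀, y)))) := by
  set x := p.φ t₀ (e.symm y) with hx_def
  set u := motionIn p.φ e f (t₀, y) with hu
  have hu' : f x = u := rfl
  obtain ⟨c, η, w, hη, hη0, hη1, hw, hwv, hwL, hζ, hξ⟩ :=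
    exists_frameChange hf (f.map_source hx) v L 0 t₀
  have hc : HasRates c f η w 0 :=
    ⟨hη, hη0, hη1, hw, hζ, fun t x hx => (hξ t x hx).1, fun t x hx => (hξ t x hx).2⟩
  rw [hu'] at hwv hwL
  set A : ℝ → Vec d →L[ℝ] Vec d := fun t => ContinuousLinearMap.id ℝ (Vec d) + η t • L with hA_def
  have hA : ∀ t k, chartD f (c.ξ t x) (mfderiv (mdl d) (mdl d) (c.ξ t) x (chartDi f u k))
      = A t k := fun t k => by
    have := hc.chartD_mfderiv hf t hx k
    rwa [hu', hwL] at this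
  have hcu : ∀ t, f (c.ξ t x) = u + η t • v := fun t => by
    rw [hc.eq_add t x hx, hu', hwv]
  have hAbij : ∀ t, Function.Bijective (A t) := fun t => by
    have h1 : (A t : Vec d → Vec d)
        = fun k => chartD f (c.ξ t x) (mfderiv (mdl d) (mdl d) (c.ξ t) x (chartDi f u k)) :=
      funext fun k => (hA t k).symm
    rw [h1]
    exact (chartD_bijective hf (hc.mem_source t x hx)).comp
      (((c.ξ t).mfderivToContinuousLinearEquiv (by simp) x).bijective.comp
        (chartDi_bijective hf (f.map_source hx)))
  set θ := p.Θ t₀ (e.symm y)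
  set Fc := p.gradIn e f (t₀, y) with hFc
  have hFbij := gradIn_bijective hp he hf hy hx
  set q₀ := p.stateIn g e f p.Θ (t₀, y) with hq₀
  -- the two families of states which the tensoriality relates
  set γ₁ : ℝ → _ := fun t => (y, θ, metricIn (p.G t₀) e y, u + η t • v, (A t).comp Fc,
    metricIn g f (u + η t • v)) with hγ₁
  set γ₂ : ℝ → _ := fun t => (y, θ, metricIn (p.G t₀) e y, u, Fc,
    pullBack (metricIn g f (u + η t • v)) (A t)) with hγ₂
  have heq : ∀ t, Ψ.inCharts e f (γ₁ t) = Ψ.inCharts e f (γ₂ t) := fun t => by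
    have h1 := hΨt (c.ξ t) (e.symm y) θ ((p.G t₀).inner (e.symm y)) x (p.F t₀ (e.symm y))
      (g.inner (c.ξ t x)) (hp.Θ_pos _ _)
      ⟨(p.G t₀).symm _, fun v hv => (p.G t₀).pos _ v hv⟩ (hp.F_bijective _ _)
      ⟨g.symm _, fun v hv => g.pos _ v hv⟩
    have h2 := Ψ.eq_inCharts he hf hy θ ((p.G t₀).inner (e.symm y)) (hc.mem_source t x hx)
      ((mfderiv (mdl d) (mdl d) (c.ξ t) x).comp (p.F t₀ (e.symm y))) (g.inner (c.ξ t x))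
    have h3 := Ψ.eq_inCharts he hf hy θ ((p.G t₀).inner (e.symm y)) hx (p.F t₀ (e.symm y))
      (pullBack (g.inner (c.ξ t x)) (mfderiv (mdl d) (mdl d) (c.ξ t) x))
    have h4 := h2.symm.trans (h1.trans h3)
    refine Eq.trans (congrArg _ ?_) (h4.trans (congrArg _ ?_))
    · refine congrArg (fun a => (y, θ, metricIn (p.G t₀) e y, a)) (Prod.ext (hcu t).symm
        (Prod.ext ?_ ?_))
      · refine ContinuousLinearMap.ext fun k => ?_
        have e1 : Fc k = chartD f x (p.F t₀ (e.symm y) (chartDi e y k)) :=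
          DFunLike.congr_fun (gradIn_eq hp he hf hy hx) k
        change A t (Fc k) = _
        rw [e1, ← hA t]
        exact congrArg (fun a => chartD f (c.ξ t x) (mfderiv (mdl d) (mdl d) (c.ξ t) x a))
          (chartDi_chartD hf hx (p.F t₀ (e.symm y) (chartDi e y k)))
      · change metricIn g f (u + η t • v) = _
        rw [← hcu t]
        exact (metricIn_chart g f (hc.mem_source t x hx)).symm
    · refine congrArg (fun a => (y, θ, metricIn (p.G t₀) e y, u, a)) (Prod.ext
        (gradIn_eq hp he hf hy hx).symm ?_)
      refine ContinuousLinearMap.ext fun k => ContinuousLinearMap.ext fun l => ?_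
      change _ = metricIn g f (u + η t • v) (A t k) (A t l)
      rw [← hcu t, ← hA t k, ← hA t l]
      exact inner_eq_metricIn g hf (hc.mem_source t x hx) _ _
  have hmem₁ : ∀ t, γ₁ t ∈ stateSet e f (Set.Ioi 0) := fun t => by
    have ht : u + η t • v ∈ f.target := hcu t ▸ f.map_source (hc.mem_source t x hx)
    exact ⟨hy, hp.Θ_pos _ _, ⟨metricIn_symm _ _ _, metricIn_pos _ he hy⟩, ht,
      (hAbij t).comp hFbij, metricIn_symm _ _ _, metricIn_pos _ hf ht⟩
  have hmem₂ : ∀ t, γ₂ t ∈ stateSet e f (Set.Ioi 0) := fun t => by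
    have ht : u + η t • v ∈ f.target := hcu t ▸ f.map_source (hc.mem_source t x hx)
    exact ⟨hy, hp.Θ_pos _ _, ⟨metricIn_symm _ _ _, metricIn_pos _ he hy⟩, f.map_source hx, hFbij,
      pullBack_symm (metricIn_symm g f _) _,
      pullBack_pos (metricIn_pos g hf ht) (hAbij t).injective⟩
  exact hasFDerivWithinAt_frame_eq hη0 hη1
    ((contDiffAt_metricIn g hf (f.map_source hx)).differentiableAt (by simp))
    (hasFDerivWithinAt_response (g := g) hp he hf hΨ (q := (t₀, y)) hy hx) hmem₁ hmem₂ heq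

end GrowthProcess

end Tensoriality

/-! ### Balance laws in charts -/

section BalanceLawsInCharts

variable {d : ℕ} {B S : Type*} [TopologicalSpace B] [ChartedSpace (Vec d) B]
  [IsManifold (mdl d) ∞ B] [TopologicalSpace S] [ChartedSpace (Vec d) S] [IsManifold (mdl d) ∞ S]
  [T2Space S]

namespace GrowthProcess

variable {p : GrowthProcess d B S} {g : Metric d S} {e : OpenPartialHomeomorph B (Vec d)}
  {f : OpenPartialHomeomorph S (Vec d)} {t₀ : ℝ} {E Ψ : Response d B S} {entropies : Set ℝ}
  (hcov : p.EnergyBalanceCovariant g E Ψ t₀) (hp : p.IsRegular)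
  (he : e ∈ atlas (Vec d) B) (hf : f ∈ atlas (Vec d) S) (hN : ∀ t X, p.N t X ∈ entropies)
  (hE : E.IsSmooth entropies) (hΨ : Ψ.IsSmooth (Set.Ioi 0))
  {y : Vec d} (hy : y ∈ e.target) (hx : p.φ t₀ (e.symm y) ∈ f.source)

omit [IsManifold (mdl d) ∞ S] [T2Space S] in
include he hy in
theorem volIn_pos : 0 < p.volIn e (t₀, y) :=
  Real.sqrt_pos.2 (posDef_components (p.G t₀) he hy).det_pos

include hcov hp he hf hN hE hΨ hy hx

/-- The virtual power of a frame which only rescales the temperature determines the entropy. -/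
theorem EnergyBalanceCovariant.responseDeriv_temperature (a : ℝ) :
    p.responseDeriv g Ψ e f (t₀, y) (0, a, 0, 0, 0, 0) = -(a * p.N t₀ (e.symm y)) := by
  have hΘ := (hp.Θ_pos t₀ (e.symm y)).ne'
  have hρ := (mul_pos (hp.ρ_pos t₀ (e.symm y)) (volIn_pos (p := p) (t₀ := t₀) he hy)).ne'
  have h := hcov.virtual_power hp he hf hN hE hΨ hy hx 0 0 (a / p.Θ t₀ (e.symm y))
  have hacc : lowerAcc (metricIn g f) (fun s => motionIn p.φ e f (s, y)) t₀ 0 = 0 := by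
    simp [lowerAcc]
  simp only [map_zero, ContinuousLinearMap.zero_comp, _root_.zero_apply, hacc,
    Finset.sum_const_zero, mul_zero, add_zero, sub_zero, zero_add, div_mul_cancel₀ _ hΘ,
    mul_eq_zero, hρ, false_or] at h
  linarith

/-- The virtual power of a frame with velocity zero at the point determines the stress: since the
deformation gradient is invertible, its variations `L F` are arbitrary. -/
theorem EnergyBalanceCovariant.responseDeriv_gradient (H : Vec d →L[ℝ] Vec d) :
    p.ρ t₀ (e.symm y) * p.responseDeriv g Ψ e f (t₀, y) (0, 0, 0, 0, H, 0)
      = ∑ i, metricIn g f (motionIn p.φ e f (t₀, y)) (p.stressIn e f (t₀, y) i) (H (stdVec i)) := by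
  have hvol := (volIn_pos (p := p) (t₀ := t₀) he hy).ne'
  let Fe := (LinearEquiv.ofBijective (p.gradIn e f (t₀, y)).toLinearMap
    (gradIn_bijective hp he hf hy hx)).toContinuousLinearEquiv
  have hFe : ∀ k, Fe.symm (p.gradIn e f (t₀, y) k) = k := fun k => Fe.symm_apply_apply k
  have h := hcov.virtual_power hp he hf hN hE hΨ hy hx 0 (H.comp (Fe.symm : Vec d →L[ℝ] Vec d)) 0
  have hacc : lowerAcc (metricIn g f) (fun s => motionIn p.φ e f (s, y)) t₀ 0 = 0 := by
    simp [lowerAcc]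
  have hcomp : (H.comp (Fe.symm : Vec d →L[ℝ] Vec d)).comp (p.gradIn e f (t₀, y)) = H := by
    ext1 k
    exact congrArg H (hFe k)
  simp only [map_zero, hcomp, hacc, ContinuousLinearMap.comp_apply,
    ContinuousLinearEquiv.coe_coe, hFe, mul_zero, zero_mul, add_zero, sub_zero, zero_add] at h
  refine mul_left_cancel₀ hvol ?_
  linarith

/-- Balance of mass: the terms which are quadratic in the velocity of the frame have to cancel. -/
theorem EnergyBalanceCovariant.deriv_massDensity :
    deriv (fun t => p.ρ t (e.symm y) * p.volIn e (t, y)) t₀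
      = p.Sm t₀ (e.symm y) * p.volIn e (t₀, y) := by
  -- adding the identities for `v` and `-v` leaves the quadratic terms
  set v : Vec d := stdVec 0 with hv
  have hv0 : v ≠ 0 := by simp [hv]
  have h1 := hcov.virtual_power hp he hf hN hE hΨ hy hx v 0 0
  have h2 := hcov.virtual_power hp he hf hN hE hΨ hy hx (-v) 0 0
  have hacc : lowerAcc (metricIn g f) (fun s => motionIn p.φ e f (s, y)) t₀ (-v)
      = -lowerAcc (metricIn g f) (fun s => motionIn p.φ e f (s, y)) t₀ v := by
    simp only [lowerAcc, map_neg, neg_apply]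
    ring
  have hneg : ∀ b : Vec d →L[ℝ] Vec d →L[ℝ] ℝ,
      p.responseDeriv g Ψ e f (t₀, y) (0, 0, 0, -v, 0, -b)
        = -p.responseDeriv g Ψ e f (t₀, y) (0, 0, 0, v, 0, b) := fun b => by
    rw [← map_neg]
    simp
  simp only [map_neg, neg_apply, hacc, ContinuousLinearMap.zero_comp, zero_mul, hneg,
    _root_.zero_apply, map_zero, add_zero, Finset.sum_neg_distrib] at h1 h2
  have hpos := metricIn_pos g hf (f.map_source hx) v hv0
  have h3 : (deriv (fun t => p.ρ t (e.symm y) * p.volIn e (t, y)) t₀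
      - p.Sm t₀ (e.symm y) * p.volIn e (t₀, y))
      * metricIn g f (motionIn p.φ e f (t₀, y)) v v = 0 := by linear_combination h1 + h2
  exact sub_eq_zero.1 ((mul_eq_zero.1 h3).resolve_right hpos.ne')

/-- The virtual power of an infinitesimal isometry does not involve the response of the material. -/
theorem EnergyBalanceCovariant.isometry_power (hΨt : Ψ.IsTensorial (Set.Ioi 0)) {v : Vec d}
    {L : Vec d →L[ℝ] Vec d}
    (hL : ∀ k l, fderiv ℝ (metricIn g f) (motionIn p.φ e f (t₀, y)) v k l
      + metricIn g f (motionIn p.φ e f (t₀, y)) (L k) l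
      + metricIn g f (motionIn p.φ e f (t₀, y)) k (L l) = 0) :
    p.ρ t₀ (e.symm y) * p.volIn e (t₀, y) *
        (lowerAcc (metricIn g f) (fun s => motionIn p.φ e f (s, y)) t₀ v
        - metricIn g f (motionIn p.φ e f (t₀, y)) (p.forceIn e f (t₀, y)) v)
    = metricIn g f (motionIn p.φ e f (t₀, y))
          (∑ i, fderiv ℝ (fun z => p.volIn e (t₀, z) • p.stressIn e f (t₀, z) i) y (stdVec i)) v
        + p.volIn e (t₀, y) * ∑ i, (fderiv ℝ (metricIn g f) (motionIn p.φ e f (t₀, y))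
            (p.gradIn e f (t₀, y) (stdVec i)) (p.stressIn e f (t₀, y) i) v
          + metricIn g f (motionIn p.φ e f (t₀, y)) (p.stressIn e f (t₀, y) i)
            (L (p.gradIn e f (t₀, y) (stdVec i)))) := by
  have h := hcov.virtual_power hp he hf hN hE hΨ hy hx v L 0
  have hzero : fderiv ℝ (metricIn g f) (motionIn p.φ e f (t₀, y)) v
      + (metricIn g f (motionIn p.φ e f (t₀, y))).comp L
      + (ContinuousLinearMap.precomp ℝ L).comp (metricIn g f (motionIn p.φ e f (t₀, y))) = 0 :=
    ContinuousLinearMap.ext fun k => ContinuousLinearMap.ext fun l => hL k l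
  have hz : p.responseDeriv g Ψ e f (t₀, y) (0, 0, 0, 0, 0, 0) = 0 :=
    map_zero (p.responseDeriv g Ψ e f (t₀, y))
  rw [zero_mul, responseDeriv_frame hp he hf hΨ hΨt hy hx, hzero, hz,
    hcov.deriv_massDensity hp he hf hN hE hΨ hy hx] at h
  linear_combination h

/-- Rotational invariance: the stress does no work on skew-symmetric velocity gradients. The simple
skew-symmetric maps `k ↦ ⟨b, k⟩ a - ⟨a, k⟩ b` express the symmetry of the Kirchhoff stress. -/
theorem EnergyBalanceCovariant.stress_symm (hΨt : Ψ.IsTensorial (Set.Ioi 0)) (a b : Vec d) :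
    ∑ i, metricIn g f (motionIn p.φ e f (t₀, y)) b (p.gradIn e f (t₀, y) (stdVec i))
        * metricIn g f (motionIn p.φ e f (t₀, y)) a (p.stressIn e f (t₀, y) i)
      = ∑ i, metricIn g f (motionIn p.φ e f (t₀, y)) a (p.gradIn e f (t₀, y) (stdVec i))
        * metricIn g f (motionIn p.φ e f (t₀, y)) b (p.stressIn e f (t₀, y) i) := by
  have hs := metricIn_symm g f (motionIn p.φ e f (t₀, y))
  have hvol := (volIn_pos (p := p) (t₀ := t₀) he hy).ne'
  set h := metricIn g f (motionIn p.φ e f (t₀, y)) with hh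
  have key := hcov.isometry_power hp he hf hN hE hΨ hy hx hΨt (v := 0)
    (L := (h b).smulRight a - (h a).smulRight b) (fun k l => by
      simp only [map_zero, _root_.zero_apply, sub_apply, ContinuousLinearMap.smulRight_apply,
        map_sub, map_smul, _root_.smul_apply, smul_eq_mul, ← hh, hs k a, hs k b]
      ring)
  have hacc : lowerAcc (metricIn g f) (fun s => motionIn p.φ e f (s, y)) t₀ 0 = 0 := by
    simp [lowerAcc]
  simp only [map_zero, hacc, zero_add, sub_zero, mul_zero, ← hh, sub_apply,
    ContinuousLinearMap.smulRight_apply, map_sub, map_smul, smul_eq_mul,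
    Finset.sum_sub_distrib] at key
  have key' := (mul_eq_zero.1 key.symm).resolve_left hvol
  simpa only [hs a, hs b] using! sub_eq_zero.1 key'

/-- Balance of momentum in charts, tested with a vector `v`: the frame with velocity `v` which is
parallel at the point considered. -/
theorem EnergyBalanceCovariant.momentum (hΨt : Ψ.IsTensorial (Set.Ioi 0)) (v : Vec d) :
    p.ρ t₀ (e.symm y) * p.volIn e (t₀, y) *
        (lowerAcc (metricIn g f) (fun s => motionIn p.φ e f (s, y)) t₀ v
        - metricIn g f (motionIn p.φ e f (t₀, y)) (p.forceIn e f (t₀, y)) v)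
      = metricIn g f (motionIn p.φ e f (t₀, y))
          (∑ i, fderiv ℝ (fun z => p.volIn e (t₀, z) • p.stressIn e f (t₀, z) i) y (stdVec i)
            + p.volIn e (t₀, y) • ∑ i, christoffelMap (components g.inner f)
              (motionIn p.φ e f (t₀, y)) (p.gradIn e f (t₀, y) (stdVec i))
              (p.stressIn e f (t₀, y) i)) v := by
  have hu : motionIn p.φ e f (t₀, y) ∈ f.target := f.map_source hx
  set u := motionIn p.φ e f (t₀, y) with hu_def
  have hd : DifferentiableAt ℝ (metricIn g f) u :=
    (contDiffAt_metricIn g hf hu).differentiableAt (by simp)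
  have hΓ : ∀ a b k, metricIn g f u (christoffelMap (components g.inner f) u a b) k
      = (1 / 2) * (fderiv ℝ (metricIn g f) u a b k + fderiv ℝ (metricIn g f) u b a k
        - fderiv ℝ (metricIn g f) u k a b) := fun a b k =>
    metric_christoffelMap hd (.of_forall (metricIn_symm g f)) (metricIn_pos g hf hu) a b k
  have hDs : ∀ k a b, fderiv ℝ (metricIn g f) u k a b = fderiv ℝ (metricIn g f) u k b a :=
    fun k a b => by
      have e1 : ∀ a b, HasFDerivAt (fun z => metricIn g f z a b) _ u := fun a b =>
        (hd.hasFDerivAt.clm_apply (hasFDerivAt_const a u)).clm_apply (hasFDerivAt_const b u)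
      have e2 := (e1 a b).unique ((e1 b a).congr_of_eventuallyEq
        (.of_forall fun z => metricIn_symm g f z a b))
      simpa using DFunLike.congr_fun e2 k
  have hs := metricIn_symm g f u
  -- the velocity gradient for which `v` is parallel; since the metric is parallel, such a
  -- frame is an infinitesimal isometry at the point
  let L : Vec d →L[ℝ] Vec d := LinearMap.toContinuousLinearMap
    { toFun := fun k => -christoffelMap (components g.inner f) u k v
      map_add' := fun a b => by
        ext i
        simp only [christoffelMap, Pi.neg_apply, Pi.add_apply, mul_add, add_mul,
          Finset.sum_add_distrib]
        ring
      map_smul' := fun r a => by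
        ext i
        simp only [christoffelMap, Pi.neg_apply, Pi.smul_apply, smul_eq_mul, RingHom.id_apply,
          mul_neg, Finset.mul_sum]
        exact congrArg _ (Finset.sum_congr rfl fun b _ => Finset.sum_congr rfl fun k _ => by ring) }
  have hLk : ∀ k, L k = -christoffelMap (components g.inner f) u k v := fun k => rfl
  have key := hcov.isometry_power hp he hf hN hE hΨ hy hx hΨt (v := v) (L := L) (fun k l => by
    rw [hs k, hLk, hLk, map_neg, map_neg, neg_apply, neg_apply, hΓ, hΓ, hDs v l k, hDs k l v,
      hDs l v k, hDs v k l]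
    ring)
  have hsum : (∑ i, (fderiv ℝ (metricIn g f) u (p.gradIn e f (t₀, y) (stdVec i))
        (p.stressIn e f (t₀, y) i) v
      + metricIn g f u (p.stressIn e f (t₀, y) i) (L (p.gradIn e f (t₀, y) (stdVec i)))))
      = metricIn g f u (∑ i, christoffelMap (components g.inner f) u
          (p.gradIn e f (t₀, y) (stdVec i)) (p.stressIn e f (t₀, y) i)) v := by
    rw [map_sum, _root_.sum_apply]
    refine Finset.sum_congr rfl fun i _ => ?_
    rw [hLk, map_neg, hs _ (christoffelMap _ _ _ _), hΓ, hΓ, hDs _ v, hDs v]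
    ring
  rw [key, hsum, map_add, map_smul, _root_.add_apply, _root_.smul_apply, smul_eq_mul]

end GrowthProcess

end BalanceLawsInCharts

/-! ### The volume element, mass, stress and entropy -/

section VolumeElement

variable {d : ℕ}

theorem hasDerivAt_volDensity {M : ℝ → Matrix (Fin (d + 1)) (Fin (d + 1)) ℝ}
    {M' : Matrix (Fin (d + 1)) (Fin (d + 1)) ℝ} {t : ℝ}
    (h : ∀ i j, HasDerivAt (fun s => M s i j) (M' i j) t) (hdet : 0 < (M t).det) :
    HasDerivAt (fun s => volDensity (M s))
      ((1 / 2) * volDensity (M t) * ((M t)⁻¹ * M').trace) t := by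
  refine ((hasDerivAt_det h hdet.ne').sqrt hdet.ne').congr_deriv ?_
  have h1 : 0 < Real.sqrt (M t).det := Real.sqrt_pos.2 hdet
  have h2 := Real.mul_self_sqrt hdet.le
  rw [volDensity]
  field_simp
  linear_combination (-((M t)⁻¹ * M').trace) * h2

/-- The contracted Christoffel symbols are the logarithmic derivatives of the volume density. -/
theorem fderiv_volDensity {M : Vec d → Matrix (Fin (d + 1)) (Fin (d + 1)) ℝ} {y : Vec d}
    (hM : ∀ I J, DifferentiableAt ℝ (fun z => M z I J) y) (hs : ∀ z I J, M z I J = M z J I)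
    (hdet : 0 < (M y).det) (hvol : DifferentiableAt ℝ (fun z => volDensity (M z)) y)
    (J : Fin (d + 1)) :
    fderiv ℝ (fun z => volDensity (M z)) y (stdVec J)
      = volDensity (M y) * ∑ I, christoffel M y I I J := by
  have hline : HasDerivAt (fun s : ℝ => y + s • (stdVec J : Vec d)) (stdVec J) 0 := by
    simpa using ((hasDerivAt_id (0 : ℝ)).smul_const (stdVec J : Vec d)).const_add y
  have h0 : y = y + (0 : ℝ) • (stdVec J : Vec d) := by simp
  have h1 := HasFDerivAt.comp_hasDerivAt_of_eq (l := fun z => volDensity (M z)) 0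
    hvol.hasFDerivAt hline h0
  have h2 : ∀ I K, HasDerivAt (fun s : ℝ => M (y + s • (stdVec J : Vec d)) I K)
      (fderiv ℝ (fun z => M z I K) y (stdVec J)) 0 := fun I K =>
    HasFDerivAt.comp_hasDerivAt_of_eq (l := fun z => M z I K) 0 (hM I K).hasFDerivAt hline h0
  have h3 := hasDerivAt_volDensity (M := fun s : ℝ => M (y + s • (stdVec J : Vec d)))
    (M' := Matrix.of fun I K => fderiv ℝ (fun z => M z I K) y (stdVec J)) h2
    (by simpa using hdet)
  have h4 := h1.unique h3
  simp only [zero_smul, add_zero] at h4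
  have hfs : ∀ I K, fderiv ℝ (fun z => M z I K) y = fderiv ℝ (fun z => M z K I) y := fun I K =>
    congrArg (fun F => fderiv ℝ F y) (funext fun z => hs z I K)
  have hinv : ∀ I K, (M y)⁻¹ I K = (M y)⁻¹ K I := fun I K => by
    have : (M y).transpose = M y := Matrix.ext fun I K => hs y K I
    have h5 := Matrix.transpose_nonsing_inv (M y)
    rw [this] at h5
    exact congrFun (congrFun h5 K) I
  -- the terms which are skew in the contracted indices cancel
  have h6 : ∑ I, ∑ K, (M y)⁻¹ I K * fderiv ℝ (fun z => M z K J) y (stdVec I)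
      = ∑ I, ∑ K, (M y)⁻¹ I K * fderiv ℝ (fun z => M z I J) y (stdVec K) := by
    rw [Finset.sum_comm]
    exact Finset.sum_congr rfl fun I _ => Finset.sum_congr rfl fun K _ => by rw [hinv]
  have h7 : ∑ I, christoffel M y I I J = (1 / 2) * ((M y)⁻¹ * Matrix.of fun I K =>
      fderiv ℝ (fun z => M z I K) y (stdVec J)).trace := by
    simp only [christoffel, ← Finset.mul_sum, mul_add, mul_sub, Finset.sum_add_distrib,
      Finset.sum_sub_distrib, h6, Matrix.trace, Matrix.diag_apply, Matrix.mul_apply,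
      Matrix.of_apply]
    ring
  rw [h7, h4]
  ring

end VolumeElement

section BalanceLaws

variable {d : ℕ} {B S : Type*} [TopologicalSpace B] [ChartedSpace (Vec d) B]
  [IsManifold (mdl d) ∞ B] [TopologicalSpace S] [ChartedSpace (Vec d) S] [IsManifold (mdl d) ∞ S]
  [T2Space S]

/-- The metric identifies vectors and covectors. -/
theorem exists_eq_inner {b : Vec d →L[ℝ] Vec d →L[ℝ] ℝ} (hb : ∀ v, v ≠ 0 → 0 < b v v)
    (α : Vec d →L[ℝ] ℝ) : ∃ a, ∀ k, b a k = α k := by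
  let T : Vec d →ₗ[ℝ] Module.Dual ℝ (Vec d) :=
    (ContinuousLinearMap.coeLM ℝ).comp b.toLinearMap
  have hT : ∀ a k, T a k = b a k := fun _ _ => rfl
  have hinj : Function.Injective T := (injective_iff_map_eq_zero T).2 fun a ha => by
    by_contra hne
    refine (hb a hne).ne' ?_
    rw [← hT, ha]
    rfl
  have hsurj := (LinearMap.injective_iff_surjective_of_finrank_eq_finrank
    (f := T) (Subspace.dual_finrank_eq (K := ℝ) (V := Vec d)).symm).1 hinj
  obtain ⟨a, ha⟩ := hsurj α.toLinearMap
  exact ⟨a, fun k => DFunLike.congr_fun ha k⟩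

theorem eventually_bijective {F : Vec d →L[ℝ] Vec d} (hF : Function.Bijective F) :
    ∀ᶠ F' in 𝓝 F, Function.Bijective (F' : Vec d →L[ℝ] Vec d) := by
  let Fe := (LinearEquiv.ofBijective F.toLinearMap hF).toContinuousLinearEquiv
  have h : Set.range ((↑) : (Vec d ≃L[ℝ] Vec d) → Vec d →L[ℝ] Vec d) ∈ 𝓝 F :=
    ContinuousLinearEquiv.nhds Fe
  filter_upwards [h] with F' hF'
  obtain ⟨F'', rfl⟩ := hF'
  exact F''.bijective

namespace GrowthProcess

variable {p : GrowthProcess d B S} {g : Metric d S} {e : OpenPartialHomeomorph B (Vec d)}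
  {f : OpenPartialHomeomorph S (Vec d)} {t₀ : ℝ} {E Ψ : Response d B S} {entropies : Set ℝ}
  (hcov : p.EnergyBalanceCovariant g E Ψ t₀) (hp : p.IsRegular)
  (he : e ∈ atlas (Vec d) B) (hf : f ∈ atlas (Vec d) S) (hN : ∀ t X, p.N t X ∈ entropies)
  (hE : E.IsSmooth entropies) (hΨ : Ψ.IsSmooth (Set.Ioi 0))
  {y : Vec d} (hy : y ∈ e.target) (hx : p.φ t₀ (e.symm y) ∈ f.source)
  (hDe : chartD e (e.symm y) = ContinuousLinearMap.id ℝ (Vec d))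
  (hDei : chartDi e y = ContinuousLinearMap.id ℝ (Vec d))
  (hDf : chartD f (p.φ t₀ (e.symm y)) = ContinuousLinearMap.id ℝ (Vec d))

include hcov hp he hf hN hE hΨ hy hx

include hDei in
theorem EnergyBalanceCovariant.mass_balance :
    deriv (fun t => p.ρ t (e.symm y)) t₀ + (1 / 2) * p.ρ t₀ (e.symm y) *
      traceForm ((p.G t₀).inner (e.symm y)) (p.Gdot t₀ (e.symm y)) = p.Sm t₀ (e.symm y) := by
  have hm := hcov.deriv_massDensity hp he hf hN hE hΨ hy hx
  have hvol := volIn_pos (p := p) (t₀ := t₀) he hy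
  have hρ : HasDerivAt (fun t => p.ρ t (e.symm y)) (deriv (fun t => p.ρ t (e.symm y)) t₀) t₀ :=
    (deriv_time ((contDiffAt_inChart hp.ρ_smooth he (q := (t₀, y)) hy).differentiableAt
      (by simp))).differentiableAt.hasDerivAt
  set M' : Matrix (Fin (d + 1)) (Fin (d + 1)) ℝ := Matrix.of fun I J =>
    fderiv ℝ (p.materialMetricIn e) (t₀, y) (1, 0) (stdVec I) (stdVec J) with hM'
  have h1 : HasDerivAt (fun t => p.volIn e (t, y)) ((1 / 2) * p.volIn e (t₀, y)
      * ((components (p.G t₀).inner e y)⁻¹ * M').trace) t₀ := by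
    refine hasDerivAt_volDensity (fun I J => ?_) (posDef_components (p.G t₀) he hy).det_pos
    have h2 : HasDerivAt (fun s => p.materialMetricIn e (s, y)) _ t₀ :=
      deriv_time ((contDiffAt_materialMetricIn hp.isSmoothMotion he (q := (t₀, y))
        hy).differentiableAt (by simp))
    have h3 := (h2.clm_apply (hasDerivAt_const t₀ (stdVec I : Vec d))).clm_apply
      (hasDerivAt_const t₀ (stdVec J : Vec d))
    refine h3.congr_deriv ?_
    simp [M']
  have h4 : traceForm ((p.G t₀).inner (e.symm y)) (p.Gdot t₀ (e.symm y))
      = ((components (p.G t₀).inner e y)⁻¹ * M').trace := by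
    have e1 : ∀ I J, M' I J = p.Gdot t₀ (e.symm y) (stdVec I : Vec d) (stdVec J : Vec d) :=
      fun I J => by
        refine (DFunLike.congr_fun (DFunLike.congr_fun (pullBack_Gdot hp.isSmoothMotion he
          (t := t₀) hy) (stdVec I)) (stdVec J)).symm.trans ?_
        exact congrArg₂ (fun a b => p.Gdot t₀ (e.symm y) a b)
          (DFunLike.congr_fun hDei (stdVec I)) (DFunLike.congr_fun hDei (stdVec J))
    have e2 : components (p.G t₀).inner e y = Matrix.of fun I J : Fin (d + 1) =>
        (p.G t₀).inner (e.symm y) (stdVec I : Vec d) (stdVec J : Vec d) := by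
      ext I J
      refine congrArg₂ (fun a b => (p.G t₀).inner (e.symm y) a b) ?_ ?_
      · exact DFunLike.congr_fun hDei (stdVec I)
      · exact DFunLike.congr_fun hDei (stdVec J)
    rw [traceForm, e2, Matrix.trace]
    refine Finset.sum_congr rfl fun I _ => ?_
    rw [Matrix.diag_apply, Matrix.mul_apply]
    refine Finset.sum_congr rfl fun J _ => ?_
    rw [← e1]
    exact congrArg _ (fderiv_materialMetricIn_symm hp.isSmoothMotion he hy _ _)
  have h5 : deriv (fun t => p.ρ t (e.symm y) * p.volIn e (t, y)) t₀ = _ := (hρ.mul h1).deriv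
  rw [hm, ← h4] at h5
  refine mul_right_cancel₀ hvol.ne' ?_
  linear_combination -h5

include hDei hDf in
omit hcov hN hE hΨ [T2Space S] in
theorem gradIn_apply (k : Vec d) : p.gradIn e f (t₀, y) k = p.F t₀ (e.symm y) k := by
  rw [gradIn_eq hp he hf hy hx]
  refine (DFunLike.congr_fun hDf _).trans ?_
  exact congrArg (p.F t₀ (e.symm y)) (DFunLike.congr_fun hDei k)

include hDe hDf in
omit hcov hp he hf hN hE hΨ hy hx [T2Space S] [IsManifold (mdl d) ∞ S] in
theorem stressIn_eq (i : Fin (d + 1)) : p.stressIn e f (t₀, y) i = p.P t₀ (e.symm y)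
    (ContinuousLinearMap.proj (R := ℝ) (φ := fun _ : Fin (d + 1) => ℝ) i) := by
  refine (DFunLike.congr_fun hDf (p.P t₀ (e.symm y) (coordCovec e y i))).trans ?_
  refine congrArg (p.P t₀ (e.symm y)) ?_
  exact ContinuousLinearMap.ext fun k => congrFun (DFunLike.congr_fun hDe k) i

include hDf in
omit hcov hp he hN hE hΨ hy [T2Space S] in
theorem inner_eq_metricIn_motionIn (k l : Vec d) :
    g.inner (p.φ t₀ (e.symm y)) k l = metricIn g f (motionIn p.φ e f (t₀, y)) k l :=
  (inner_eq_metricIn g hf hx k l).trans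
    (congrArg₂ (fun a b => metricIn g f (motionIn p.φ e f (t₀, y)) a b)
      (DFunLike.congr_fun hDf k) (DFunLike.congr_fun hDf l))

include hDe hDei hDf in
theorem EnergyBalanceCovariant.kirchhoff_symm (hΨt : Ψ.IsTensorial (Set.Ioi 0))
    (α β : Cotan d (p.φ t₀ (e.symm y))) :
    α (p.kirchhoff t₀ (e.symm y) β) = β (p.kirchhoff t₀ (e.symm y) α) := by
  have hpos := metricIn_pos g hf (f.map_source hx)
  obtain ⟨a, ha⟩ := exists_eq_inner hpos α
  obtain ⟨b, hb⟩ := exists_eq_inner hpos β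
  have key := hcov.stress_symm hp he hf hN hE hΨ hy hx hΨt a b
  have hk : ∀ γ δ : Vec d →L[ℝ] ℝ, γ (p.kirchhoff t₀ (e.symm y) δ)
      = ∑ i, δ (p.gradIn e f (t₀, y) (stdVec i)) * γ (p.stressIn e f (t₀, y) i) := fun γ δ => by
    have h1 : (δ.comp (p.F t₀ (e.symm y)) : Vec d →L[ℝ] ℝ)
        = ∑ i, δ (p.gradIn e f (t₀, y) (stdVec i)) •
          (ContinuousLinearMap.proj (R := ℝ) (φ := fun _ : Fin (d + 1) => ℝ) i) := by
      refine ContinuousLinearMap.ext fun k => ?_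
      rw [_root_.sum_apply]
      have h2 : δ (p.F t₀ (e.symm y) k) = δ (p.gradIn e f (t₀, y) k) :=
        congrArg δ (gradIn_apply hp he hf hy hx hDei hDf k).symm
      refine h2.trans ?_
      conv_lhs => rw [vec_eq_sum k]
      simp only [map_sum, map_smul, smul_eq_mul, _root_.smul_apply, ContinuousLinearMap.proj_apply]
      exact Finset.sum_congr rfl fun i _ => mul_comm _ _
    let T : (Vec d →L[ℝ] ℝ) →L[ℝ] Vec d := p.P t₀ (e.symm y)
    have h3 : γ (p.kirchhoff t₀ (e.symm y) δ) = γ (T (δ.comp (p.F t₀ (e.symm y)))) := rfl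
    rw [h3, h1, map_sum, map_sum]
    refine Finset.sum_congr rfl fun i _ => ?_
    rw [map_smul, map_smul, smul_eq_mul]
    exact congrArg (fun k => _ * γ k) (stressIn_eq hDe hDf i).symm
  have ha' : metricIn g f (motionIn p.φ e f (t₀, y)) a = α := ContinuousLinearMap.ext ha
  have hb' : metricIn g f (motionIn p.φ e f (t₀, y)) b = β := ContinuousLinearMap.ext hb
  rw [ha', hb'] at key
  exact (hk α β).trans (key.trans (hk β α).symm)

include hDe hDei hDf in
theorem EnergyBalanceCovariant.hasDerivAt_stress
    (H : Tan d (e.symm y) →L[ℝ] Tan d (p.φ t₀ (e.symm y))) :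
    HasDerivAt (fun s : ℝ => p.ρ t₀ (e.symm y) *
        Ψ (e.symm y) (p.Θ t₀ (e.symm y)) ((p.G t₀).inner (e.symm y)) (p.φ t₀ (e.symm y))
          (p.F t₀ (e.symm y) + s • H) (g.inner (p.φ t₀ (e.symm y))))
      (p.stressPairing g t₀ (e.symm y) H) 0 := by
  let H' : Vec d →L[ℝ] Vec d := H
  have h1 : ∀ s : ℝ, Ψ (e.symm y) (p.Θ t₀ (e.symm y)) ((p.G t₀).inner (e.symm y))
      (p.φ t₀ (e.symm y)) (p.F t₀ (e.symm y) + s • H) (g.inner (p.φ t₀ (e.symm y)))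
      = Ψ.inCharts e f (y, p.Θ t₀ (e.symm y), metricIn (p.G t₀) e y, motionIn p.φ e f (t₀, y),
        p.gradIn e f (t₀, y) + s • H', metricIn g f (motionIn p.φ e f (t₀, y))) := fun s => by
    refine (Ψ.eq_inCharts he hf hy _ _ hx (p.F t₀ (e.symm y) + s • H) _).trans ?_
    refine congrArg (fun a => Ψ.inCharts e f (y, p.Θ t₀ (e.symm y), metricIn (p.G t₀) e y,
      motionIn p.φ e f (t₀, y), a)) (Prod.ext ?_ (metricIn_chart g f hx))
    refine ContinuousLinearMap.ext fun k => ?_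
    refine (DFunLike.congr_fun hDf _).trans ?_
    refine (congrArg (p.F t₀ (e.symm y) + s • H) (DFunLike.congr_fun hDei k)).trans ?_
    exact congrArg (fun a : Vec d => a + s • H' k) (gradIn_apply hp he hf hy hx hDei hDf k).symm
  have hlin : HasDerivAt (fun s : ℝ => p.gradIn e f (t₀, y) + s • H') H' 0 := by
    simpa using ((hasDerivAt_id (0 : ℝ)).smul_const H').const_add (p.gradIn e f (t₀, y))
  have hcurve : HasDerivAt (fun s : ℝ => (y, p.Θ t₀ (e.symm y), metricIn (p.G t₀) e y,
      motionIn p.φ e f (t₀, y), p.gradIn e f (t₀, y) + s • H',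
      metricIn g f (motionIn p.φ e f (t₀, y)))) (0, 0, 0, 0, H', 0) 0 :=
    (hasDerivAt_const _ y).prodMk ((hasDerivAt_const _ _).prodMk ((hasDerivAt_const _ _).prodMk
      ((hasDerivAt_const _ _).prodMk (hlin.prodMk (hasDerivAt_const _ _)))))
  have hmem : p.stateIn g e f p.Θ (t₀, y) ∈ stateSet e f (Set.Ioi 0) :=
    stateIn_mem hp.isSmoothMotion he hf hy hx (hp.Θ_pos _ _)
  have hbij : ∀ᶠ s : ℝ in 𝓝 0, Function.Bijective (p.gradIn e f (t₀, y) + s • H') := by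
    refine hlin.continuousAt.tendsto.eventually
      (p := fun F' : Vec d →L[ℝ] Vec d => Function.Bijective F') ?_
    rw [zero_smul, add_zero]
    exact eventually_bijective (gradIn_bijective hp he hf hy hx)
  have h2 := HasFDerivWithinAt.comp_hasDerivAt_of_eq (l := Ψ.inCharts e f) _
    (hasFDerivWithinAt_response (g := g) hp he hf hΨ (q := (t₀, y)) hy hx) hcurve
    (hbij.mono fun s hs => ⟨hy, hmem.2.1, hmem.2.2.1, hmem.2.2.2.1, hs, hmem.2.2.2.2.2⟩)
    (by rw [zero_smul, add_zero]; rfl)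
  have h3 : p.stressPairing g t₀ (e.symm y) H = ∑ i, metricIn g f (motionIn p.φ e f (t₀, y))
      (p.stressIn e f (t₀, y) i) (H' (stdVec i)) := by
    refine Finset.sum_congr rfl fun i _ => ?_
    refine (inner_eq_metricIn_motionIn hf hx hDf _ _).trans ?_
    exact congrArg (fun a => metricIn g f (motionIn p.φ e f (t₀, y)) a (H' (stdVec i)))
      (stressIn_eq hDe hDf i).symm
  rw [h3, ← hcov.responseDeriv_gradient hp he hf hN hE hΨ hy hx H']
  exact (h2.const_mul (p.ρ t₀ (e.symm y))).congr_of_eventuallyEq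
    (.of_forall fun s => congrArg (p.ρ t₀ (e.symm y) * ·) (h1 s))

theorem EnergyBalanceCovariant.hasDerivAt_temperature :
    HasDerivAt (fun θ : ℝ => Ψ (e.symm y) θ ((p.G t₀).inner (e.symm y)) (p.φ t₀ (e.symm y))
      (p.F t₀ (e.symm y)) (g.inner (p.φ t₀ (e.symm y)))) (-p.N t₀ (e.symm y))
      (p.Θ t₀ (e.symm y)) := by
  have h1 : ∀ θ : ℝ, Ψ (e.symm y) θ ((p.G t₀).inner (e.symm y)) (p.φ t₀ (e.symm y))
      (p.F t₀ (e.symm y)) (g.inner (p.φ t₀ (e.symm y)))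
      = Ψ.inCharts e f (y, θ, metricIn (p.G t₀) e y, motionIn p.φ e f (t₀, y),
        p.gradIn e f (t₀, y), metricIn g f (motionIn p.φ e f (t₀, y))) := fun θ => by
    refine (Ψ.eq_inCharts he hf hy θ _ hx (p.F t₀ (e.symm y)) _).trans ?_
    rw [gradIn_eq hp he hf hy hx]
    refine congrArg (fun a => Ψ.inCharts e f (y, θ, metricIn (p.G t₀) e y,
      motionIn p.φ e f (t₀, y), _, a)) (metricIn_chart g f hx)
  have hθ : HasDerivAt (fun θ : ℝ => (y, θ, metricIn (p.G t₀) e y, motionIn p.φ e f (t₀, y),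
      p.gradIn e f (t₀, y), metricIn g f (motionIn p.φ e f (t₀, y))))
      (0, 1, 0, 0, 0, 0) (p.Θ t₀ (e.symm y)) :=
    (hasDerivAt_const _ y).prodMk ((hasDerivAt_id _).prodMk (hasDerivAt_const _ _))
  have hmem : p.stateIn g e f p.Θ (t₀, y) ∈ stateSet e f (Set.Ioi 0) :=
    stateIn_mem hp.isSmoothMotion he hf hy hx (hp.Θ_pos _ _)
  have h2 := HasFDerivWithinAt.comp_hasDerivAt_of_eq (l := Ψ.inCharts e f) _
    (hasFDerivWithinAt_response (g := g) hp he hf hΨ (q := (t₀, y)) hy hx) hθ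
    ((isOpen_Ioi.eventually_mem (hp.Θ_pos t₀ (e.symm y))).mono fun θ hθ =>
      ⟨hy, hθ, hmem.2.2⟩) rfl
  rw [hcov.responseDeriv_temperature hp he hf hN hE hΨ hy hx, one_mul] at h2
  exact h2.congr_of_eventuallyEq (.of_forall h1)

end GrowthProcess

end BalanceLaws

/-! ### Balance of momentum -/

section Momentum

variable {d : ℕ} {B S : Type*} [TopologicalSpace B] [ChartedSpace (Vec d) B]
  [IsManifold (mdl d) ∞ B] [TopologicalSpace S] [ChartedSpace (Vec d) S] [IsManifold (mdl d) ∞ S]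

namespace GrowthProcess

variable {p : GrowthProcess d B S} {g : Metric d S} {e : OpenPartialHomeomorph B (Vec d)}
  {f : OpenPartialHomeomorph S (Vec d)} {t₀ : ℝ} {E Ψ : Response d B S} {entropies : Set ℝ}
  {y : Vec d}

/-- The divergence of the densitized stress in the preferred charts: the derivative of the volume
density supplies the contracted Christoffel symbols of the material metric. -/
theorem volIn_smul_DivP (hp : p.IsRegular) (hy : y ∈ e.target)
    (he' : chartAt (Vec d) (e.symm y) = e) (hf' : chartAt (Vec d) (p.φ t₀ (e.symm y)) = f) :
    (∑ i, fderiv ℝ (fun z => p.volIn e (t₀, z) • p.stressIn e f (t₀, z) i) y (stdVec i)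
        + p.volIn e (t₀, y) • ∑ i, christoffelMap (components g.inner f)
          (motionIn p.φ e f (t₀, y)) (p.gradIn e f (t₀, y) (stdVec i))
          (p.stressIn e f (t₀, y) i))
      = p.volIn e (t₀, y) • (p.DivP g t₀ (e.symm y) : Vec d) := by
  have he : e ∈ atlas (Vec d) B := he' ▸ chart_mem_atlas _ _
  have hf : f ∈ atlas (Vec d) S := hf' ▸ chart_mem_atlas _ _
  have hx : p.φ t₀ (e.symm y) ∈ f.source := hf' ▸ mem_chart_source _ _
  have hpt : ContDiffAt ℝ ∞ (fun y : Vec d => (t₀, y)) y := contDiffAt_prodMk_right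
  have hslice : ∀ {F : Type} [NormedAddCommGroup F] [NormedSpace ℝ F] {U : ℝ × Vec d → F},
      ContDiffAt ℝ ∞ U (t₀, y) → DifferentiableAt ℝ (fun z => U (t₀, z)) y :=
    fun {F} _ _ {U} hU => (ContDiffAt.comp (g := U) y hU hpt).differentiableAt (by simp)
  have hvol := hslice (contDiffAt_volIn hp.isSmoothMotion he (q := (t₀, y)) hy)
  have hP := fun i => hslice (contDiffAt_stressIn hp he hf (q := (t₀, y)) hy hx i)
  have hdvol : ∀ J, fderiv ℝ (fun z => p.volIn e (t₀, z)) y (stdVec J)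
      = p.volIn e (t₀, y) * ∑ I, christoffel (components (p.G t₀).inner e) y I I J := fun J =>
    fderiv_volDensity (M := components (p.G t₀).inner e)
      (fun I J => hslice (contDiffAt_components hp.isSmoothMotion he (q := (t₀, y)) hy I J))
      (fun z I J => metricIn_symm (p.G t₀) e z _ _) (posDef_components (p.G t₀) he hy).det_pos hvol
      J
  have hterm : ∀ i, fderiv ℝ (fun z => p.volIn e (t₀, z) • p.stressIn e f (t₀, z) i) y (stdVec i)
      = p.volIn e (t₀, y) • (fderiv ℝ (fun z => p.stressIn e f (t₀, z) i) y (stdVec i)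
        + (∑ I, christoffel (components (p.G t₀).inner e) y I I i) •
          p.stressIn e f (t₀, y) i) := fun i => by
    have h1 : HasFDerivAt (fun z => p.volIn e (t₀, z) • p.stressIn e f (t₀, z) i) _ y :=
      hvol.hasFDerivAt.smul (hP i).hasFDerivAt
    rw [h1.fderiv]
    simp only [_root_.add_apply, _root_.smul_apply, ContinuousLinearMap.smulRight_apply, hdvol,
      smul_add, smul_smul]
  have hgrad : ∀ i, p.gradIn e f (t₀, y) (stdVec i)
      = fderiv ℝ (fun z => f (p.φ t₀ (e.symm z))) y (stdVec i) := fun i =>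
    (DFunLike.congr_fun (hasFDerivAt_motionIn hp.φ_smooth he hf hy hx).fderiv (stdVec i)).symm
  have hcomp : ∀ i a, fderiv ℝ (fun z => p.stressIn e f (t₀, z) i) y (stdVec i) a
      = fderiv ℝ (fun z => p.Pcomp e f t₀ z a i) y (stdVec i) := fun i a => by
    have h1 := (hasFDerivAt_pi'.1 (hP i).hasFDerivAt a).fderiv
    exact (DFunLike.congr_fun h1 (stdVec i)).symm
  have hdiv : (p.DivP g t₀ (e.symm y) : Vec d) = fun a =>
      ∑ I, fderiv ℝ (fun z => p.Pcomp e f t₀ z a I) y (stdVec I)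
      + ∑ I, ∑ J, christoffel (components (p.G t₀).inner e) y I I J * p.Pcomp e f t₀ y a J
      + ∑ I, ∑ b, ∑ c, christoffel (components g.inner f) (f (p.φ t₀ (e.symm y))) a b c
        * fderiv ℝ (fun z => f (p.φ t₀ (e.symm z))) y (stdVec I) b * p.Pcomp e f t₀ y c I := by
    rw [DivP]
    dsimp only
    rw [he', hf', e.right_inv hy]
  rw [Finset.sum_congr rfl fun i _ => hterm i, ← Finset.smul_sum, ← smul_add, hdiv]
  congr 1
  funext a
  simp only [Pi.add_apply, Finset.sum_apply, Pi.smul_apply, smul_eq_mul, hcomp, hgrad,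
    christoffelMap, Finset.sum_add_distrib, Finset.sum_mul]
  rw [Finset.sum_comm (f := fun i I => christoffel (components (p.G t₀).inner e) y I I i
    * p.stressIn e f (t₀, y) i a)]
  rfl

theorem EnergyBalanceCovariant.momentum_balance [T2Space S]
    (hcov : p.EnergyBalanceCovariant g E Ψ t₀) (hp : p.IsRegular)
    (hN : ∀ t X, p.N t X ∈ entropies) (hE : E.IsSmooth entropies) (hΨ : Ψ.IsSmooth (Set.Ioi 0))
    (hΨt : Ψ.IsTensorial (Set.Ioi 0)) (hy : y ∈ e.target)
    (he' : chartAt (Vec d) (e.symm y) = e) (hf' : chartAt (Vec d) (p.φ t₀ (e.symm y)) = f) :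
    p.DivP g t₀ (e.symm y) + p.ρ t₀ (e.symm y) • p.force t₀ (e.symm y)
      = p.ρ t₀ (e.symm y) • p.A g t₀ (e.symm y) := by
  have he : e ∈ atlas (Vec d) B := he' ▸ chart_mem_atlas _ _
  have hf : f ∈ atlas (Vec d) S := hf' ▸ chart_mem_atlas _ _
  have hx : p.φ t₀ (e.symm y) ∈ f.source := hf' ▸ mem_chart_source _ _
  have hDf : chartD f (p.φ t₀ (e.symm y)) = ContinuousLinearMap.id ℝ (Vec d) :=
    hf' ▸ chartD_chartAt _
  have hvol := volIn_pos (p := p) (t₀ := t₀) he hy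
  set Div : Vec d := p.DivP g t₀ (e.symm y) with hDiv
  set b : Vec d := p.force t₀ (e.symm y) with hb
  set a : Vec d := p.A g t₀ (e.symm y) with ha
  set r := p.ρ t₀ (e.symm y)
  have hforce : p.forceIn e f (t₀, y) = b := DFunLike.congr_fun hDf b
  have hacc : ∀ v, lowerAcc (metricIn g f) (fun s => motionIn p.φ e f (s, y)) t₀ v
      = metricIn g f (motionIn p.φ e f (t₀, y)) a v := fun v => by
    have h1 := inner_acceleration g hf (contMDiff_path hp.φ_smooth (e.symm y)).contMDiffAt hx
      (t := t₀) v
    have h2 : chartD f (p.φ t₀ (e.symm y)) v = v := DFunLike.congr_fun hDf v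
    rw [h2] at h1
    exact h1.symm.trans (inner_eq_metricIn_motionIn hf hx hDf a v)
  have key : ∀ v, metricIn g f (motionIn p.φ e f (t₀, y)) (Div + r • b - r • a) v = 0 := fun v => by
    have h1 := hcov.momentum hp he hf hN hE hΨ hy hx hΨt v
    have hD : _ = p.volIn e (t₀, y) • Div := volIn_smul_DivP hp hy he' hf'
    rw [hD, hacc, hforce, map_smul, _root_.smul_apply, smul_eq_mul] at h1
    have h2 : metricIn g f (motionIn p.φ e f (t₀, y)) (Div + r • b - r • a) v
        = metricIn g f (motionIn p.φ e f (t₀, y)) Div v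
          + r * metricIn g f (motionIn p.φ e f (t₀, y)) b v
          - r * metricIn g f (motionIn p.φ e f (t₀, y)) a v := by
      simp only [map_add, map_sub, map_smul, _root_.add_apply, sub_apply, _root_.smul_apply,
        smul_eq_mul]
    rw [h2]
    refine (mul_eq_zero.1 (?_ : p.volIn e (t₀, y) * _ = 0)).resolve_left hvol.ne'
    linear_combination -h1
  have hzero : Div + r • b - r • a = 0 := by
    by_contra hne
    exact (metricIn_pos g hf (f.map_source hx) _ hne).ne' (key _)
  exact sub_eq_zero.1 hzero

end GrowthProcess

end Momentum

end GrowthMechanics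

end

theorem mainTheorem1 {d : ℕ} {B S : Type*}
    [TopologicalSpace B] [T2Space B] [ChartedSpace (GrowthMechanics.Vec d) B]
    [IsManifold (GrowthMechanics.mdl d) ∞ B]
    [TopologicalSpace S] [T2Space S] [ChartedSpace (GrowthMechanics.Vec d) S]
    [IsManifold (GrowthMechanics.mdl d) ∞ S]
    (g : GrowthMechanics.Metric d S) (p : GrowthMechanics.GrowthProcess d B S) (hp : p.IsRegular)
    (E Ψ : GrowthMechanics.Response d B S)
    (entropies : Set ℝ) (h_open : IsOpen entropies) (hN : ∀ t X, p.N t X ∈ entropies)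
    (hE : E.IsSmooth entropies) (hΨ : Ψ.IsSmooth (Set.Ioi 0))
    (hE_tensorial : E.IsTensorial entropies) (hΨ_tensorial : Ψ.IsTensorial (Set.Ioi 0))
    (hEΨ : p.Helmholtz g E Ψ)
    (t₀ : ℝ)
    (h_balance : p.EnergyBalance g E t₀)
    (h_covariant : p.EnergyBalanceCovariant g E Ψ t₀) (X : B) :
    -- balance of mass
    (deriv (fun t => p.ρ t X) t₀ + (1 / 2) * p.ρ t₀ X *
      GrowthMechanics.traceForm ((p.G t₀).inner X) (p.Gdot t₀ X) = p.Sm t₀ X) ∧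
    -- balance of linear momentum
    (p.DivP g t₀ X + p.ρ t₀ X • p.force t₀ X = p.ρ t₀ X • p.A g t₀ X) ∧
    -- symmetry of the Kirchhoff stress
    (∀ α β : GrowthMechanics.Cotan d (p.φ t₀ X),
      α (p.kirchhoff t₀ X β) = β (p.kirchhoff t₀ X α)) ∧
    -- the stress is given by the free energy
    (∀ H : GrowthMechanics.Tan d X →L[ℝ] GrowthMechanics.Tan d (p.φ t₀ X),
      HasDerivAt (fun s : ℝ => p.ρ t₀ X *
          Ψ X (p.Θ t₀ X) ((p.G t₀).inner X) (p.φ t₀ X) (p.F t₀ X + s • H)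
            (g.inner (p.φ t₀ X)))
        (p.stressPairing g t₀ X H) 0) ∧
    -- the entropy is given by the free energy
    HasDerivAt (fun θ : ℝ => Ψ X θ ((p.G t₀).inner X) (p.φ t₀ X) (p.F t₀ X)
      (g.inner (p.φ t₀ X))) (-p.N t₀ X) (p.Θ t₀ X) := by
  open GrowthMechanics in
  -- in the preferred charts at `X` and at its place, components are taken by the identity
  obtain ⟨e, he⟩ : ∃ e, e = chartAt (Vec d) X := ⟨_, rfl⟩
  obtain ⟨f, hf⟩ : ∃ f, f = chartAt (Vec d) (p.φ t₀ X) := ⟨_, rfl⟩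
  have hX : X ∈ e.source := he ▸ mem_chart_source _ X
  obtain ⟨y, hy, rfl⟩ : ∃ y ∈ e.target, e.symm y = X := ⟨e X, e.map_source hX, e.left_inv hX⟩
  have hea : e ∈ atlas (Vec d) B := he ▸ chart_mem_atlas _ _
  have hfa : f ∈ atlas (Vec d) S := hf ▸ chart_mem_atlas _ _
  have hx : p.φ t₀ (e.symm y) ∈ f.source := hf ▸ mem_chart_source _ _
  have hDe : chartD e (e.symm y) = ContinuousLinearMap.id ℝ (Vec d) := by
    have h := chartD_chartAt (d := d) (e.symm y)
    rwa [← he] at h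
  have hDei : chartDi e y = ContinuousLinearMap.id ℝ (Vec d) := by
    have h := chartDi_chartAt (d := d) (e.symm y)
    rwa [← he, e.right_inv hy] at h
  have hDf : chartD f (p.φ t₀ (e.symm y)) = ContinuousLinearMap.id ℝ (Vec d) := by
    have h := chartD_chartAt (d := d) (p.φ t₀ (e.symm y))
    rwa [← hf] at h
  exact ⟨h_covariant.mass_balance hp hea hfa hN hE hΨ hy hx hDei,
    h_covariant.momentum_balance hp hN hE hΨ hΨ_tensorial hy he.symm hf.symm,
    h_covariant.kirchhoff_symm hp hea hfa hN hE hΨ hy hx hDe hDei hDf hΨ_tensorial,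
    h_covariant.hasDerivAt_stress hp hea hfa hN hE hΨ hy hx hDe hDei hDf,
    h_covariant.hasDerivAt_temperature hp hea hfa hN hE hΨ hy hx⟩
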